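/- **Conventions.** A *compact closed category* is a symmetric monoidal category $\mathcal K$ with a contravariant functor $(\_)^*$ satisfying $(\_)^{**}=\mathrm{Id}$ and arrows $\eta_A:I\to A\otimes A^*$, $\epsilon_A:A^*\otimes A\to I$ satisfying the yanking (triangle) equations, the action of $(\_)^*$ on arrows being the one determined by $\eta,\epsilon$. Its internal hom is $[A\to B]=A^*\otimes B$. A *reflexive object* is an object $R$ together with an isomorphism $\mathrm{app}:R\to[R\to R]$, with inverse $\mathrm{lam}$. A (strong symmetric) monoidal functor $F$ between compact closed categories has a canonical comparison $F[A\to B]\cong[FA\to FB]$; composing it with $F(\mathrm{app})$ gives the image under $F$ of a reflexive object. A *monoidal strictification* of the reflexivity of $R\in Ob(\mathcal K)$, with target a compact closed category $\mathcal D$, consists of a small compact closed category $\mathcal S$, a faithful monoidal functor $\Gamma:\mathcal S\to\mathcal K$, a reflexive object $N'$ of $\mathcal S$ whose image under $\Gamma$ is $R$ with its given $\mathrm{app}$, and a monoidal equivalence $E:\mathcal S\to\mathcal D$ such that $E N'=[EN'\to EN']$ and the image of $\mathrm{app}$ under $E$ is the identity arrow (hence so is that of $\mathrm{lam}$). For a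 symmetric traced monoidal category $\mathcal C$, $\mathbf{Int}\,\mathcal C$ has as objects the pairs $(X,U)$ of objects of $\mathcal C$; arrows $(X,U)\to(Y,V)$ are the arrows $X\otimes V\to Y\otimes U$ of $\mathcal C$; the composite of $f:(X,U)\to(Y,V)$ and $g:(Y,V)\to(Z,W)$ is the trace over $V$ of $(X\otimes W)\otimes V\to(Z\otimes U)\otimes V$ obtained from $f\otimes 1_W$, $g\otimes 1_U$ and the symmetries; $(X,U)\,\Box\,(X',U')=(X\otimes X',U'\otimes U)$, the unit object is $(I,I)$, $(X,U)^*=(U,X)$, and the remaining structure is given by the usual symmetry arrows. For an isomorphism (code) $c:N\otimes N\to N$ of $\mathcal C$, put $f\star g=c\,(f\otimes g)\,c^{-1}$ on $\mathcal C(N,N)$, and let $(\mathcal C(N,N),\star)_{+I}$ be the symmetric monoidal category with two objects $I,N$ obtained by taking the coproduct of the monoid $\mathcal C(N,N)$ with the terminal category $\{I\}$ and extending $\star$ by making $I$ a strict unit. On $\mathcal C(N,N)$ put $\mathrm{Tr}^N(f)=\mathrm{Tr}^N_{N,N}(c^{-1}fc)$ and $\mathrm{Tr}^I(f)=f$; all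 traces with values in the one-element hom-set at $I$ are trivial. (There are no arrows, and hence no traces, between the two different objects.) Let $\mathcal G_c$ be the full subcategory of $\mathbf{Int}\bigl((\mathcal C(N,N),\star)_{+I}\bigr)$ on the objects generated by $(N,N)$ under $\Box$ and the unit; these are $(I,I)$ and $(N,N)$, and the composites in $\mathcal G_c$ use only the traces just described. **Theorem.** Let $(\mathcal C,\otimes,\sigma,I,\mathrm{Tr})$ be a symmetric traced monoidal category with trivial scalars, i.e. $\mathcal C(I,I)=\{1_I\}$. Then $\mathbf{Int}\,\mathcal C$ is a compact closed category, and: 1. For every reflexive object $X$ of $\mathbf{Int}\,\mathcal C$ (with any choice of $\mathrm{app}$) there exists a monoidal strictification of the reflexivity of $X$, with a small target. 2. Let $N\in Ob(\mathcal C)$ be self-similar, with code isomorphism $c:N\otimes N\to N$. Then $\mathcal G_c$ is a compact closed category; $(N,N)\in Ob(\mathbf{Int}\,\mathcal C)$ is reflexive via the isomorphism $c^{-1}\otimes c:(N,N)\to(N\otimes N,N\otimes N)=[(N,N)\to(N,N)]$; and for every object $X$ of $\mathbf{Int}\,\mathcal C$ and every isomorphism $\varphi:X\cong(N,N)$, the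 reflexivity that $X$ obtains from $(N,N)$ by transport along $\varphi$ has a monoidal strictification whose target is $\mathcal G_c$, in which $\Gamma$ is also full and $E$ sends the reflexive object to $(N,N)$. -/

import Mathlib

open CategoryTheory MonoidalCategory

universe v u w

namespace StrictRefl

/-! ### Compact closed categories, internal homs, reflexivity -/

/-- A compact closed category: a symmetric monoidal category with a contravariant involution
`dual` (strictly, `dual ∘ dual = Id`) and, for every object `A`, a unit `I ⟶ A ⊗ A*` and a
counit `A* ⊗ A ⟶ I` satisfying the yanking equations. The action of the dual on arrows is the one
determined by the units and counits (`coev_natural`); such a dual is automatically a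
(contravariant) monoidal functor. -/
class CompactClosed (K : Type u) [Category.{v} K] [MonoidalCategory K] [SymmetricCategory K] where
  dual : Kᵒᵖ ⥤ K
  dual_dual : dual.rightOp ⋙ dual = 𝟭 K
  pairing : ∀ A : K, ExactPairing A (dual.obj (Opposite.op A))
  coev_natural : ∀ {A B : K} (f : A ⟶ B),
    (pairing A).coevaluation' ≫ f ▷ dual.obj (Opposite.op A) =
      (pairing B).coevaluation' ≫ B ◁ dual.map f.op

section Reflexive

variable {K : Type u} [Category.{v} K] [MonoidalCategory K] [SymmetricCategory K]
  [CompactClosed K]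

/-- The dual object `A*`. -/
abbrev dualObj (A : K) : K := CompactClosed.dual.obj (Opposite.op A)

/-- The internal hom `[A → B] = A* ⊗ B` of a compact closed category. -/
abbrev ihom (A B : K) : K := dualObj A ⊗ B

variable (K) in
/-- The unit arrow `I ⟶ A ⊗ A*`. -/
abbrev coev (A : K) : 𝟙_ K ⟶ A ⊗ dualObj A := (CompactClosed.pairing A).coevaluation'

variable (K) in
/-- The counit arrow `A* ⊗ A ⟶ I`. -/
abbrev ev (A : K) : dualObj A ⊗ A ⟶ 𝟙_ K := (CompactClosed.pairing A).evaluation'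

/-- `R` is reflexive when there is an isomorphism `R ≅ [R → R]`; a choice of such an isomorphism
consists of the arrow app (its `hom`) and the arrow lam (its `inv`). -/
abbrev Reflexivity (R : K) := R ≅ ihom R R

/-- Transport of a reflexivity along an isomorphism of objects. -/
def Reflexivity.transport {X Y : K} (φ : X ≅ Y) (app : Reflexivity Y) : Reflexivity X :=
  φ ≪≫ app ≪≫ ((CompactClosed.dual.mapIso φ.op) ⊗ᵢ φ.symm)

end Reflexive

section Functors

variable {K : Type u} [Category.{v} K] [MonoidalCategory K] [SymmetricCategory K]
  [CompactClosed K]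
  {L : Type w} [Category.{v} L] [MonoidalCategory L] [SymmetricCategory L] [CompactClosed L]

/-- The canonical comparison arrow `F (A*) ⟶ (F A)*` of a monoidal functor between compact closed
categories. -/
def dualComparison (F : K ⥤ L) [F.Monoidal] (A : K) : F.obj (dualObj A) ⟶ dualObj (F.obj A) :=
  (ρ_ _).inv ≫ F.obj (dualObj A) ◁ coev L (F.obj A) ≫ (α_ _ _ _).inv ≫
    (Functor.LaxMonoidal.μ F (dualObj A) A ≫ F.map (ev K A) ≫
      Functor.OplaxMonoidal.η F) ▷ dualObj (F.obj A) ≫ (λ_ _).hom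

/-- The canonical comparison arrow `F [A → B] ⟶ [F A → F B]`, i.e. the closed structure of
a monoidal functor between compact closed categories. -/
def ihomComparison (F : K ⥤ L) [F.Monoidal] (A B : K) :
    F.obj (ihom A B) ⟶ ihom (F.obj A) (F.obj B) :=
  Functor.OplaxMonoidal.δ F (dualObj A) B ≫ dualComparison F A ▷ F.obj B

/-- The arrow `F R ⟶ [F R → F R]` that is the image of the arrow app of `R`. -/
def mapApp (F : K ⥤ L) [F.Monoidal] {R : K} (app : Reflexivity R) :
    F.obj R ⟶ ihom (F.obj R) (F.obj R) :=
  F.map app.hom ≫ ihomComparison F R R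

end Functors

/-- A small compact closed category. -/
structure SmallCompactClosed where
  carrier : Type v
  [category : Category.{v} carrier]
  [monoidal : MonoidalCategory carrier]
  [symmetric : SymmetricCategory carrier]
  [compactClosed : CompactClosed carrier]

attribute [instance] SmallCompactClosed.category SmallCompactClosed.monoidal
  SmallCompactClosed.symmetric SmallCompactClosed.compactClosed

/-- A monoidal strictification of the reflexivity `app` of an object `R` of a compact closed
category `K`, with target the compact closed category `D`: a small compact closed category `S`, a
faithful (symmetric strong) monoidal functor `Γ : S ⥤ K`, a reflexive object `N` of `S` whose
reflexivity is sent by `Γ` to that of `R`, and a (symmetric) monoidal equivalence `E : S ⥤ D`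
under which the reflexivity of `N` becomes an identity arrow: `E N` and `[E N → E N]` are the same
object, and the image of app (hence also that of its inverse lam) is the identity. -/
structure MonoidalStrictification {K : Type u} [Category.{v} K] [MonoidalCategory K]
    [SymmetricCategory K] [CompactClosed K] (R : K) (app : Reflexivity R)
    (D : Type v) [Category.{v} D] [MonoidalCategory D] [SymmetricCategory D]
    [CompactClosed D] where
  S : SmallCompactClosed.{v}
  Γ : S.carrier ⥤ K
  braidedΓ : Γ.Braided
  faithfulΓ : Γ.Faithful
  N : S.carrier
  appN : Reflexivity N
  obj_eq : Γ.obj N = R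
  app_eq : mapApp Γ appN =
    eqToHom obj_eq ≫ app.hom ≫ eqToHom (congrArg (fun A => ihom A A) obj_eq.symm)
  E : S.carrier ⥤ D
  braidedE : E.Braided
  equivalenceE : E.IsEquivalence
  strict_obj : E.obj N = ihom (E.obj N) (E.obj N)
  strict_app : mapApp E appN = eqToHom strict_obj

/-! ### Compact closed categories given by explicit formulas

`CCData` consists of all the operations of a compact closed category, without axioms, and
`CCData.Laws` says that these operations do form a compact closed category. -/

structure CCData (K : Type u) where
  Hom : K → K → Type v
  id : ∀ A, Hom A A
  comp : ∀ {A B C}, Hom A B → Hom B C → Hom A C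
  unit : K
  tensor : K → K → K
  tensorHom : ∀ {A B A' B'}, Hom A B → Hom A' B' → Hom (tensor A A') (tensor B B')
  assoc : ∀ A B C, Hom (tensor (tensor A B) C) (tensor A (tensor B C))
  assocInv : ∀ A B C, Hom (tensor A (tensor B C)) (tensor (tensor A B) C)
  lunit : ∀ A, Hom (tensor unit A) A
  lunitInv : ∀ A, Hom A (tensor unit A)
  runit : ∀ A, Hom (tensor A unit) A
  runitInv : ∀ A, Hom A (tensor A unit)
  braid : ∀ A B, Hom (tensor A B) (tensor B A)
  dual : K → K
  dualHom : ∀ {A B}, Hom A B → Hom (dual B) (dual A)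
  coev : ∀ A, Hom unit (tensor A (dual A))
  ev : ∀ A, Hom (tensor (dual A) A) unit

structure CCData.Laws {K : Type u} (P : CCData.{v} K) : Prop where
  id_comp : ∀ {A B} (f : P.Hom A B), P.comp (P.id A) f = f
  comp_id : ∀ {A B} (f : P.Hom A B), P.comp f (P.id B) = f
  comp_assoc : ∀ {A B C D} (f : P.Hom A B) (g : P.Hom B C) (h : P.Hom C D),
    P.comp (P.comp f g) h = P.comp f (P.comp g h)
  tensor_id : ∀ A B, P.tensorHom (P.id A) (P.id B) = P.id (P.tensor A B)
  tensor_comp : ∀ {A B C A' B' C'} (f : P.Hom A B) (g : P.Hom B C) (f' : P.Hom A' B')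
    (g' : P.Hom B' C'), P.comp (P.tensorHom f f') (P.tensorHom g g') =
      P.tensorHom (P.comp f g) (P.comp f' g')
  assoc_assocInv : ∀ A B C, P.comp (P.assoc A B C) (P.assocInv A B C) = P.id _
  assocInv_assoc : ∀ A B C, P.comp (P.assocInv A B C) (P.assoc A B C) = P.id _
  assoc_natural : ∀ {A B A' B' A'' B''} (f : P.Hom A B) (f' : P.Hom A' B') (f'' : P.Hom A'' B''),
    P.comp (P.tensorHom (P.tensorHom f f') f'') (P.assoc B B' B'') =
      P.comp (P.assoc A A' A'') (P.tensorHom f (P.tensorHom f' f''))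
  lunit_lunitInv : ∀ A, P.comp (P.lunit A) (P.lunitInv A) = P.id _
  lunitInv_lunit : ∀ A, P.comp (P.lunitInv A) (P.lunit A) = P.id _
  lunit_natural : ∀ {A B} (f : P.Hom A B),
    P.comp (P.tensorHom (P.id P.unit) f) (P.lunit B) = P.comp (P.lunit A) f
  runit_runitInv : ∀ A, P.comp (P.runit A) (P.runitInv A) = P.id _
  runitInv_runit : ∀ A, P.comp (P.runitInv A) (P.runit A) = P.id _
  runit_natural : ∀ {A B} (f : P.Hom A B),
    P.comp (P.tensorHom f (P.id P.unit)) (P.runit B) = P.comp (P.runit A) f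
  pentagon : ∀ A B C D,
    P.comp (P.tensorHom (P.assoc A B C) (P.id D))
      (P.comp (P.assoc A (P.tensor B C) D) (P.tensorHom (P.id A) (P.assoc B C D))) =
    P.comp (P.assoc (P.tensor A B) C D) (P.assoc A B (P.tensor C D))
  triangle : ∀ A B,
    P.comp (P.assoc A P.unit B) (P.tensorHom (P.id A) (P.lunit B)) =
      P.tensorHom (P.runit A) (P.id B)
  braid_braid : ∀ A B, P.comp (P.braid A B) (P.braid B A) = P.id _
  braid_natural : ∀ {A B A' B'} (f : P.Hom A B) (f' : P.Hom A' B'),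
    P.comp (P.tensorHom f f') (P.braid B B') = P.comp (P.braid A A') (P.tensorHom f' f)
  hexagon : ∀ A B C,
    P.comp (P.assoc A B C) (P.comp (P.braid A (P.tensor B C)) (P.assoc B C A)) =
      P.comp (P.tensorHom (P.braid A B) (P.id C))
        (P.comp (P.assoc B A C) (P.tensorHom (P.id B) (P.braid A C)))
  hexagon_inv : ∀ A B C,
    P.comp (P.assocInv A B C) (P.comp (P.braid (P.tensor A B) C) (P.assocInv C A B)) =
      P.comp (P.tensorHom (P.id A) (P.braid B C))
        (P.comp (P.assocInv A C B) (P.tensorHom (P.braid A C) (P.id B)))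
  dual_dual : ∀ A, P.dual (P.dual A) = A
  dualHom_dualHom : ∀ {A B} (f : P.Hom A B), HEq (P.dualHom (P.dualHom f)) f
  dualHom_id : ∀ A, P.dualHom (P.id A) = P.id _
  dualHom_comp : ∀ {A B C} (f : P.Hom A B) (g : P.Hom B C),
    P.dualHom (P.comp f g) = P.comp (P.dualHom g) (P.dualHom f)
  yank : ∀ A,
    P.comp (P.tensorHom (P.coev A) (P.id A))
      (P.comp (P.assoc A (P.dual A) A) (P.tensorHom (P.id A) (P.ev A))) =
    P.comp (P.lunit A) (P.runitInv A)
  yank_dual : ∀ A,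
    P.comp (P.tensorHom (P.id (P.dual A)) (P.coev A))
      (P.comp (P.assocInv (P.dual A) A (P.dual A)) (P.tensorHom (P.ev A) (P.id (P.dual A)))) =
    P.comp (P.runit (P.dual A)) (P.lunitInv (P.dual A))
  coev_natural : ∀ {A B} (f : P.Hom A B),
    P.comp (P.coev A) (P.tensorHom f (P.id (P.dual A))) =
      P.comp (P.coev B) (P.tensorHom (P.id B) (P.dualHom f))

/-- The objects of the compact closed category with operations `P`. -/
def CCData.Laws.Obj {K : Type u} {P : CCData.{v} K} (_ : P.Laws) : Type u := K

/-- An object, regarded as an object of the compact closed category with operations `P`. -/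
def CCData.Laws.of {K : Type u} {P : CCData.{v} K} (h : P.Laws) (A : K) : h.Obj := A

namespace CCData.Laws

variable {K : Type u} {P : CCData.{v} K} (h : P.Laws)

instance : Category.{v} h.Obj where
  Hom A B := P.Hom A B
  id A := P.id A
  comp f g := P.comp f g
  id_comp := h.id_comp
  comp_id := h.comp_id
  assoc := h.comp_assoc

instance : MonoidalCategoryStruct h.Obj where
  tensorObj A B := P.tensor A B
  whiskerLeft A _ _ f := P.tensorHom (P.id A) f
  whiskerRight f B := P.tensorHom f (P.id B)
  tensorHom f g := P.tensorHom f g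
  tensorUnit := P.unit
  associator A B C :=
    { hom := P.assoc A B C
      inv := P.assocInv A B C
      hom_inv_id := h.assoc_assocInv A B C
      inv_hom_id := h.assocInv_assoc A B C }
  leftUnitor A :=
    { hom := P.lunit A
      inv := P.lunitInv A
      hom_inv_id := h.lunit_lunitInv A
      inv_hom_id := h.lunitInv_lunit A }
  rightUnitor A :=
    { hom := P.runit A
      inv := P.runitInv A
      hom_inv_id := h.runit_runitInv A
      inv_hom_id := h.runitInv_runit A }

instance : MonoidalCategory h.Obj :=
  MonoidalCategory.ofTensorHom
    (id_tensorHom_id := h.tensor_id)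
    (id_tensorHom := fun _ _ _ _ => rfl)
    (tensorHom_id := fun _ _ => rfl)
    (tensorHom_comp_tensorHom := fun f₁ f₂ g₁ g₂ => h.tensor_comp f₁ g₁ f₂ g₂)
    (associator_naturality := h.assoc_natural)
    (leftUnitor_naturality := h.lunit_natural)
    (rightUnitor_naturality := h.runit_natural)
    (pentagon := h.pentagon)
    (triangle := h.triangle)

instance : SymmetricCategory h.Obj where
  braiding A B :=
    { hom := P.braid A B
      inv := P.braid B A
      hom_inv_id := h.braid_braid A B
      inv_hom_id := h.braid_braid B A }
  braiding_naturality_right A _ _ f := h.braid_natural (P.id A) f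
  braiding_naturality_left f C := h.braid_natural f (P.id C)
  hexagon_forward := h.hexagon
  hexagon_reverse := h.hexagon_inv
  symmetry := h.braid_braid

instance : CompactClosed h.Obj where
  dual :=
    { obj := fun A => P.dual A.unop
      map := fun f => P.dualHom f.unop
      map_id := fun A => h.dualHom_id A.unop
      map_comp := fun f g => h.dualHom_comp g.unop f.unop }
  dual_dual := CategoryTheory.Functor.hext h.dual_dual fun _ _ f => h.dualHom_dualHom f
  pairing A :=
    { coevaluation' := P.coev A
      evaluation' := P.ev A
      coevaluation_evaluation' := h.yank_dual A
      evaluation_coevaluation' := h.yank A }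
  coev_natural f := h.coev_natural f

end CCData.Laws

/-! ### Traced symmetric monoidal categories -/

section Wiring

variable {C : Type u} [Category.{v} C] [MonoidalCategory C] [SymmetricCategory C]

/-- The canonical arrow exchanging the last two of three tensor factors. -/
def rswap (A B D : C) : (A ⊗ B) ⊗ D ⟶ (A ⊗ D) ⊗ B :=
  (α_ A B D).hom ≫ A ◁ (β_ B D).hom ≫ (α_ A D B).inv

end Wiring

/-- A trace on a symmetric monoidal category. -/
class Traced (C : Type u) [Category.{v} C] [MonoidalCategory C] [SymmetricCategory C] where
  tr : ∀ {X Y : C} (U : C), (X ⊗ U ⟶ Y ⊗ U) → (X ⟶ Y)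
  natural_left : ∀ {X' X Y : C} (U : C) (g : X' ⟶ X) (f : X ⊗ U ⟶ Y ⊗ U),
    tr U (g ▷ U ≫ f) = g ≫ tr U f
  natural_right : ∀ {X Y Y' : C} (U : C) (f : X ⊗ U ⟶ Y ⊗ U) (g : Y ⟶ Y'),
    tr U (f ≫ g ▷ U) = tr U f ≫ g
  dinatural : ∀ {X Y U V : C} (f : X ⊗ U ⟶ Y ⊗ V) (g : V ⟶ U),
    tr U (f ≫ Y ◁ g) = tr V (X ◁ g ≫ f)
  vanishing_unit : ∀ {X Y : C} (f : X ⊗ 𝟙_ C ⟶ Y ⊗ 𝟙_ C),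
    tr (𝟙_ C) f = (ρ_ X).inv ≫ f ≫ (ρ_ Y).hom
  vanishing_tensor : ∀ {X Y : C} (U V : C) (f : X ⊗ (U ⊗ V) ⟶ Y ⊗ (U ⊗ V)),
    tr (U ⊗ V) f = tr U (tr V ((α_ X U V).hom ≫ f ≫ (α_ Y U V).inv))
  yanking : ∀ U : C, tr U (β_ U U).hom = 𝟙 U
  superposing : ∀ {X Y A B : C} (U : C) (f : X ⊗ U ⟶ Y ⊗ U) (g : A ⟶ B),
    tr U f ⊗ₘ g = tr U (rswap X A U ≫ (f ⊗ₘ g) ≫ rswap Y U B)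

/-! ### The Int construction -/

/-- The objects of `Int C`: pairs of objects of `C`. -/
structure IntObj (C : Type u) where
  pos : C
  neg : C

namespace IntObj

variable {C : Type u} [Category.{v} C] [MonoidalCategory C] [SymmetricCategory C]

/-- Arrows `(X, U) ⟶ (Y, V)` of `Int C` are arrows `X ⊗ V ⟶ Y ⊗ U` of `C`. -/
abbrev Hom (A B : IntObj C) : Type v := A.pos ⊗ B.neg ⟶ B.pos ⊗ A.neg

/-- The arrow whose trace over `V` is the composite of `f : (X, U) ⟶ (Y, V)` and
`g : (Y, V) ⟶ (Z, W)`. -/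
def cut {A B D : IntObj C} (f : Hom A B) (g : Hom B D) :
    (A.pos ⊗ D.neg) ⊗ B.neg ⟶ (D.pos ⊗ A.neg) ⊗ B.neg :=
  rswap A.pos D.neg B.neg ≫ f ▷ D.neg ≫ rswap B.pos A.neg D.neg ≫ g ▷ A.neg ≫
    rswap D.pos B.neg A.neg

variable (C) in
def unit : IntObj C := ⟨𝟙_ C, 𝟙_ C⟩

def tensor (A B : IntObj C) : IntObj C := ⟨A.pos ⊗ B.pos, B.neg ⊗ A.neg⟩

def dual (A : IntObj C) : IntObj C := ⟨A.neg, A.pos⟩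

def tensorHom {A B A' B' : IntObj C} (f : Hom A B) (g : Hom A' B') :
    Hom (tensor A A') (tensor B B') :=
  (A.pos ⊗ A'.pos) ◁ (β_ B'.neg B.neg).hom ≫ tensorμ A.pos A'.pos B.neg B'.neg ≫
    (f ⊗ₘ g) ≫ tensorμ B.pos A.neg B'.pos A'.neg ≫
      (B.pos ⊗ B'.pos) ◁ (β_ A.neg A'.neg).hom

def dualHom {A B : IntObj C} (f : Hom A B) : Hom (dual B) (dual A) :=
  (β_ B.neg A.pos).hom ≫ f ≫ (β_ B.pos A.neg).hom

/-- The arrow `(X, U) ⟶ (Y, V)` of `Int C` given by `p : X ⟶ Y` and `q : V ⟶ U`. -/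
def ofPair {A B : IntObj C} (p : A.pos ⟶ B.pos) (q : B.neg ⟶ A.neg) : Hom A B := p ⊗ₘ q

end IntObj

section

variable (C : Type u) [Category.{v} C] [MonoidalCategory C] [SymmetricCategory C] [Traced C]

open IntObj

/-- The compact closed category `Int C`. -/
def intData : CCData.{v} (IntObj C) where
  Hom := Hom
  id A := ofPair (𝟙 A.pos) (𝟙 A.neg)
  comp {_ B _} f g := Traced.tr B.neg (cut f g)
  unit := unit C
  tensor := tensor
  tensorHom := IntObj.tensorHom
  assoc A B D := ofPair (A := tensor (tensor A B) D) (B := tensor A (tensor B D))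
    (α_ A.pos B.pos D.pos).hom (α_ D.neg B.neg A.neg).hom
  assocInv A B D := ofPair (A := tensor A (tensor B D)) (B := tensor (tensor A B) D)
    (α_ A.pos B.pos D.pos).inv (α_ D.neg B.neg A.neg).inv
  lunit A := ofPair (A := tensor (unit C) A) (B := A) (λ_ A.pos).hom (ρ_ A.neg).inv
  lunitInv A := ofPair (A := A) (B := tensor (unit C) A) (λ_ A.pos).inv (ρ_ A.neg).hom
  runit A := ofPair (A := tensor A (unit C)) (B := A) (ρ_ A.pos).hom (λ_ A.neg).inv
  runitInv A := ofPair (A := A) (B := tensor A (unit C)) (ρ_ A.pos).inv (λ_ A.neg).hom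
  braid A B := ofPair (A := tensor A B) (B := tensor B A)
    (β_ A.pos B.pos).hom (β_ A.neg B.neg).hom
  dual := dual
  dualHom := dualHom
  coev A := (β_ (𝟙_ C) (A.pos ⊗ A.neg)).hom
  ev A := (β_ (A.neg ⊗ A.pos) (𝟙_ C)).hom

/-- The object `(N, N)` of `Int C`. -/
def diag {C : Type u} (N : C) : IntObj C := ⟨N, N⟩

/-- For a code isomorphism `c : N ⊗ N ≅ N`, the arrow `decode ⊗ code` of `Int C` from `(N, N)` to
`(N, N)* ⊗ (N, N) = (N ⊗ N, N ⊗ N)`. -/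
def codeApp {C : Type u} [Category.{v} C] [MonoidalCategory C] [SymmetricCategory C] [Traced C]
    {N : C} (c : N ⊗ N ≅ N) : (intData C).Hom (diag N) (tensor (dual (diag N)) (diag N)) :=
  ofPair (A := diag N) (B := tensor (dual (diag N)) (diag N)) c.inv c.hom

end

/-! ### The monoid `(C(N, N), ⋆)` with a unit object adjoined -/

/-- The two objects of `(C(N, N), ⋆)₊ᵢ`, where `N` is an object of `C` with code isomorphism
`c : N ⊗ N ≅ N`: the adjoined unit object, and the unique object of the monoid `C(N, N)`. -/
inductive Star {C : Type u} [Category.{v} C] [MonoidalCategory C] {N : C} (c : N ⊗ N ≅ N) : Type v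
  | unit : Star c
  | pt : Star c

namespace Star

variable {C : Type u} [Category.{v} C] [MonoidalCategory C]
  {N : C} {c : N ⊗ N ≅ N}

/-- The hom-sets of the coproduct of the terminal category and the monoid `C(N, N)`. -/
def Hom : Star c → Star c → Type v
  | unit, unit => PUnit
  | pt, pt => N ⟶ N
  | unit, pt => PEmpty
  | pt, unit => PEmpty

def comp : ∀ {X Y Z : Star c}, Hom X Y → Hom Y Z → Hom X Z
  | unit, unit, unit, _, _ => PUnit.unit
  | pt, pt, pt, f, g => CategoryStruct.comp (obj := C) (X := N) (Y := N) (Z := N) f g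
  | unit, pt, _, f, _ => PEmpty.elim f
  | pt, unit, _, f, _ => PEmpty.elim f
  | unit, unit, pt, _, g => PEmpty.elim g
  | pt, pt, unit, _, g => PEmpty.elim g

instance : Category.{v} (Star c) where
  Hom := Hom
  id
    | unit => PUnit.unit
    | pt => 𝟙 N
  comp := comp
  id_comp {X Y} f := by
    cases X <;> cases Y <;>
      first | rfl | exact PEmpty.elim f | exact Category.id_comp (X := N) (Y := N) f
  comp_id {X Y} f := by
    cases X <;> cases Y <;>
      first | rfl | exact PEmpty.elim f | exact Category.comp_id (X := N) (Y := N) f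
  assoc {W X Y Z} f g h := by
    cases W <;> cases X <;> cases Y <;> cases Z <;>
      first
      | rfl
      | exact PEmpty.elim f
      | exact PEmpty.elim g
      | exact PEmpty.elim h
      | exact Category.assoc (W := N) (X := N) (Y := N) (Z := N) f g h

/-- An element of `C(N, N)`, as an arrow of `(C(N, N), ⋆)₊ᵢ`. -/
abbrev ofEnd (f : N ⟶ N) : (pt : Star c) ⟶ pt := f

/-- The element of `C(N, N)` given by an arrow of `(C(N, N), ⋆)₊ᵢ`. -/
abbrev toEnd (f : (pt : Star c) ⟶ pt) : N ⟶ N := f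

def objC : Star c → C
  | unit => 𝟙_ C
  | pt => N

def mapC : ∀ {X Y : Star c}, (X ⟶ Y) → (objC X ⟶ objC Y)
  | unit, unit, _ => 𝟙 (𝟙_ C)
  | pt, pt, f => toEnd f
  | unit, pt, f => PEmpty.elim f
  | pt, unit, f => PEmpty.elim f

/-- The faithful functor to `C` that sends the adjoined unit object to `I` and the other object
to `N`. -/
def toC : Star c ⥤ C where
  obj := objC
  map := mapC
  map_id X := by cases X <;> rfl
  map_comp {X Y Z} f g := by
    cases X <;> cases Y <;> cases Z <;>
      first
      | rfl
      | exact PEmpty.elim f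
      | exact PEmpty.elim g
      | exact (Category.id_comp (𝟙 (𝟙_ C))).symm

instance : (toC (c := c)).Faithful where
  map_injective {X Y} f g h := by
    cases X <;> cases Y <;> first | rfl | exact PEmpty.elim f | exact h

/-- The tensor on objects: `I` is a strict unit, and `N ⋆ N = N`. -/
def tensor : Star c → Star c → Star c
  | unit, Y => Y
  | pt, _ => pt

/-- The tensor on arrows: `f ⋆ g = code ∘ (f ⊗ g) ∘ decode` on `C(N, N)`, extended by
strictness of the unit. -/
def tensorHom : ∀ {X Y X' Y' : Star c}, (X ⟶ Y) → (X' ⟶ Y') → (tensor X X' ⟶ tensor Y Y')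
  | unit, unit, _, _, _, g => g
  | pt, pt, unit, unit, f, _ => f
  | pt, pt, pt, pt, f, g => ofEnd (c.inv ≫ (toEnd f ⊗ₘ toEnd g) ≫ c.hom)
  | unit, pt, _, _, f, _ => PEmpty.elim f
  | pt, unit, _, _, f, _ => PEmpty.elim f
  | pt, pt, unit, pt, _, g => PEmpty.elim g
  | pt, pt, pt, unit, _, g => PEmpty.elim g

/-- The associativity isomorphism of `⋆` on `C(N, N)`. -/
def assocEnd (c : N ⊗ N ≅ N) : (pt : Star c) ≅ pt where
  hom := ofEnd (c.inv ≫ c.inv ▷ N ≫ (α_ N N N).hom ≫ N ◁ c.hom ≫ c.hom)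
  inv := ofEnd (c.inv ≫ N ◁ c.inv ≫ (α_ N N N).inv ≫ c.hom ▷ N ≫ c.hom)
  hom_inv_id := by
    change (c.inv ≫ c.inv ▷ N ≫ (α_ N N N).hom ≫ N ◁ c.hom ≫ c.hom) ≫
      (c.inv ≫ N ◁ c.inv ≫ (α_ N N N).inv ≫ c.hom ▷ N ≫ c.hom) = 𝟙 N
    simp
  inv_hom_id := by
    change (c.inv ≫ N ◁ c.inv ≫ (α_ N N N).inv ≫ c.hom ▷ N ≫ c.hom) ≫
      (c.inv ≫ c.inv ▷ N ≫ (α_ N N N).hom ≫ N ◁ c.hom ≫ c.hom) = 𝟙 N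
    simp

def assoc : ∀ X Y Z : Star c, tensor (tensor X Y) Z ≅ tensor X (tensor Y Z)
  | unit, Y, Z => Iso.refl (tensor Y Z)
  | pt, unit, _ => Iso.refl pt
  | pt, pt, unit => Iso.refl pt
  | pt, pt, pt => assocEnd c

def rightUnit : ∀ X : Star c, tensor X unit ≅ X
  | unit => Iso.refl unit
  | pt => Iso.refl pt

instance : MonoidalCategoryStruct (Star c) where
  tensorObj := tensor
  tensorUnit := unit
  tensorHom := tensorHom
  whiskerLeft X _ _ g := tensorHom (𝟙 X) g
  whiskerRight f Y := tensorHom f (𝟙 Y)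
  associator := assoc
  leftUnitor X := Iso.refl X
  rightUnitor := rightUnit

def muIso : ∀ X Y : Star c, objC X ⊗ objC Y ≅ objC (tensor X Y)
  | unit, Y => λ_ (objC Y)
  | pt, unit => ρ_ N
  | pt, pt => c

theorem mapC_tensorHom {X Y X' Y' : Star c} (f : X ⟶ Y) (g : X' ⟶ Y') :
    mapC (tensorHom f g) = (muIso X X').inv ≫ (mapC f ⊗ₘ mapC g) ≫ (muIso Y Y').hom := by
  cases X <;> cases Y <;> first | exact PEmpty.elim f | skip
  all_goals cases X' <;> cases Y' <;> first | exact PEmpty.elim g | skip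
  · change 𝟙 (𝟙_ C) = (λ_ (𝟙_ C)).inv ≫ (𝟙 (𝟙_ C) ⊗ₘ 𝟙 (𝟙_ C)) ≫ (λ_ (𝟙_ C)).hom
    simp
  · change toEnd g = (λ_ N).inv ≫ (𝟙 (𝟙_ C) ⊗ₘ toEnd g) ≫ (λ_ N).hom
    simp
  · change toEnd f = (ρ_ N).inv ≫ (toEnd f ⊗ₘ 𝟙 (𝟙_ C)) ≫ (ρ_ N).hom
    simp
  · rfl

theorem mapC_assoc (X Y Z : Star c) :
    mapC (assoc X Y Z).hom = (muIso (tensor X Y) Z).inv ≫ (muIso X Y).inv ▷ objC Z ≫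
      (α_ (objC X) (objC Y) (objC Z)).hom ≫ objC X ◁ (muIso Y Z).hom ≫
        (muIso X (tensor Y Z)).hom := by
  cases X
  · have e : mapC (assoc unit Y Z).hom = 𝟙 (objC (tensor Y Z)) := toC.map_id (tensor Y Z)
    rw [e]
    change _ = (muIso Y Z).inv ≫ (λ_ (objC Y)).inv ▷ objC Z ≫
      (α_ (𝟙_ C) (objC Y) (objC Z)).hom ≫ 𝟙_ C ◁ (muIso Y Z).hom ≫ (λ_ (objC (tensor Y Z))).hom
    simp
  · cases Y
    · have e : mapC (assoc (c := c) pt unit Z).hom = 𝟙 N := rfl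
      rw [e]
      cases Z
      · change _ = (ρ_ N).inv ≫ (ρ_ N).inv ▷ 𝟙_ C ≫ (α_ N (𝟙_ C) (𝟙_ C)).hom ≫
          N ◁ (λ_ (𝟙_ C)).hom ≫ (ρ_ N).hom
        simp
      · change _ = c.inv ≫ (ρ_ N).inv ▷ N ≫ (α_ N (𝟙_ C) N).hom ≫ N ◁ (λ_ N).hom ≫ c.hom
        simp
    · cases Z
      · change 𝟙 N = (ρ_ N).inv ≫ c.inv ▷ 𝟙_ C ≫ (α_ N N (𝟙_ C)).hom ≫ N ◁ (ρ_ N).hom ≫ c.hom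
        simp
      · rfl

/-- The operations on `(C(N, N), ⋆)₊ᵢ` correspond to those of `C`. -/
def inducing : Monoidal.InducingFunctorData (toC (c := c)) where
  μIso := muIso
  εIso := Iso.refl _
  whiskerLeft_eq X _ _ f := by
    refine (mapC_tensorHom (𝟙 X) f).trans ?_
    have e : mapC (𝟙 X) = 𝟙 (objC X) := toC.map_id X
    rw [e, id_tensorHom]
    rfl
  whiskerRight_eq f Y := by
    refine (mapC_tensorHom f (𝟙 Y)).trans ?_
    have e : mapC (𝟙 Y) = 𝟙 (objC Y) := toC.map_id Y
    rw [e, tensorHom_id]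
    rfl
  tensorHom_eq f g := mapC_tensorHom f g
  associator_eq X Y Z := by
    refine (mapC_assoc X Y Z).trans ?_
    rw [← id_tensorHom, ← tensorHom_id]
    change _ = ((muIso (tensor X Y) Z).inv ≫ ((muIso X Y).inv ⊗ₘ 𝟙 (objC Z))) ≫
      (α_ (objC X) (objC Y) (objC Z)).hom ≫
        ((𝟙 (objC X) ⊗ₘ (muIso Y Z).hom) ≫ (muIso X (tensor Y Z)).hom)
    simp only [Category.assoc]
  leftUnitor_eq X := by
    have e : toC.map (λ_ X).hom = 𝟙 (objC X) := toC.map_id X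
    rw [e]
    change _ = ((λ_ (objC X)).inv ≫ (𝟙 (𝟙_ C) ⊗ₘ 𝟙 (objC X))) ≫ (λ_ (objC X)).hom
    simp
  rightUnitor_eq X := by
    cases X
    · change 𝟙 (𝟙_ C) = ((λ_ (𝟙_ C)).inv ≫ (𝟙 (𝟙_ C) ⊗ₘ 𝟙 (𝟙_ C))) ≫ (ρ_ (𝟙_ C)).hom
      rw [← unitors_equal]
      simp
    · change 𝟙 N = ((ρ_ N).inv ≫ (𝟙 N ⊗ₘ 𝟙 (𝟙_ C))) ≫ (ρ_ N).hom
      simp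

instance : MonoidalCategory (Star c) := Monoidal.induced toC inducing

instance : (toC (c := c)).Monoidal := Monoidal.fromInducedMonoidal toC inducing

section Symmetric

variable {C : Type u} [Category.{v} C] [MonoidalCategory C] [SymmetricCategory C]
  {N : C} {c : N ⊗ N ≅ N}

/-- The symmetry of `⋆` on `C(N, N)`. -/
def braidEnd (c : N ⊗ N ≅ N) : (pt : Star c) ≅ pt where
  hom := ofEnd (c.inv ≫ (β_ N N).hom ≫ c.hom)
  inv := ofEnd (c.inv ≫ (β_ N N).hom ≫ c.hom)
  hom_inv_id := by
    change (c.inv ≫ (β_ N N).hom ≫ c.hom) ≫ (c.inv ≫ (β_ N N).hom ≫ c.hom) = 𝟙 N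
    simp
  inv_hom_id := by
    change (c.inv ≫ (β_ N N).hom ≫ c.hom) ≫ (c.inv ≫ (β_ N N).hom ≫ c.hom) = 𝟙 N
    simp

def braid : ∀ X Y : Star c, tensor X Y ≅ tensor Y X
  | unit, unit => Iso.refl unit
  | unit, pt => Iso.refl pt
  | pt, unit => Iso.refl pt
  | pt, pt => braidEnd c

theorem mapC_braid (X Y : Star c) :
    (muIso X Y).hom ≫ mapC (braid X Y).hom = (β_ (objC X) (objC Y)).hom ≫ (muIso Y X).hom := by
  cases X <;> cases Y
  · change (λ_ (𝟙_ C)).hom ≫ 𝟙 (𝟙_ C) = (β_ (𝟙_ C) (𝟙_ C)).hom ≫ (λ_ (𝟙_ C)).hom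
    rw [braiding_tensorUnit_left, unitors_equal]
    simp
  · change (λ_ N).hom ≫ 𝟙 N = (β_ (𝟙_ C) N).hom ≫ (ρ_ N).hom
    simp
  · change (ρ_ N).hom ≫ 𝟙 N = (β_ N (𝟙_ C)).hom ≫ (λ_ N).hom
    simp
  · change c.hom ≫ (c.inv ≫ (β_ N N).hom ≫ c.hom) = (β_ N N).hom ≫ c.hom
    simp

instance : BraidedCategory (Star c) :=
  BraidedCategory.ofFaithful toC braid mapC_braid

instance : SymmetricCategory (Star c) where
  symmetry X Y := by
    cases X <;> cases Y
    · rfl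
    · exact (braid unit pt).hom_inv_id
    · exact (braid pt unit).hom_inv_id
    · exact (braidEnd c).hom_inv_id

variable [Traced C]

/-- The trace of `(C(N, N), ⋆)₊ᵢ`. Between different objects there are no arrows, hence no
trace; on `C(N, N)` the trace over `N` is that of `decode ≫ f ≫ code`, and the remaining traces are
determined by vanishing over the unit object and triviality of scalars. -/
def tr : ∀ {X Y : Star c} (U : Star c), X = Y → (X ⊗ U ⟶ Y ⊗ U) → (X ⟶ Y)
  | unit, unit, _, _, _ => 𝟙 unit
  | pt, pt, unit, _, f => f
  | pt, pt, pt, _, f => ofEnd (Traced.tr N (c.hom ≫ toEnd f ≫ c.inv))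
  | unit, pt, _, h, _ => nomatch h
  | pt, unit, _, h, _ => nomatch h

end Symmetric

end Star

/-! ### The subcategory of `Int((C(N, N), ⋆)₊ᵢ)` generated by `(N, N)` -/

section Generated

variable {C : Type u} [Category.{v} C] [MonoidalCategory C] {N : C} (c : N ⊗ N ≅ N)

open IntObj

/-- The objects generated by `(N, N)` under the tensor of the Int construction. -/
inductive Gen : IntObj (Star c) → Prop
  | base : Gen ⟨Star.pt, Star.pt⟩
  | unit : Gen (unit (Star c))
  | tensor {A B : IntObj (Star c)} : Gen A → Gen B → Gen (tensor A B)

variable {c}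

/-- The only generated objects are `(I, I)` and `(N, N)`. -/
theorem Gen.cases_eq {A : IntObj (Star c)} (h : Gen c A) :
    A = ⟨Star.unit, Star.unit⟩ ∨ A = ⟨Star.pt, Star.pt⟩ := by
  induction h with
  | base => exact Or.inr rfl
  | unit => exact Or.inl rfl
  | tensor _ _ hA hB =>
    rcases hA with rfl | rfl <;> rcases hB with rfl | rfl
    · exact Or.inl rfl
    · exact Or.inr rfl
    · exact Or.inr rfl
    · exact Or.inr rfl

theorem Gen.dual {A : IntObj (Star c)} (h : Gen c A) : Gen c (IntObj.dual A) := by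
  rcases h.cases_eq with rfl | rfl
  · exact Gen.unit
  · exact Gen.base

/-- The traces occurring in composites of arrows between generated objects exist. -/
theorem Gen.tensor_eq {A B : IntObj (Star c)} (hA : Gen c A) (hB : Gen c B) :
    A.pos ⊗ B.neg = B.pos ⊗ A.neg := by
  rcases hA.cases_eq with rfl | rfl <;> rcases hB.cases_eq with rfl | rfl <;> rfl

variable {C : Type u} [Category.{v} C] [MonoidalCategory C] [SymmetricCategory C] [Traced C]
  {N : C} (c : N ⊗ N ≅ N)

/-- The full subcategory of `Int((C(N, N), ⋆)₊ᵢ)` generated by `(N, N)`, with the operations of the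
Int construction. -/
def genData : CCData.{v} {A : IntObj (Star c) // Gen c A} where
  Hom A B := Hom A.1 B.1
  id A := ofPair (𝟙 A.1.pos) (𝟙 A.1.neg)
  comp {A B D} f g := Star.tr B.1.neg (Gen.tensor_eq A.2 D.2) (cut f g)
  unit := ⟨unit (Star c), Gen.unit⟩
  tensor A B := ⟨tensor A.1 B.1, Gen.tensor A.2 B.2⟩
  tensorHom f g := IntObj.tensorHom f g
  assoc A B D := ofPair (A := tensor (tensor A.1 B.1) D.1) (B := tensor A.1 (tensor B.1 D.1))
    (α_ A.1.pos B.1.pos D.1.pos).hom (α_ D.1.neg B.1.neg A.1.neg).hom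
  assocInv A B D := ofPair (A := tensor A.1 (tensor B.1 D.1)) (B := tensor (tensor A.1 B.1) D.1)
    (α_ A.1.pos B.1.pos D.1.pos).inv (α_ D.1.neg B.1.neg A.1.neg).inv
  lunit A := ofPair (A := tensor (unit (Star c)) A.1) (B := A.1) (λ_ A.1.pos).hom (ρ_ A.1.neg).inv
  lunitInv A :=
    ofPair (A := A.1) (B := tensor (unit (Star c)) A.1) (λ_ A.1.pos).inv (ρ_ A.1.neg).hom
  runit A := ofPair (A := tensor A.1 (unit (Star c))) (B := A.1) (ρ_ A.1.pos).hom (λ_ A.1.neg).inv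
  runitInv A :=
    ofPair (A := A.1) (B := tensor A.1 (unit (Star c))) (ρ_ A.1.pos).inv (λ_ A.1.neg).hom
  braid A B := ofPair (A := tensor A.1 B.1) (B := tensor B.1 A.1)
    (β_ A.1.pos B.1.pos).hom (β_ A.1.neg B.1.neg).hom
  dual A := ⟨dual A.1, A.2.dual⟩
  dualHom f := dualHom f
  coev A := (β_ (𝟙_ (Star c)) (A.1.pos ⊗ A.1.neg)).hom
  ev A := (β_ (A.1.neg ⊗ A.1.pos) (𝟙_ (Star c))).hom

/-- The object `(N, N)` of the generated subcategory. -/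
def genBase : {A : IntObj (Star c) // Gen c A} := ⟨⟨Star.pt, Star.pt⟩, Gen.base⟩

end Generated

end StrictRefl

namespace StrictRefl

/-! ### Coherence for symmetric monoidal categories

Two composites of structural arrows with the same source agree as soon as the source is
multilinear, i.e. no variable occurs twice in it. -/

namespace Coherence

/-! Both strictifications have the same form: a category on two objects, `I` and `N`, that carries a
copy of the structure of `Int C` and in which `N ⊗ N = N` and `N* = N` hold by definition. It has a
functor to `Int C` that is injective on arrows and respects all operations up to coherent
isomorphisms, so the compact closed laws are inherited (`Embedding.laws`). The comparison
isomorphisms are chosen so that the identity `N ⟶ [N → N]` is sent to the prescribed `app`. Hence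
the target can be the two-object category itself, with `E` the identity functor
(`Embedding.strictification`).

For an arbitrary reflexive `X` of `Int C`, the delicate point is that the copied dual must be
strictly involutive on arrows. In `Int C` the object `[X → X]` equals its own dual, so `d = app ≫
app*` is an isomorphism from `X` to `X*`, and `d* = d`. This symmetry makes `f ↦ d ≫ f* ≫ d⁻¹` an
involution (`dualHom_dualHom_of_symm`). Replacing `X*` by `X` along `d` turns `app` into an
isomorphism `X ≅ X ⊗ X`.

For the code `c`, the functor `Star.toC` is faithful, strong and symmetric monoidal, and it carries
the prescribed traces to those of `C`; trivial scalars take care of the traces at `I`. Its action on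
Int arrows (`imap`) therefore embeds the generated category in `Int C` (`genEmbedding`), with no
need to verify trace axioms on `Star c`. Trivial scalars also give fullness. `Embedding.conj` then
puts `X` in the place of `(N, N)`.

That `Int C` is compact closed is a computation with wires and loops. Arrows of the form `p ⊗ₘ q`
compose without any trace (`icomp_pair`, `pair_icomp`), so the laws between structural arrows reduce
to those of `C`. The other laws rest on exchanging loops (`tr_tr_swap`) and straightening them
(`tr_yank`). The remaining equalities of wire permutations are instances of the coherence theorem
`Wiring.unique`: every structural arrow commutes with the isomorphism that sorts a multilinear
formal product into a fixed order of its variables. -/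

/-- `Mg a b c`: the bit `c` is the disjoint union of the bits `a` and `b`. -/
def Mg : Bool → Bool → Bool → Prop
  | false, false, false => True
  | true, false, true => True
  | false, true, true => True
  | _, _, _ => False

theorem Mg.or {a b : Bool} (h : (a && b) = false) : Mg a b (a || b) := by
  cases a <;> cases b <;> simp_all [Mg]

theorem Mg.false_left (a : Bool) : Mg false a a := by cases a <;> trivial

theorem Mg.symm {a b c : Bool} (h : Mg a b c) : Mg b a c := by
  cases a <;> cases b <;> cases c <;> simp_all [Mg]

/-! ### Sorted tensor products and their merging -/

section

variable {C : Type u} [Category.{v} C] [MonoidalCategory C]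

/-- The object `X`, or the unit object if the bit is off. -/
def slot (X : C) : Bool → C
  | true => X
  | false => 𝟙_ C

/-- At most one of the two factors differs from the unit, so unitors suffice. The excluded case of
two copies of `X` is where multilinearity enters the coherence theorem. -/
def slotMul (X : C) : ∀ a b c : Bool, Mg a b c → (slot X a ⊗ slot X b ≅ slot X c)
  | false, false, false, _ => λ_ (𝟙_ C)
  | true, false, true, _ => ρ_ X
  | false, true, true, _ => λ_ X
  | true, true, _, h => h.elim
  | false, false, true, h => h.elim
  | true, false, false, h => h.elim
  | false, true, false, h => h.elim

theorem slotMul_assoc (X : C) {a b c p q w : Bool} (h₁ : Mg a b p) (h₂ : Mg p c w)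
    (h₃ : Mg b c q) (h₄ : Mg a q w) :
    (slotMul X a b p h₁).hom ▷ slot X c ≫ (slotMul X p c w h₂).hom =
      (α_ _ _ _).hom ≫ slot X a ◁ (slotMul X b c q h₃).hom ≫ (slotMul X a q w h₄).hom := by
  cases a <;> cases b <;> cases p <;> first | exact h₁.elim | skip
  all_goals cases c <;> cases w <;> first | exact h₂.elim | skip
  all_goals cases q <;> first | exact h₃.elim | skip
  all_goals dsimp only [slotMul, slot]; monoidal

theorem slotMul_left (X : C) {a : Bool} (h : Mg false a a) :
    (slotMul X false a a h).hom = (λ_ (slot X a)).hom := by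
  cases a <;> rfl

end

section

variable {C : Type u} [Category.{v} C] [MonoidalCategory C] [SymmetricCategory C]

theorem slotMul_comm (X : C) {a b c : Bool} (h : Mg a b c) (h' : Mg b a c) :
    (β_ (slot X a) (slot X b)).hom ≫ (slotMul X b a c h').hom = (slotMul X a b c h).hom := by
  cases a <;> cases b <;> cases c <;> first | exact h.elim | skip
  all_goals simp [slotMul, slot, ← unitors_equal]

/-- After shuffling, the braiding of two pairs acts componentwise. This is what lets commutativity
of merging be proved by induction on the number of variables. -/
theorem braiding_tensorμ (A B A' B' : C) :
    (β_ (A ⊗ B) (A' ⊗ B')).hom ≫ tensorμ A' B' A B =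
      tensorμ A B A' B' ≫ ((β_ A A').hom ⊗ₘ (β_ B B').hom) := by
  simp [tensorμ, SymmetricCategory.braiding_swap_eq_inv_braiding B' A, MonoidalCategory.tensorHom_def]

/-- The tensor product of those of the `X i` whose bit is on. -/
def slots : ∀ (n : ℕ), (Fin n → C) → (Fin n → Bool) → C
  | 0, _, _ => 𝟙_ C
  | n + 1, X, s => slot (X 0) (s 0) ⊗ slots n (fun i => X i.succ) (fun i => s i.succ)

def slotsMul : ∀ (n : ℕ) (X : Fin n → C) (s t r : Fin n → Bool),
    (∀ i, Mg (s i) (t i) (r i)) → (slots n X s ⊗ slots n X t ≅ slots n X r)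
  | 0, _, _, _, _, _ => λ_ (𝟙_ C)
  | n + 1, X, s, t, r, h =>
    { hom := tensorμ _ _ _ _
      inv := tensorδ _ _ _ _ : _ ≅ (slot (X 0) (s 0) ⊗ slot (X 0) (t 0)) ⊗
        (slots n (fun i => X i.succ) (fun i => s i.succ) ⊗
          slots n (fun i => X i.succ) (fun i => t i.succ)) } ≪≫
    (slotMul (X 0) (s 0) (t 0) (r 0) (h 0) ⊗ᵢ
      slotsMul n (fun i => X i.succ) (fun i => s i.succ) (fun i => t i.succ)
        (fun i => r i.succ) (fun i => h i.succ))

/-- The bits are arbitrary, with a pointwise equation, instead of the constant function: supports of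
formal objects and restrictions along `Fin.succ` then fit without casts. -/
def slotsUnit : ∀ (n : ℕ) (X : Fin n → C) (s : Fin n → Bool), (∀ i, s i = false) →
    (𝟙_ C ≅ slots n X s)
  | 0, _, _, _ => Iso.refl _
  | n + 1, X, s, h => (λ_ (𝟙_ C)).symm ≪≫
    (eqToIso (congrArg (slot (X 0)) (h 0)).symm ⊗ᵢ
      slotsUnit n (fun i => X i.succ) (fun i => s i.succ) (fun i => h i.succ))

def slotsSingle : ∀ (n : ℕ) (X : Fin n → C) (i : Fin n) (s : Fin n → Bool),
    (∀ j, s j = decide (j = i)) → (X i ≅ slots n X s)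
  | n + 1, X, ⟨0, _⟩, s, h => (ρ_ (X 0)).symm ≪≫
    (eqToIso (congrArg (slot (X 0)) (h 0)).symm ⊗ᵢ
      slotsUnit n (fun i => X i.succ) (fun i => s i.succ) (fun i => (h i.succ).trans (by simp)))
  | n + 1, X, ⟨i + 1, hi⟩, s, h => (λ_ (X (Fin.succ ⟨i, by omega⟩))).symm ≪≫
    (eqToIso (congrArg (slot (X 0)) (show s 0 = false from (h 0).trans (by simp))).symm ⊗ᵢ
      slotsSingle n (fun i => X i.succ) ⟨i, by omega⟩ (fun i => s i.succ)
        (fun j => (h j.succ).trans (by simp [Fin.ext_iff])))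

/-- Together with `slotsMul_comm` and `slotsMul_unit`, this makes merging a partial commutative
monoid. These three identities are all that sorting needs in order to absorb associators, braidings
and unitors. -/
theorem slotsMul_assoc : ∀ (n : ℕ) (X : Fin n → C) {a b c p q w : Fin n → Bool}
    (h₁ : ∀ i, Mg (a i) (b i) (p i)) (h₂ : ∀ i, Mg (p i) (c i) (w i))
    (h₃ : ∀ i, Mg (b i) (c i) (q i)) (h₄ : ∀ i, Mg (a i) (q i) (w i)),
    (slotsMul n X a b p h₁).hom ▷ slots n X c ≫ (slotsMul n X p c w h₂).hom =
      (α_ _ _ _).hom ≫ slots n X a ◁ (slotsMul n X b c q h₃).hom ≫ (slotsMul n X a q w h₄).hom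
  | 0, _, _, _, _, _, _, _, _, _, _, _ => by simp [slotsMul, slots, unitors_equal]
  | n + 1, X, a, b, c, p, q, w, h₁, h₂, h₃, h₄ => by
    have e₀ := slotMul_assoc (X 0) (h₁ 0) (h₂ 0) (h₃ 0) (h₄ 0)
    have e₁ := slotsMul_assoc n (fun i => X i.succ) (fun i => h₁ i.succ) (fun i => h₂ i.succ)
      (fun i => h₃ i.succ) (fun i => h₄ i.succ)
    simp only [slotsMul, slots, Iso.trans_hom, tensorIso_hom, comp_whiskerRight, Category.assoc,
      MonoidalCategory.whiskerLeft_comp]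
    rw [tensorμ_natural_left_assoc, tensorμ_natural_right_assoc, tensorHom_comp_tensorHom,
      tensorHom_comp_tensorHom, e₀, e₁, ← tensorHom_comp_tensorHom, ← tensor_associativity_assoc]

theorem slotsMul_comm : ∀ (n : ℕ) (X : Fin n → C) {a b c : Fin n → Bool}
    (h : ∀ i, Mg (a i) (b i) (c i)) (h' : ∀ i, Mg (b i) (a i) (c i)),
    (β_ (slots n X a) (slots n X b)).hom ≫ (slotsMul n X b a c h').hom = (slotsMul n X a b c h).hom
  | 0, _, _, _, _, _, _ => by simp [slotsMul, slots, ← unitors_equal]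
  | n + 1, X, a, b, c, h, h' => by
    have e₀ := slotMul_comm (X 0) (h 0) (h' 0)
    have e₁ := slotsMul_comm n (fun i => X i.succ) (fun i => h i.succ) (fun i => h' i.succ)
    simp only [slotsMul, slots, Iso.trans_hom, tensorIso_hom]
    slice_lhs 1 2 => rw [braiding_tensorμ]
    rw [Category.assoc, tensorHom_comp_tensorHom, e₀, e₁]

theorem tensorμ_unit_aux {A B P : C} (m : 𝟙_ C ⊗ A ⟶ A) (hm : m = (λ_ A).hom) (p : 𝟙_ C ⟶ P)
    (k : P ⊗ B ⟶ B) (hk : p ▷ B ≫ k = (λ_ B).hom) :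
    ((λ_ (𝟙_ C)).inv ≫ (𝟙 (𝟙_ C) ⊗ₘ p)) ▷ (A ⊗ B) ≫ tensorμ (𝟙_ C) P A B ≫ (m ⊗ₘ k) =
      (λ_ (A ⊗ B)).hom := by
  rw [comp_whiskerRight, Category.assoc, tensorμ_natural_left_assoc, tensorHom_comp_tensorHom,
    hk, hm, id_whiskerRight, Category.id_comp, tensor_left_unitality]

theorem slotsMul_unit : ∀ (n : ℕ) (X : Fin n → C) {s t : Fin n → Bool}
    (hs : ∀ i, s i = false) (h : ∀ i, Mg (s i) (t i) (t i)),
    (slotsUnit n X s hs).hom ▷ slots n X t ≫ (slotsMul n X s t t h).hom = (λ_ (slots n X t)).hom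
  | 0, _, _, _, _, _ => by simp [slotsMul, slotsUnit, slots]
  | n + 1, X, s, t, hs, h => by
    -- With `s` literally constant, the `eqToIso` inside `slotsUnit` is an identity by computation,
    -- so the abstract lemma applies up to definitional unfolding.
    obtain rfl : s = fun _ => false := funext hs
    have e₀ := slotMul_left (X 0) (h 0)
    have e₁ := slotsMul_unit n (fun i => X i.succ) (fun i => hs i.succ) (fun i => h i.succ)
    exact tensorμ_unit_aux _ e₀ _ _ e₁


/-! #### Formal objects and structural arrows -/

/-- Formal tensor products of `n` variables. -/
inductive Shape (n : ℕ) : Type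
  | one : Shape n
  | atom (i : Fin n) : Shape n
  | mul (a b : Shape n) : Shape n

namespace Shape

variable {n : ℕ}

def supp : Shape n → Fin n → Bool
  | one, _ => false
  | atom i, j => decide (j = i)
  | mul a b, j => supp a j || supp b j

/-- No variable occurs twice. -/
def linear : Shape n → Bool
  | one => true
  | atom _ => true
  | mul a b => linear a && linear b && decide (∀ j : Fin n, (supp a j && supp b j) = false)

theorem linear_mul {a b : Shape n} :
    linear (mul a b) = true ↔
      linear a = true ∧ linear b = true ∧ ∀ j : Fin n, (supp a j && supp b j) = false := by
  simp only [linear, Bool.and_eq_true, decide_eq_true_eq, and_assoc]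

def obj (X : Fin n → C) : Shape n → C
  | one => 𝟙_ C
  | atom i => X i
  | mul a b => obj X a ⊗ obj X b

/-- The comparison of a formal object with the sorted tensor product of its variables. -/
def sort (X : Fin n → C) : ∀ (a : Shape n) (s : Fin n → Bool), linear a = true → supp a = s →
    (obj X a ≅ slots n X s)
  | one, s, _, hs => slotsUnit n X s (fun _ => hs ▸ rfl)
  | atom i, s, _, hs => slotsSingle n X i s (fun _ => hs ▸ rfl)
  | mul a b, s, hl, hs =>
    (sort X a _ (linear_mul.1 hl).1 rfl ⊗ᵢ sort X b _ (linear_mul.1 hl).2.1 rfl) ≪≫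
      slotsMul n X (supp a) (supp b) s
        (fun i => hs ▸ Mg.or ((linear_mul.1 hl).2.2 i))

end Shape

open Shape

/-- `Rep X a A`: the formal object `a` denotes `A`. -/
inductive Rep {n : ℕ} (X : Fin n → C) : Shape n → C → Prop
  | one : Rep X .one (𝟙_ C)
  | atom (i : Fin n) {A : C} (h : X i = A) : Rep X (.atom i) A
  | mul {a b : Shape n} {A B : C} : Rep X a A → Rep X b B → Rep X (.mul a b) (A ⊗ B)

/-- Denotation is a relation so that it can be established by constructor search, each variable
being matched by `rfl`; here it becomes an equality along which to substitute. -/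
theorem Rep.eq {n : ℕ} {X : Fin n → C} {a : Shape n} {A : C} (h : Rep X a A) : obj X a = A := by
  induction h with
  | one => rfl
  | atom i h => exact h
  | mul _ _ h₁ h₂ => exact congrArg₂ (· ⊗ ·) h₁ h₂

/-- `Wiring X a b f`: `f` is a composite of structural arrows from `a` to `b`. -/
inductive Wiring {n : ℕ} (X : Fin n → C) : Shape n → Shape n → ∀ {A B : C}, (A ⟶ B) → Prop
  | id {a A} : Rep X a A → Wiring X a a (𝟙 A)
  | comp {a b c A B D} {f : A ⟶ B} {g : B ⟶ D} : Wiring X a b f → Wiring X b c g →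
      Wiring X a c (f ≫ g)
  | whiskerLeft {a b c A B D} {f : A ⟶ B} : Rep X c D → Wiring X a b f →
      Wiring X (.mul c a) (.mul c b) (D ◁ f)
  | whiskerRight {a b c A B D} {f : A ⟶ B} : Rep X c D → Wiring X a b f →
      Wiring X (.mul a c) (.mul b c) (f ▷ D)
  | tensorHom {a b c d A B D E} {f : A ⟶ B} {g : D ⟶ E} : Wiring X a b f → Wiring X c d g →
      Wiring X (.mul a c) (.mul b d) (f ⊗ₘ g)
  | assoc {a b c A B D} : Rep X a A → Rep X b B → Rep X c D →
      Wiring X (.mul (.mul a b) c) (.mul a (.mul b c)) (α_ A B D).hom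
  | assocInv {a b c A B D} : Rep X a A → Rep X b B → Rep X c D →
      Wiring X (.mul a (.mul b c)) (.mul (.mul a b) c) (α_ A B D).inv
  | left {a A} : Rep X a A → Wiring X (.mul .one a) a (λ_ A).hom
  | leftInv {a A} : Rep X a A → Wiring X a (.mul .one a) (λ_ A).inv
  | right {a A} : Rep X a A → Wiring X (.mul a .one) a (ρ_ A).hom
  | rightInv {a A} : Rep X a A → Wiring X a (.mul a .one) (ρ_ A).inv
  | braid {a b A B} : Rep X a A → Rep X b B → Wiring X (.mul a b) (.mul b a) (β_ A B).hom
  | braidInv {a b A B} : Rep X a A → Rep X b B → Wiring X (.mul a b) (.mul b a) (β_ B A).inv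

/-! ### Structural arrows commute with sorting -/

/-- An arrow between denotations that is compatible with sorting. -/
def Sorted {n : ℕ} (X : Fin n → C) (a b : Shape n) (f : obj X a ⟶ obj X b) : Prop :=
  linear a = true → linear b = true ∧ supp a = supp b ∧
    ∀ (s) (hl : linear a = true) (hs : supp a = s) (hl' : linear b = true) (hs' : supp b = s),
      f ≫ (sort X b s hl' hs').hom = (sort X a s hl hs).hom

variable {n : ℕ} {X : Fin n → C}

theorem Sorted.comp {a b c : Shape n} {f : obj X a ⟶ obj X b} {g : obj X b ⟶ obj X c}
    (hf : Sorted X a b f) (hg : Sorted X b c g) : Sorted X a c (f ≫ g) := fun h => by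
  obtain ⟨h₁, e₁, k₁⟩ := hf h
  obtain ⟨h₂, e₂, k₂⟩ := hg h₁
  refine ⟨h₂, e₁.trans e₂, fun s hl hs hl' hs' => ?_⟩
  rw [Category.assoc, k₂ s h₁ (e₂.trans hs'), k₁ s h]

/-- Cancelling `g ≫ f` shows that inverses respect sorting, so associators and unitors have to be
examined in one direction only. -/
theorem Sorted.inv {a b : Shape n} {f : obj X a ⟶ obj X b} {g : obj X b ⟶ obj X a}
    (hf : Sorted X a b f) (e : g ≫ f = 𝟙 _) (h' : linear b = true → linear a = true) :
    Sorted X b a g := fun h => by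
  obtain ⟨h₁, e₁, k₁⟩ := hf (h' h)
  refine ⟨h' h, e₁.symm, fun s hl hs hl' hs' => ?_⟩
  rw [← k₁ s hl' hs' hl hs, reassoc_of% e]

theorem Sorted.tensorHom {a b c d : Shape n} {f : obj X a ⟶ obj X b} {g : obj X c ⟶ obj X d}
    (hf : Sorted X a b f) (hg : Sorted X c d g) :
    Sorted X (.mul a c) (.mul b d) (f ⊗ₘ g) := fun h => by
  obtain ⟨ha, hc, hac⟩ := linear_mul.1 h
  obtain ⟨h₁, e₁, k₁⟩ := hf ha
  obtain ⟨h₂, e₂, k₂⟩ := hg hc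
  refine ⟨linear_mul.2 ⟨h₁, h₂, fun j => ?_⟩, ?_, fun s hl hs hl' hs' => ?_⟩
  · rw [← e₁, ← e₂]; exact hac j
  · funext j
    simp only [supp, e₁, e₂]
  -- The supports of `b` and `d` equal those of `a` and `c` only propositionally. Generalizing them
  -- first lets the sorting of `b` and `d` be expressed with the supports of `a` and `c`.
  · have aux : ∀ (s₁ s₂ : Fin n → Bool) (e₁ : supp b = s₁) (e₂ : supp d = s₂)
        (hm : ∀ i, Mg (s₁ i) (s₂ i) (s i)),
        (sort X (.mul b d) s hl' hs').hom =
          ((sort X b s₁ h₁ e₁).hom ⊗ₘ (sort X d s₂ h₂ e₂).hom) ≫ (slotsMul n X s₁ s₂ s hm).hom := by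
      rintro _ _ rfl rfl hm
      rfl
    rw [aux _ _ e₁.symm e₂.symm (fun i => hs ▸ Mg.or (hac i))]
    refine (tensorHom_comp_tensorHom_assoc _ _ _ _ _).trans ?_
    rw [k₁ _ ha rfl, k₂ _ hc rfl]
    rfl

theorem Sorted.id (a : Shape n) : Sorted X a a (𝟙 _) := fun h =>
  ⟨h, rfl, fun _ _ _ _ _ => Category.id_comp _⟩

theorem linear_assoc (a b c : Shape n) :
    linear (.mul (.mul a b) c) = true ↔ linear (.mul a (.mul b c)) = true := by
  simp only [linear_mul, supp]
  constructor
  · rintro ⟨⟨ha, hb, hab⟩, hc, h⟩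
    refine ⟨ha, ⟨hb, hc, fun j => ?_⟩, fun j => ?_⟩ <;> have h₁ := hab j <;> have h₂ := h j <;>
      revert h₁ h₂ <;> cases supp a j <;> cases supp b j <;> cases supp c j <;> simp
  · rintro ⟨ha, ⟨hb, hc, hab⟩, h⟩
    refine ⟨⟨ha, hb, fun j => ?_⟩, hc, fun j => ?_⟩ <;> have h₁ := hab j <;> have h₂ := h j <;>
      revert h₁ h₂ <;> cases supp a j <;> cases supp b j <;> cases supp c j <;> simp

/-- Sorting a product means sorting the factors and then merging, so naturality of the associator
reduces the claim to associativity of merging. Free objects and arrows keep the dependent supports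
out of the rewriting; `left_aux` and `braid_aux` play the same role. -/
theorem assoc_aux {A B D A' B' D' P Q W : C} (p : A ⟶ A') (q : B ⟶ B') (r : D ⟶ D')
    (m₁ : A' ⊗ B' ⟶ P) (m₂ : P ⊗ D' ⟶ W) (m₃ : B' ⊗ D' ⟶ Q) (m₄ : A' ⊗ Q ⟶ W)
    (e : m₁ ▷ D' ≫ m₂ = (α_ A' B' D').hom ≫ A' ◁ m₃ ≫ m₄) :
    (α_ A B D).hom ≫ (p ⊗ₘ ((q ⊗ₘ r) ≫ m₃)) ≫ m₄ = (((p ⊗ₘ q) ≫ m₁) ⊗ₘ r) ≫ m₂ := by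
  have e₁ : (p ⊗ₘ ((q ⊗ₘ r) ≫ m₃)) = (p ⊗ₘ (q ⊗ₘ r)) ≫ A' ◁ m₃ := by
    rw [← id_tensorHom, tensorHom_comp_tensorHom, Category.comp_id]
  have e₂ : (((p ⊗ₘ q) ≫ m₁) ⊗ₘ r) = ((p ⊗ₘ q) ⊗ₘ r) ≫ m₁ ▷ D' := by
    rw [← tensorHom_id, tensorHom_comp_tensorHom, Category.comp_id]
  rw [e₁, e₂, Category.assoc, Category.assoc, e, associator_naturality_assoc]

theorem left_aux {A A' P : C} (p : A ⟶ A') (u : 𝟙_ C ⟶ P) (m : P ⊗ A' ⟶ A')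
    (e : u ▷ A' ≫ m = (λ_ A').hom) : (λ_ A).hom ≫ p = (u ⊗ₘ p) ≫ m := by
  rw [MonoidalCategory.tensorHom_def', Category.assoc, e, leftUnitor_naturality]

theorem braid_aux {A B A' B' P : C} (p : A ⟶ A') (q : B ⟶ B') (m : A' ⊗ B' ⟶ P)
    (m' : B' ⊗ A' ⟶ P) (e : (β_ A' B').hom ≫ m' = m) :
    (β_ A B).hom ≫ (q ⊗ₘ p) ≫ m' = (p ⊗ₘ q) ≫ m := by
  rw [← e, BraidedCategory.braiding_naturality_assoc]

theorem Sorted.assoc (a b c : Shape n) :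
    Sorted X (.mul (.mul a b) c) (.mul a (.mul b c)) (α_ _ _ _).hom := fun h => by
  have h' := (linear_assoc a b c).1 h
  refine ⟨h', funext fun j => Bool.or_assoc _ _ _, fun s hl hs hl' hs' => ?_⟩
  obtain ⟨hab, hc, h₁⟩ := linear_mul.1 h
  obtain ⟨ha, hbc, h₂⟩ := linear_mul.1 h'
  have e := slotsMul_assoc n X (a := supp a) (b := supp b) (c := supp c)
    (p := supp (.mul a b)) (q := supp (.mul b c)) (w := s)
    (fun i => Mg.or ((linear_mul.1 hab).2.2 i)) (fun i => hs ▸ Mg.or (h₁ i))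
    (fun i => Mg.or ((linear_mul.1 hbc).2.2 i)) (fun i => hs' ▸ Mg.or (h₂ i))
  exact assoc_aux _ _ _ _ _ _ _ e

theorem Sorted.left (a : Shape n) : Sorted X (.mul .one a) a (λ_ _).hom := fun h => by
  obtain ⟨_, ha, _⟩ := linear_mul.1 h
  refine ⟨ha, funext fun j => Bool.false_or _, fun s hl hs hl' hs' => ?_⟩
  subst hs'
  have e := slotsMul_unit n X (s := supp .one) (t := supp a) (fun _ => rfl)
    (fun i => Mg.false_left _)
  exact left_aux _ _ _ e

theorem Sorted.braid (a b : Shape n) : Sorted X (.mul a b) (.mul b a) (β_ _ _).hom := fun h => by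
  obtain ⟨ha, hb, hab⟩ := linear_mul.1 h
  refine ⟨linear_mul.2 ⟨hb, ha, fun j => by rw [Bool.and_comm]; exact hab j⟩,
    funext fun j => Bool.or_comm _ _, fun s hl hs hl' hs' => ?_⟩
  have e := slotsMul_comm n X (a := supp a) (b := supp b) (c := s)
    (fun i => hs ▸ Mg.or (hab i)) (fun i => Mg.symm (hs ▸ Mg.or (hab i)))
  exact braid_aux _ _ _ _ e

theorem linear_left (a : Shape n) : linear a = true → linear (.mul .one a) = true := fun h =>
  linear_mul.2 ⟨rfl, h, fun _ => rfl⟩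

theorem linear_right (a : Shape n) : linear a = true → linear (.mul a .one) = true := fun h =>
  linear_mul.2 ⟨h, rfl, fun _ => Bool.and_false _⟩

theorem Sorted.right (a : Shape n) : Sorted X (.mul a .one) a (ρ_ _).hom := by
  -- Factoring the right unitor through the braiding makes a right unit law for merging unnecessary.
  have e : (ρ_ (obj X a)).hom = (β_ _ _).hom ≫ (λ_ _).hom := by simp
  rw [e]
  exact (Sorted.braid a .one).comp (Sorted.left a)

theorem Sorted.exists_eq {a b : Shape n} {f : obj X a ⟶ obj X b} (h : Sorted X a b f) :
    ∃ (hA : obj X a = obj X a) (hB : obj X b = obj X b),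
      Sorted X a b (eqToHom hA ≫ f ≫ eqToHom hB.symm) :=
  ⟨rfl, rfl, by simpa using h⟩

/-- Each constructor of `Wiring` preserves compatibility with sorting. The `eqToHom`s appear because
the end objects are only propositionally equal to denotations; they vanish after substitution. -/
theorem Wiring.sorted {a b : Shape n} {A B : C} {f : A ⟶ B} (h : Wiring X a b f) :
    ∃ (hA : obj X a = A) (hB : obj X b = B),
      Sorted X a b (eqToHom hA ≫ f ≫ eqToHom hB.symm) := by
  induction h with
  | id h =>
    obtain rfl := h.eq
    exact (Sorted.id _).exists_eq
  | comp _ _ h₁ h₂ =>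
    obtain ⟨rfl, rfl, h₁⟩ := h₁
    obtain ⟨h, rfl, h₂⟩ := h₂
    simp only [eqToHom_refl, Category.id_comp, Category.comp_id] at h₁ h₂
    exact (h₁.comp h₂).exists_eq
  | whiskerLeft h _ h₁ =>
    obtain ⟨rfl, rfl, h₁⟩ := h₁
    obtain rfl := h.eq
    simp only [eqToHom_refl, Category.id_comp, Category.comp_id] at h₁
    rw [← id_tensorHom]
    exact ((Sorted.id _).tensorHom h₁).exists_eq
  | whiskerRight h _ h₁ =>
    obtain ⟨rfl, rfl, h₁⟩ := h₁
    obtain rfl := h.eq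
    simp only [eqToHom_refl, Category.id_comp, Category.comp_id] at h₁
    rw [← tensorHom_id]
    exact (h₁.tensorHom (Sorted.id _)).exists_eq
  | tensorHom _ _ h₁ h₂ =>
    obtain ⟨rfl, rfl, h₁⟩ := h₁
    obtain ⟨rfl, rfl, h₂⟩ := h₂
    simp only [eqToHom_refl, Category.id_comp, Category.comp_id] at h₁ h₂
    exact (h₁.tensorHom h₂).exists_eq
  | assoc h₁ h₂ h₃ =>
    obtain rfl := h₁.eq
    obtain rfl := h₂.eq
    obtain rfl := h₃.eq
    exact (Sorted.assoc _ _ _).exists_eq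
  | assocInv h₁ h₂ h₃ =>
    obtain rfl := h₁.eq
    obtain rfl := h₂.eq
    obtain rfl := h₃.eq
    exact ((Sorted.assoc _ _ _).inv (Iso.inv_hom_id _) (linear_assoc _ _ _).2).exists_eq
  | left h =>
    obtain rfl := h.eq
    exact (Sorted.left _).exists_eq
  | leftInv h =>
    obtain rfl := h.eq
    exact ((Sorted.left _).inv (Iso.inv_hom_id _) (linear_left _)).exists_eq
  | right h =>
    obtain rfl := h.eq
    exact (Sorted.right _).exists_eq
  | rightInv h =>
    obtain rfl := h.eq
    exact ((Sorted.right _).inv (Iso.inv_hom_id _) (linear_right _)).exists_eq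
  | braid h₁ h₂ =>
    obtain rfl := h₁.eq
    obtain rfl := h₂.eq
    exact (Sorted.braid _ _).exists_eq
  | braidInv h₁ h₂ =>
    obtain rfl := h₁.eq
    obtain rfl := h₂.eq
    rw [← SymmetricCategory.braiding_swap_eq_inv_braiding]
    exact (Sorted.braid _ _).exists_eq

/-- Coherence: multilinear structural arrows are determined by their source and target. -/
theorem Wiring.unique {a b : Shape n} {A B : C} {f g : A ⟶ B} (hf : Wiring X a b f)
    (hg : Wiring X a b g) (h : linear a = true) : f = g := by
  obtain ⟨rfl, rfl, hf⟩ := hf.sorted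
  obtain ⟨_, _, hg⟩ := hg.sorted
  simp only [eqToHom_refl, Category.id_comp, Category.comp_id] at hf hg
  obtain ⟨h', e, hf⟩ := hf h
  obtain ⟨_, _, hg⟩ := hg h
  -- Followed by the sorting of the target, which is invertible, both arrows become the sorting of
  -- the source.
  rw [← cancel_mono (sort X b _ h' rfl).hom, hf _ h e, hg _ h e]


end

end Coherence

/-! ### Traces -/

section

open Coherence

variable {C : Type u} [Category.{v} C] [MonoidalCategory C] [SymmetricCategory C]

theorem rswap_natural {A B D A' B' D' : C} (f : A ⟶ A') (g : B ⟶ B') (h : D ⟶ D') :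
    ((f ⊗ₘ g) ⊗ₘ h) ≫ rswap A' B' D' = rswap A B D ≫ ((f ⊗ₘ h) ⊗ₘ g) := by
  simp only [rswap, Category.assoc]
  rw [associator_naturality_assoc, ← id_tensorHom, ← id_tensorHom, tensorHom_comp_tensorHom_assoc,
    BraidedCategory.braiding_naturality, Category.comp_id, ← associator_inv_naturality,
    tensorHom_comp_tensorHom_assoc, Category.id_comp]

theorem whiskerRight_rswap {A A' : C} (f : A ⟶ A') (B D : C) :
    f ▷ B ▷ D ≫ rswap A' B D = rswap A B D ≫ f ▷ D ▷ B := by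
  simpa using rswap_natural f (𝟙 B) (𝟙 D)

theorem whiskerRight_rswap_assoc {A A' : C} (f : A ⟶ A') (B D : C) {Z : C}
    (k : (A' ⊗ D) ⊗ B ⟶ Z) :
    f ▷ B ▷ D ≫ rswap A' B D ≫ k = rswap A B D ≫ f ▷ D ▷ B ≫ k := by
  rw [reassoc_of% whiskerRight_rswap f B D]

/-- Interchanges the idle wires `B` and `D` beside `f`. In `icomp_assoc` this puts the idle wires of
both sides in the same order. -/
theorem whiskerRight_comm {A A' : C} (f : A ⟶ A') (B D : C) :
    f ▷ B ▷ D = rswap A B D ≫ f ▷ D ▷ B ≫ rswap A' D B := by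
  have e : rswap A' B D ≫ rswap A' D B = 𝟙 _ :=
    Wiring.unique (X := ![A', B, D]) (a := .mul (.mul (.atom 0) (.atom 1)) (.atom 2))
      (by repeat' constructor) (by repeat' constructor) (by decide)
  rw [← whiskerRight_rswap_assoc, e, Category.comp_id]

theorem whiskerRight_comm_assoc {A A' : C} (f : A ⟶ A') (B D : C) {Z : C}
    (k : (A' ⊗ B) ⊗ D ⟶ Z) :
    f ▷ B ▷ D ≫ k = rswap A B D ≫ f ▷ D ▷ B ≫ rswap A' D B ≫ k := by
  rw [whiskerRight_comm, Category.assoc, Category.assoc]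

theorem whiskerMid_rswap (A : C) {B B' : C} (f : B ⟶ B') (D : C) :
    (A ◁ f) ▷ D ≫ rswap A B' D = rswap A B D ≫ (A ⊗ D) ◁ f := by
  simpa using rswap_natural (𝟙 A) f (𝟙 D)

theorem whiskerMid_rswap_assoc (A : C) {B B' : C} (f : B ⟶ B') (D : C) {Z : C}
    (k : (A ⊗ D) ⊗ B' ⟶ Z) :
    (A ◁ f) ▷ D ≫ rswap A B' D ≫ k = rswap A B D ≫ (A ⊗ D) ◁ f ≫ k := by
  rw [reassoc_of% whiskerMid_rswap A f D]

theorem whiskerLeft_rswap (A B : C) {D D' : C} (f : D ⟶ D') :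
    (A ⊗ B) ◁ f ≫ rswap A B D' = rswap A B D ≫ (A ◁ f) ▷ B := by
  simpa using rswap_natural (𝟙 A) (𝟙 B) f

theorem whiskerLeft_rswap_assoc (A B : C) {D D' : C} (f : D ⟶ D') {Z : C}
    (k : (A ⊗ D') ⊗ B ⟶ Z) :
    (A ⊗ B) ◁ f ≫ rswap A B D' ≫ k = rswap A B D ≫ (A ◁ f) ▷ B ≫ k := by
  rw [reassoc_of% whiskerLeft_rswap A B f]

@[simp]
theorem rswap_rswap (A B D : C) : rswap A B D ≫ rswap A D B = 𝟙 _ := by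
  simp only [rswap, Category.assoc, Iso.inv_hom_id_assoc]
  rw [← MonoidalCategory.whiskerLeft_comp_assoc, SymmetricCategory.symmetry]
  simp

@[simp]
theorem rswap_rswap_assoc (A B D : C) {Z : C} (k : (A ⊗ B) ⊗ D ⟶ Z) :
    rswap A B D ≫ rswap A D B ≫ k = k := by
  rw [reassoc_of% rswap_rswap A B D]

/-! ### Composition and tensor product of arrows of the Int construction, in terms of `C` -/

/-- This and `itensor` are `IntObj.cut` and `IntObj.tensorHom` with all components as free
variables. The agreement is definitional, so the lemmas about them apply both to `Int C` and to the
generated category. -/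
def icut {X Y Z U V W : C} (f : X ⊗ V ⟶ Y ⊗ U) (g : Y ⊗ W ⟶ Z ⊗ V) :
    (X ⊗ W) ⊗ V ⟶ (Z ⊗ U) ⊗ V :=
  rswap X W V ≫ f ▷ W ≫ rswap Y U W ≫ g ▷ U ≫ rswap Z V U

def itensor {X Y U V X' Y' U' V' : C} (f : X ⊗ V ⟶ Y ⊗ U) (g : X' ⊗ V' ⟶ Y' ⊗ U') :
    (X ⊗ X') ⊗ (V' ⊗ V) ⟶ (Y ⊗ Y') ⊗ (U' ⊗ U) :=
  (X ⊗ X') ◁ (β_ V' V).hom ≫ tensorμ X X' V V' ≫ (f ⊗ₘ g) ≫ tensorμ Y U Y' U' ≫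
    (Y ⊗ Y') ◁ (β_ U U').hom

theorem itensor_pair {X Y U V X' Y' U' V' : C} (p : X ⟶ Y) (q : V ⟶ U) (p' : X' ⟶ Y')
    (q' : V' ⟶ U') : itensor (p ⊗ₘ q) (p' ⊗ₘ q') = ((p ⊗ₘ p') ⊗ₘ (q' ⊗ₘ q)) := by
  have e : tensorμ X X' V V' ≫ tensorμ X V X' V' ≫ (X ⊗ X') ◁ (β_ V V').hom =
      (X ⊗ X') ◁ (β_ V V').hom :=
    Wiring.unique (X := ![X, X', V, V']) (a := .mul (.mul (.atom 0) (.atom 1))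
      (.mul (.atom 2) (.atom 3))) (by repeat' constructor) (by repeat' constructor) (by decide)
  have e' : ((p ⊗ₘ p') ⊗ₘ (q ⊗ₘ q')) ≫ (Y ⊗ Y') ◁ (β_ U U').hom =
      (X ⊗ X') ◁ (β_ V V').hom ≫ ((p ⊗ₘ p') ⊗ₘ (q' ⊗ₘ q)) := by
    rw [← id_tensorHom, ← id_tensorHom, tensorHom_comp_tensorHom, tensorHom_comp_tensorHom,
      BraidedCategory.braiding_naturality, Category.comp_id, Category.id_comp]
  rw [itensor, tensorμ_natural_assoc, e', reassoc_of% e, ← MonoidalCategory.whiskerLeft_comp_assoc,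
    SymmetricCategory.symmetry]
  simp

variable [Traced C]

open Traced

theorem tr_whiskerRight {X Y U : C} (f : X ⊗ U ⟶ Y ⊗ U) (S : C) :
    tr U f ▷ S = tr U (rswap X S U ≫ f ▷ S ≫ rswap Y U S) := by
  simpa using superposing U f (𝟙 S)

theorem whiskerLeft_tr {X Y U : C} (S : C) (f : X ⊗ U ⟶ Y ⊗ U) :
    S ◁ tr U f = tr U ((α_ S X U).hom ≫ S ◁ f ≫ (α_ S Y U).inv) := by
  have e : S ◁ tr U f = (β_ S X).hom ≫ tr U f ▷ S ≫ (β_ Y S).hom := by simp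
  rw [e, tr_whiskerRight, ← natural_right, ← natural_left]
  have e₁ : (β_ S X).hom ▷ U ≫ rswap X S U = (α_ S X U).hom ≫ (β_ S (X ⊗ U)).hom :=
    Wiring.unique (X := ![S, X, U]) (a := .mul (.mul (.atom 0) (.atom 1)) (.atom 2))
      (by repeat' constructor) (by repeat' constructor) (by decide)
  have e₂ : rswap Y U S ≫ (β_ Y S).hom ▷ U = (β_ (Y ⊗ U) S).hom ≫ (α_ S Y U).inv :=
    Wiring.unique (X := ![Y, U, S]) (a := .mul (.mul (.atom 0) (.atom 1)) (.atom 2))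
      (by repeat' constructor) (by repeat' constructor) (by decide)
  congr 1
  simp only [Category.assoc]
  rw [reassoc_of% e₁, e₂, ← BraidedCategory.braiding_naturality_right_assoc,
    SymmetricCategory.symmetry_assoc]

/-- Both double traces are single traces, over `U ⊗ V` and over `V ⊗ U`; dinaturality carries the
symmetry from one to the other. -/
theorem tr_tr_swap {X Y : C} (U V : C) (f : (X ⊗ U) ⊗ V ⟶ (Y ⊗ U) ⊗ V) :
    tr U (tr V f) = tr V (tr U (rswap X V U ≫ f ≫ rswap Y U V)) := by
  have e₁ := vanishing_tensor U V ((α_ X U V).inv ≫ f ≫ (α_ Y U V).hom)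
  have e₂ := vanishing_tensor V U
    (X ◁ (β_ V U).hom ≫ (α_ X U V).inv ≫ f ≫ (α_ Y U V).hom ≫ Y ◁ (β_ U V).hom)
  have e₃ := dinatural ((α_ X U V).inv ≫ f ≫ (α_ Y U V).hom ≫ Y ◁ (β_ U V).hom) (β_ V U).hom
  simp only [Category.assoc, Iso.hom_inv_id, Iso.hom_inv_id_assoc, Category.comp_id,
    ← MonoidalCategory.whiskerLeft_comp, SymmetricCategory.symmetry,
    MonoidalCategory.whiskerLeft_id] at e₁ e₂ e₃
  rw [← e₁, e₃, e₂]
  simp [rswap]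

theorem tr_rswap (R U : C) : tr U (rswap R U U) = 𝟙 (R ⊗ U) := by
  rw [rswap, ← whiskerLeft_tr, yanking, MonoidalCategory.whiskerLeft_id]

/-- A wire that leaves `f`, runs once round the loop and enters `g` can be pulled straight. Later
traces are removed by using coherence to bring the traced arrow to this shape. -/
theorem tr_yank {X Y R U : C} (f : X ⟶ R ⊗ U) (g : R ⊗ U ⟶ Y) :
    tr U (f ▷ U ≫ rswap R U U ≫ g ▷ U) = f ≫ g := by
  rw [natural_left, natural_right, tr_rswap, Category.id_comp]

theorem tr_yank_left {X R U : C} (f : X ⟶ R ⊗ U) : tr U (f ▷ U ≫ rswap R U U) = f := by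
  simpa using tr_yank f (𝟙 _)

theorem tr_yank_right {Y R U : C} (g : R ⊗ U ⟶ Y) : tr U (rswap R U U ≫ g ▷ U) = g := by
  simpa using tr_yank (𝟙 _) g

def icomp {X Y Z U V W : C} (f : X ⊗ V ⟶ Y ⊗ U) (g : Y ⊗ W ⟶ Z ⊗ V) : X ⊗ W ⟶ Z ⊗ U :=
  tr V (icut f g)

/-- Since `p ⊗ₘ q` does not connect its two wires, the loop can be pulled straight and no trace
remains. The structural arrows of `Int C` have this form, apart from the units and counits. -/
theorem icomp_pair {X Y Z U V W : C} (f : X ⊗ V ⟶ Y ⊗ U) (p : Y ⟶ Z) (q : W ⟶ V) :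
    icomp f (p ⊗ₘ q) = X ◁ q ≫ f ≫ p ▷ U := by
  have e : icut f (p ⊗ₘ q) = (X ◁ q) ▷ V ≫ rswap X V V ≫ (f ≫ p ▷ U) ▷ V := by
    simp only [icut, MonoidalCategory.tensorHom_def', comp_whiskerRight, Category.assoc,
      whiskerRight_rswap]
    rw [whiskerMid_rswap_assoc, rswap_rswap_assoc, ← whisker_exchange_assoc,
      whiskerMid_rswap_assoc]
  rw [icomp, e, natural_left]
  exact congrArg _ (tr_yank_right _)

theorem pair_icomp {X Y Z U V W : C} (p : X ⟶ Y) (q : V ⟶ U) (g : Y ⊗ W ⟶ Z ⊗ V) :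
    icomp (p ⊗ₘ q) g = p ▷ W ≫ g ≫ Z ◁ q := by
  have e : icut (p ⊗ₘ q) g =
      (X ⊗ W) ◁ q ≫ (p ▷ W ≫ g) ▷ U ≫ rswap Z V U := by
    simp only [icut, MonoidalCategory.tensorHom_def', comp_whiskerRight, Category.assoc]
    rw [whiskerRight_rswap_assoc, ← whiskerLeft_rswap_assoc, rswap_rswap_assoc]
  -- Here `q` sits on the traced wire before `g`. Dinaturality moves it round the loop to the other
  -- end, and the remaining loop is straightened by `tr_yank_left`.
  rw [icomp, e, ← dinatural]
  simp only [Category.assoc]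
  rw [← whiskerMid_rswap, ← comp_whiskerRight_assoc, tr_yank_left, Category.assoc]

theorem pair_icomp_pair {X Y Z U V W : C} (p : X ⟶ Y) (q : V ⟶ U) (p' : Y ⟶ Z) (q' : W ⟶ V) :
    icomp (p ⊗ₘ q) (p' ⊗ₘ q') = (p ≫ p') ⊗ₘ (q' ≫ q) := by
  rw [pair_icomp, ← tensorHom_id, ← id_tensorHom, tensorHom_comp_tensorHom,
    tensorHom_comp_tensorHom, Category.comp_id, Category.id_comp]

theorem id_icomp {Y Z V W : C} (g : Y ⊗ W ⟶ Z ⊗ V) : icomp (𝟙 Y ⊗ₘ 𝟙 V) g = g := by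
  rw [pair_icomp]; simp

theorem icomp_id {X Y U V : C} (f : X ⊗ V ⟶ Y ⊗ U) : icomp f (𝟙 Y ⊗ₘ 𝟙 V) = f := by
  rw [icomp_pair]; simp

/-- Associativity of composition. -/
theorem icomp_assoc {X Y Z T U V W S : C} (f : X ⊗ V ⟶ Y ⊗ U) (g : Y ⊗ W ⟶ Z ⊗ V)
    (h : Z ⊗ S ⟶ T ⊗ W) : icomp (icomp f g) h = icomp f (icomp g h) := by
  have l : icomp (icomp f g) h = tr W (tr V (rswap X S W ▷ V ≫ rswap (X ⊗ W) S V ≫ icut f g ▷ S ≫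
      rswap (Z ⊗ U) V S ≫ (rswap Z U S ≫ h ▷ U ≫ rswap T W U) ▷ V)) := by
    rw [icomp, icut, icomp, tr_whiskerRight, ← natural_right, ← natural_left]
    simp only [Category.assoc]
  have r : icomp f (icomp g h) = tr V (tr W ((rswap X S V ≫ f ▷ S ≫ rswap Y U S) ▷ W ≫
      rswap (Y ⊗ S) U W ≫ icut g h ▷ U ≫ rswap (T ⊗ V) W U ≫ rswap T V U ▷ W)) := by
    rw [icomp, icut, icomp, tr_whiskerRight, ← natural_right, ← Category.assoc, ← Category.assoc,
      ← natural_left]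
    simp only [Category.assoc]
  -- The two sides are double traces over `V` and `W` in opposite orders. Once the loops are
  -- exchanged, the bodies contain `f`, `g`, `h` in the same order, separated by permutations that
  -- coherence identifies.
  rw [l, r, tr_tr_swap]
  congr 2
  simp only [icut, comp_whiskerRight, Category.assoc]
  rw [whiskerRight_comm_assoc f W S, whiskerRight_comm_assoc g U S, whiskerRight_comm_assoc h U V]
  have e₀ : rswap (X ⊗ S) V W ≫ rswap X S W ▷ V ≫ rswap (X ⊗ W) S V ≫ rswap X W V ▷ S ≫
      rswap (X ⊗ V) W S = rswap X S V ▷ W :=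
    Wiring.unique (X := ![X, S, V, W]) (a := .mul (.mul (.mul (.atom 0) (.atom 1)) (.atom 2)) (.atom 3))
      (by repeat' constructor) (by repeat' constructor) (by decide)
  rw [reassoc_of% e₀]
  congr 2
  have e₁ : rswap (Y ⊗ U) S W ≫ rswap Y U W ▷ S ≫ rswap (Y ⊗ W) U S =
      rswap Y U S ▷ W ≫ rswap (Y ⊗ S) U W ≫ rswap Y S W ▷ U :=
    Wiring.unique (X := ![Y, U, S, W]) (a := .mul (.mul (.mul (.atom 0) (.atom 1)) (.atom 2)) (.atom 3))
      (by repeat' constructor) (by repeat' constructor) (by decide)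
  rw [reassoc_of% e₁]
  congr 4
  have e₂ : rswap (Z ⊗ V) S U ≫ rswap Z V U ▷ S ≫ rswap (Z ⊗ U) V S ≫ rswap Z U S ▷ V ≫ rswap (Z ⊗ S) U V =
      rswap Z V S ▷ U :=
    Wiring.unique (X := ![Z, V, S, U]) (a := .mul (.mul (.mul (.atom 0) (.atom 1)) (.atom 2)) (.atom 3))
      (by repeat' constructor) (by repeat' constructor) (by decide)
  rw [reassoc_of% e₂]
  congr 2
  exact Wiring.unique (X := ![T, W, V, U]) (a := .mul (.mul (.mul (.atom 0) (.atom 1)) (.atom 2)) (.atom 3))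
      (by repeat' constructor) (by repeat' constructor) (by decide)

end

/-! ### The monoidal structure of Int: naturality and interchange -/

section

open Coherence Traced

variable {C : Type u} [Category.{v} C] [MonoidalCategory C] [SymmetricCategory C]

/-- Gathers the idle wires of two neighbouring boxes on one side, so that `f ⊗ₘ f'` becomes a single
box. The interchange law needs both of its sides in this form. -/
theorem tensorHom_whiskerRight {P Q P' Q' : C} (f : P ⟶ Q) (f' : P' ⟶ Q') (W W' : C) :
    (f ▷ W ⊗ₘ f' ▷ W') = (tensorμ P W P' W' ≫ (P ⊗ P') ◁ (β_ W W').hom) ≫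
      (f ⊗ₘ f') ▷ (W' ⊗ W) ≫ (Q ⊗ Q') ◁ (β_ W' W).hom ≫ tensorμ Q Q' W W' := by
  have e : tensorμ P W P' W' ≫ tensorμ P P' W W' = 𝟙 _ :=
    Wiring.unique (X := ![P, W, P', W'])
      (a := .mul (.mul (.atom 0) (.atom 1)) (.mul (.atom 2) (.atom 3)))
      (by repeat' constructor) (by repeat' constructor) (by decide)
  have h := tensorμ_natural_left f f' W W'
  simp only [Category.assoc]
  rw [← whisker_exchange_assoc, ← MonoidalCategory.whiskerLeft_comp_assoc,
    SymmetricCategory.symmetry, MonoidalCategory.whiskerLeft_id, Category.id_comp, h,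
    reassoc_of% e]

theorem comp_comp_tensorHom {A B D E A' B' : C} (p : A ⟶ B) (f : B ⟶ D) (q : D ⟶ E)
    (g : A' ⟶ B') : ((p ≫ f ≫ q) ⊗ₘ g) = p ▷ A' ≫ (f ⊗ₘ g) ≫ q ▷ B' := by
  rw [← tensorHom_id, ← tensorHom_id, tensorHom_comp_tensorHom, tensorHom_comp_tensorHom,
    Category.id_comp, Category.comp_id]

theorem tensorHom_comp_comp {A B D E A' B' : C} (p : A ⟶ B) (f : B ⟶ D) (q : D ⟶ E)
    (g : A' ⟶ B') : (g ⊗ₘ (p ≫ f ≫ q)) = A' ◁ p ≫ (g ⊗ₘ f) ≫ B' ◁ q := by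
  rw [← id_tensorHom, ← id_tensorHom, tensorHom_comp_tensorHom, tensorHom_comp_tensorHom,
    Category.id_comp, Category.comp_id]

/-- By `icomp_pair` and `pair_icomp` this is naturality of the associator of Int. The three boxes
are isolated in the middle, and coherence compares the wires before and after them; the unitors and
the braiding are treated in the same way. -/
theorem itensor_assoc {X Y U V X' Y' U' V' X'' Y'' U'' V'' : C} (f : X ⊗ V ⟶ Y ⊗ U)
    (f' : X' ⊗ V' ⟶ Y' ⊗ U') (f'' : X'' ⊗ V'' ⟶ Y'' ⊗ U'') :
    ((X ⊗ X') ⊗ X'') ◁ (α_ V'' V' V).hom ≫ itensor (itensor f f') f'' ≫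
        (α_ Y Y' Y'').hom ▷ (U'' ⊗ (U' ⊗ U)) =
      (α_ X X' X'').hom ▷ ((V'' ⊗ V') ⊗ V) ≫ itensor f (itensor f' f'') ≫
        (Y ⊗ (Y' ⊗ Y'')) ◁ (α_ U'' U' U).hom := by
  have l : itensor (itensor f f') f'' =
      ((X ⊗ X') ⊗ X'') ◁ (β_ V'' (V' ⊗ V)).hom ≫ tensorμ (X ⊗ X') X'' (V' ⊗ V) V'' ≫
        ((X ⊗ X') ◁ (β_ V' V).hom ≫ tensorμ X X' V V') ▷ (X'' ⊗ V'') ≫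
        ((f ⊗ₘ f') ⊗ₘ f'') ≫ (tensorμ Y U Y' U' ≫ (Y ⊗ Y') ◁ (β_ U U').hom) ▷ (Y'' ⊗ U'') ≫
        tensorμ (Y ⊗ Y') (U' ⊗ U) Y'' U'' ≫ ((Y ⊗ Y') ⊗ Y'') ◁ (β_ (U' ⊗ U) U'').hom := by
    rw [itensor, show itensor f f' = ((X ⊗ X') ◁ (β_ V' V).hom ≫ tensorμ X X' V V') ≫ (f ⊗ₘ f') ≫
      (tensorμ Y U Y' U' ≫ (Y ⊗ Y') ◁ (β_ U U').hom) by simp only [itensor, Category.assoc],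
      comp_comp_tensorHom]
    simp only [Category.assoc]
  have r : itensor f (itensor f' f'') =
      (X ⊗ X' ⊗ X'') ◁ (β_ (V'' ⊗ V') V).hom ≫ tensorμ X (X' ⊗ X'') V (V'' ⊗ V') ≫
        (X ⊗ V) ◁ ((X' ⊗ X'') ◁ (β_ V'' V').hom ≫ tensorμ X' X'' V' V'') ≫
        (α_ (X ⊗ V) (X' ⊗ V') (X'' ⊗ V'')).inv ≫ ((f ⊗ₘ f') ⊗ₘ f'') ≫
        (α_ (Y ⊗ U) (Y' ⊗ U') (Y'' ⊗ U'')).hom ≫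
        (Y ⊗ U) ◁ (tensorμ Y' U' Y'' U'' ≫ (Y' ⊗ Y'') ◁ (β_ U' U'').hom) ≫
        tensorμ Y U (Y' ⊗ Y'') (U'' ⊗ U') ≫ (Y ⊗ Y' ⊗ Y'') ◁ (β_ U (U'' ⊗ U')).hom := by
    rw [itensor, show itensor f' f'' = ((X' ⊗ X'') ◁ (β_ V'' V').hom ≫ tensorμ X' X'' V' V'') ≫
      (f' ⊗ₘ f'') ≫ (tensorμ Y' U' Y'' U'' ≫ (Y' ⊗ Y'') ◁ (β_ U' U'').hom) by
        simp only [itensor, Category.assoc], tensorHom_comp_comp, associator_naturality_assoc,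
      Iso.inv_hom_id_assoc]
    simp only [Category.assoc]
  rw [l, r]
  have e₁ : ((X ⊗ X') ⊗ X'') ◁ (α_ V'' V' V).hom ≫ ((X ⊗ X') ⊗ X'') ◁ (β_ V'' (V' ⊗ V)).hom ≫
        tensorμ (X ⊗ X') X'' (V' ⊗ V) V'' ≫
        ((X ⊗ X') ◁ (β_ V' V).hom ≫ tensorμ X X' V V') ▷ (X'' ⊗ V'') =
      (α_ X X' X'').hom ▷ ((V'' ⊗ V') ⊗ V) ≫ (X ⊗ X' ⊗ X'') ◁ (β_ (V'' ⊗ V') V).hom ≫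
        tensorμ X (X' ⊗ X'') V (V'' ⊗ V') ≫
        (X ⊗ V) ◁ ((X' ⊗ X'') ◁ (β_ V'' V').hom ≫ tensorμ X' X'' V' V'') ≫
        (α_ (X ⊗ V) (X' ⊗ V') (X'' ⊗ V'')).inv :=
    Wiring.unique (X := ![X, X', X'', V'', V', V])
      (a := .mul (.mul (.mul (.atom 0) (.atom 1)) (.atom 2)) (.mul (.mul (.atom 3) (.atom 4)) (.atom 5)))
      (by repeat' constructor) (by repeat' constructor) (by decide)
  have e₂ : (tensorμ Y U Y' U' ≫ (Y ⊗ Y') ◁ (β_ U U').hom) ▷ (Y'' ⊗ U'') ≫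
        tensorμ (Y ⊗ Y') (U' ⊗ U) Y'' U'' ≫ ((Y ⊗ Y') ⊗ Y'') ◁ (β_ (U' ⊗ U) U'').hom ≫
        (α_ Y Y' Y'').hom ▷ (U'' ⊗ (U' ⊗ U)) =
      (α_ (Y ⊗ U) (Y' ⊗ U') (Y'' ⊗ U'')).hom ≫
        (Y ⊗ U) ◁ (tensorμ Y' U' Y'' U'' ≫ (Y' ⊗ Y'') ◁ (β_ U' U'').hom) ≫
        tensorμ Y U (Y' ⊗ Y'') (U'' ⊗ U') ≫ (Y ⊗ Y' ⊗ Y'') ◁ (β_ U (U'' ⊗ U')).hom ≫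
        (Y ⊗ Y' ⊗ Y'') ◁ (α_ U'' U' U).hom :=
    Wiring.unique (X := ![Y, U, Y', U', Y'', U''])
      (a := .mul (.mul (.mul (.atom 0) (.atom 1)) (.mul (.atom 2) (.atom 3))) (.mul (.atom 4) (.atom 5)))
      (by repeat' constructor) (by repeat' constructor) (by decide)
  simp only [Category.assoc]
  rw [reassoc_of% e₁, e₂]

theorem itensor_left {X Y U V : C} (f : X ⊗ V ⟶ Y ⊗ U) :
    (𝟙_ C ⊗ X) ◁ (ρ_ V).inv ≫ itensor (𝟙 (𝟙_ C) ⊗ₘ 𝟙 (𝟙_ C)) f ≫ (λ_ Y).hom ▷ (U ⊗ 𝟙_ C) =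
      (λ_ X).hom ▷ V ≫ f ≫ Y ◁ (ρ_ U).inv := by
  have e : (𝟙 (𝟙_ C ⊗ 𝟙_ C) ⊗ₘ f) = ((λ_ (𝟙_ C)).hom ▷ (X ⊗ V) ≫ (λ_ (X ⊗ V)).hom) ≫ f ≫
      (λ_ (Y ⊗ U)).inv ≫ (λ_ (𝟙_ C)).inv ▷ (Y ⊗ U) := by
    rw [id_tensorHom, Category.assoc, ← leftUnitor_naturality_assoc, Iso.hom_inv_id_assoc,
      ← whisker_exchange_assoc, hom_inv_whiskerRight, Category.comp_id]
  rw [itensor, id_tensorHom_id, e]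
  simp only [Category.assoc]
  have e₁ : (𝟙_ C ⊗ X) ◁ (ρ_ V).inv ≫ (𝟙_ C ⊗ X) ◁ (β_ V (𝟙_ C)).hom ≫
      tensorμ (𝟙_ C) X (𝟙_ C) V ≫ (λ_ (𝟙_ C)).hom ▷ (X ⊗ V) ≫ (λ_ (X ⊗ V)).hom =
        (λ_ X).hom ▷ V :=
    Wiring.unique (X := ![X, V])
      (a := .mul (.mul .one (.atom 0)) (.atom 1))
      (by repeat' constructor) (by repeat' constructor) (by decide)
  have e₂ : (λ_ (Y ⊗ U)).inv ≫ (λ_ (𝟙_ C)).inv ▷ (Y ⊗ U) ≫ tensorμ (𝟙_ C) (𝟙_ C) Y U ≫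
      (𝟙_ C ⊗ Y) ◁ (β_ (𝟙_ C) U).hom ≫ (λ_ Y).hom ▷ (U ⊗ 𝟙_ C) = Y ◁ (ρ_ U).inv :=
    Wiring.unique (X := ![Y, U])
      (a := .mul (.atom 0) (.atom 1))
      (by repeat' constructor) (by repeat' constructor) (by decide)
  rw [reassoc_of% e₁, e₂]

theorem itensor_right {X Y U V : C} (f : X ⊗ V ⟶ Y ⊗ U) :
    (X ⊗ 𝟙_ C) ◁ (λ_ V).inv ≫ itensor f (𝟙 (𝟙_ C) ⊗ₘ 𝟙 (𝟙_ C)) ≫ (ρ_ Y).hom ▷ (𝟙_ C ⊗ U) =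
      (ρ_ X).hom ▷ V ≫ f ≫ Y ◁ (λ_ U).inv := by
  have e : (f ⊗ₘ 𝟙 (𝟙_ C ⊗ 𝟙_ C)) = ((X ⊗ V) ◁ (λ_ (𝟙_ C)).hom ≫ (ρ_ (X ⊗ V)).hom) ≫ f ≫
      (ρ_ (Y ⊗ U)).inv ≫ (Y ⊗ U) ◁ (λ_ (𝟙_ C)).inv := by
    rw [tensorHom_id, Category.assoc, ← rightUnitor_naturality_assoc, Iso.hom_inv_id_assoc,
      whisker_exchange_assoc, whiskerLeft_hom_inv, Category.comp_id]
  rw [itensor, id_tensorHom_id, e]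
  simp only [Category.assoc]
  have e₁ : (X ⊗ 𝟙_ C) ◁ (λ_ V).inv ≫ (X ⊗ 𝟙_ C) ◁ (β_ (𝟙_ C) V).hom ≫
      tensorμ X (𝟙_ C) V (𝟙_ C) ≫ (X ⊗ V) ◁ (λ_ (𝟙_ C)).hom ≫ (ρ_ (X ⊗ V)).hom =
        (ρ_ X).hom ▷ V :=
    Wiring.unique (X := ![X, V])
      (a := .mul (.mul (.atom 0) .one) (.atom 1))
      (by repeat' constructor) (by repeat' constructor) (by decide)
  have e₂ : (ρ_ (Y ⊗ U)).inv ≫ (Y ⊗ U) ◁ (λ_ (𝟙_ C)).inv ≫ tensorμ Y U (𝟙_ C) (𝟙_ C) ≫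
      (Y ⊗ 𝟙_ C) ◁ (β_ U (𝟙_ C)).hom ≫ (ρ_ Y).hom ▷ (𝟙_ C ⊗ U) = Y ◁ (λ_ U).inv :=
    Wiring.unique (X := ![Y, U])
      (a := .mul (.atom 0) (.atom 1))
      (by repeat' constructor) (by repeat' constructor) (by decide)
  rw [reassoc_of% e₁, e₂]

theorem itensor_braid {X Y U V X' Y' U' V' : C} (f : X ⊗ V ⟶ Y ⊗ U)
    (f' : X' ⊗ V' ⟶ Y' ⊗ U') :
    (X ⊗ X') ◁ (β_ V V').hom ≫ itensor f f' ≫ (β_ Y Y').hom ▷ (U' ⊗ U) =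
      (β_ X X').hom ▷ (V ⊗ V') ≫ itensor f' f ≫ (Y' ⊗ Y) ◁ (β_ U U').hom := by
  have e : (f' ⊗ₘ f) = (β_ (X' ⊗ V') (X ⊗ V)).hom ≫ (f ⊗ₘ f') ≫ (β_ (Y ⊗ U) (Y' ⊗ U')).hom := by
    rw [BraidedCategory.braiding_naturality, SymmetricCategory.symmetry_assoc]
  rw [itensor, itensor, e]
  simp only [Category.assoc]
  have e₁ : (X ⊗ X') ◁ (β_ V V').hom ≫ (X ⊗ X') ◁ (β_ V' V).hom ≫ tensorμ X X' V V' =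
      (β_ X X').hom ▷ (V ⊗ V') ≫ (X' ⊗ X) ◁ (β_ V V').hom ≫ tensorμ X' X V' V ≫
        (β_ (X' ⊗ V') (X ⊗ V)).hom :=
    Wiring.unique (X := ![X, X', V, V'])
      (a := .mul (.mul (.atom 0) (.atom 1)) (.mul (.atom 2) (.atom 3)))
      (by repeat' constructor) (by repeat' constructor) (by decide)
  have e₂ : tensorμ Y U Y' U' ≫ (Y ⊗ Y') ◁ (β_ U U').hom ≫ (β_ Y Y').hom ▷ (U' ⊗ U) =
      (β_ (Y ⊗ U) (Y' ⊗ U')).hom ≫ tensorμ Y' U' Y U ≫ (Y' ⊗ Y) ◁ (β_ U' U).hom ≫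
        (Y' ⊗ Y) ◁ (β_ U U').hom :=
    Wiring.unique (X := ![Y, U, Y', U'])
      (a := .mul (.mul (.atom 0) (.atom 1)) (.mul (.atom 2) (.atom 3)))
      (by repeat' constructor) (by repeat' constructor) (by decide)
  rw [reassoc_of% e₁, e₂]

variable [Traced C]

/-- Superposing moves each factor under the loop of the other, which leaves one body under two
nested loops. -/
theorem tr_tensorHom_tr {A B A' B' V V' : C} (k : A ⊗ V ⟶ B ⊗ V) (k' : A' ⊗ V' ⟶ B' ⊗ V') :
    (tr V k ⊗ₘ tr V' k') = tr V' (tr V ((rswap (A ⊗ A') V' V ≫ rswap A A' V ▷ V' ≫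
      (α_ (A ⊗ V) A' V').hom) ≫ (k ⊗ₘ k') ≫ (α_ (B ⊗ V) B' V').inv ≫ rswap B V B' ▷ V' ≫
        rswap (B ⊗ B') V V')) := by
  have e : (k ⊗ₘ tr V' k') =
      tr V' ((α_ (A ⊗ V) A' V').hom ≫ (k ⊗ₘ k') ≫ (α_ (B ⊗ V) B' V').inv) := by
    rw [MonoidalCategory.tensorHom_def, whiskerLeft_tr, ← natural_left,
      MonoidalCategory.tensorHom_def]
    simp only [whiskerRight_tensor, Category.assoc, Iso.hom_inv_id_assoc]
  rw [superposing, e, ← natural_right, ← natural_left, tr_tr_swap]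
  simp only [Category.assoc]

/-- The interchange law. -/
theorem itensor_icomp {X Y Z U V W X' Y' Z' U' V' W' : C} (f : X ⊗ V ⟶ Y ⊗ U)
    (g : Y ⊗ W ⟶ Z ⊗ V) (f' : X' ⊗ V' ⟶ Y' ⊗ U') (g' : Y' ⊗ W' ⟶ Z' ⊗ V') :
    icomp (itensor f f') (itensor g g') = itensor (icomp f g) (icomp f' g') := by
  -- The composite of tensor products has a loop over `V' ⊗ V`, which splits into nested loops. The
  -- tensor product of composites has two separate loops, which `tr_tensorHom_tr` nests in the same
  -- order.
  rw [icomp, vanishing_tensor, icomp, icomp]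
  conv_rhs => rw [itensor, tr_tensorHom_tr]
  simp only [← natural_right, ← natural_left]
  congr 2
  simp only [icut, itensor, comp_whiskerRight, Category.assoc, ← tensorHom_comp_tensorHom,
    tensorHom_whiskerRight]
  have e₀ : (α_ ((X ⊗ X') ⊗ (W' ⊗ W)) V' V).hom ≫ rswap (X ⊗ X') (W' ⊗ W) (V' ⊗ V) ≫
      ((X ⊗ X') ◁ (β_ V' V).hom) ▷ (W' ⊗ W) ≫ tensorμ X X' V V' ▷ (W' ⊗ W) =
    ((X ⊗ X') ◁ (β_ W' W).hom) ▷ V' ▷ V ≫ tensorμ X X' W W' ▷ V' ▷ V ≫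
      rswap ((X ⊗ W) ⊗ (X' ⊗ W')) V' V ≫ rswap (X ⊗ W) (X' ⊗ W') V ▷ V' ≫
      (α_ ((X ⊗ W) ⊗ V) (X' ⊗ W') V').hom ≫ (rswap X W V ⊗ₘ rswap X' W' V') ≫
      tensorμ (X ⊗ V) W (X' ⊗ V') W' ≫ ((X ⊗ V) ⊗ (X' ⊗ V')) ◁ (β_ W W').hom :=
    Wiring.unique (X := ![X, X', W', W, V', V])
      (a := .mul (.mul (.mul (.mul (.atom 0) (.atom 1)) (.mul (.atom 2) (.atom 3))) (.atom 4)) (.atom 5))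
      (by repeat' constructor) (by repeat' constructor) (by decide)
  have e₁ : tensorμ Y U Y' U' ▷ (W' ⊗ W) ≫ ((Y ⊗ Y') ◁ (β_ U U').hom) ▷ (W' ⊗ W) ≫
      rswap (Y ⊗ Y') (U' ⊗ U) (W' ⊗ W) ≫ ((Y ⊗ Y') ◁ (β_ W' W).hom) ▷ (U' ⊗ U) ≫
      tensorμ Y Y' W W' ▷ (U' ⊗ U) =
    ((Y ⊗ U) ⊗ (Y' ⊗ U')) ◁ (β_ W' W).hom ≫ tensorμ (Y ⊗ U) (Y' ⊗ U') W W' ≫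
      (rswap Y U W ⊗ₘ rswap Y' U' W') ≫ tensorμ (Y ⊗ W) U (Y' ⊗ W') U' ≫
      ((Y ⊗ W) ⊗ (Y' ⊗ W')) ◁ (β_ U U').hom :=
    Wiring.unique (X := ![Y, U, Y', U', W', W])
      (a := .mul (.mul (.mul (.atom 0) (.atom 1)) (.mul (.atom 2) (.atom 3))) (.mul (.atom 4) (.atom 5)))
      (by repeat' constructor) (by repeat' constructor) (by decide)
  have e₂ : tensorμ Z V Z' V' ▷ (U' ⊗ U) ≫ ((Z ⊗ Z') ◁ (β_ V V').hom) ▷ (U' ⊗ U) ≫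
      rswap (Z ⊗ Z') (V' ⊗ V) (U' ⊗ U) ≫ (α_ ((Z ⊗ Z') ⊗ (U' ⊗ U)) V' V).inv =
    ((Z ⊗ V) ⊗ (Z' ⊗ V')) ◁ (β_ U' U).hom ≫ tensorμ (Z ⊗ V) (Z' ⊗ V') U U' ≫
      (rswap Z V U ⊗ₘ rswap Z' V' U') ≫ (α_ ((Z ⊗ U) ⊗ V) (Z' ⊗ U') V').inv ≫
      rswap (Z ⊗ U) V (Z' ⊗ U') ▷ V' ≫ rswap ((Z ⊗ U) ⊗ (Z' ⊗ U')) V V' ≫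
      tensorμ Z U Z' U' ▷ V' ▷ V ≫ ((Z ⊗ Z') ◁ (β_ U U').hom) ▷ V' ▷ V :=
    Wiring.unique (X := ![Z, V, Z', V', U', U])
      (a := .mul (.mul (.mul (.atom 0) (.atom 1)) (.mul (.atom 2) (.atom 3))) (.mul (.atom 4) (.atom 5)))
      (by repeat' constructor) (by repeat' constructor) (by decide)
  rw [reassoc_of% e₀, reassoc_of% e₁, e₂]

end

/-! ### Duality in Int: contravariance, units and counits -/

section

open Coherence Traced

variable {C : Type u} [Category.{v} C] [MonoidalCategory C] [SymmetricCategory C] [Traced C]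

/-- A formula for composition that is symmetric in the two arrows. -/
theorem icomp_eq_tr_tr {X Y Z U V W : C} (f : X ⊗ V ⟶ Y ⊗ U) (g : Y ⊗ W ⟶ Z ⊗ V) :
    icomp f g = tr V (tr Y ((rswap X W V ▷ Y ≫ (α_ (X ⊗ V) W Y).hom ≫ (X ⊗ V) ◁ (β_ W Y).hom) ≫
      (f ⊗ₘ g) ≫ (β_ (Y ⊗ U) (Z ⊗ V)).hom ≫ (Z ⊗ V) ◁ (β_ Y U).hom ≫ (α_ (Z ⊗ V) U Y).inv ≫
        rswap Z V U ▷ Y)) := by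
  have e₁ : icut f g = (rswap X W V ≫ f ▷ W ≫ (β_ Y U).hom ▷ W ≫ rswap U Y W) ≫
      ((α_ U W Y).hom ≫ U ◁ (β_ W Y).hom ≫ (β_ U (Y ⊗ W)).hom ≫ g ▷ U ≫ rswap Z V U) := by
    have e : (β_ Y U).hom ▷ W ≫ rswap U Y W ≫ (α_ U W Y).hom ≫ U ◁ (β_ W Y).hom ≫
        (β_ U (Y ⊗ W)).hom = rswap Y U W :=
      Wiring.unique (X := ![Y, U, W])
        (a := .mul (.mul (.atom 0) (.atom 1)) (.atom 2))
        (by repeat' constructor) (by repeat' constructor) (by decide)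
    simp only [Category.assoc]
    rw [reassoc_of% e]
    rfl
  -- Yanking is used backwards: the wire `Y` joining `f` to `g` is bent into a second loop, so that
  -- `f` and `g` can stand side by side.
  rw [icomp, e₁, ← tr_yank]
  congr 2
  have e₂ : (f ⊗ₘ g) ≫ (β_ (Y ⊗ U) (Z ⊗ V)).hom ≫ (Z ⊗ V) ◁ (β_ Y U).hom ≫
      (α_ (Z ⊗ V) U Y).inv ≫ rswap Z V U ▷ Y = f ▷ (Y ⊗ W) ≫ ((β_ (Y ⊗ U) (Y ⊗ W)).hom ≫
        (Y ⊗ W) ◁ (β_ Y U).hom ≫ (α_ (Y ⊗ W) U Y).inv) ≫ g ▷ U ▷ Y ≫ rswap Z V U ▷ Y := by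
    rw [MonoidalCategory.tensorHom_def, Category.assoc,
      BraidedCategory.braiding_naturality_right_assoc, ← whisker_exchange_assoc,
      associator_inv_naturality_left_assoc]
    simp only [Category.assoc]
  have e₃ : (α_ (X ⊗ V) W Y).hom ≫ (X ⊗ V) ◁ (β_ W Y).hom ≫ f ▷ (Y ⊗ W) =
      f ▷ W ▷ Y ≫ (α_ (Y ⊗ U) W Y).hom ≫ (Y ⊗ U) ◁ (β_ W Y).hom := by
    rw [whisker_exchange, ← associator_naturality_left_assoc]
  have e₄ : (α_ (Y ⊗ U) W Y).hom ≫ (Y ⊗ U) ◁ (β_ W Y).hom ≫ (β_ (Y ⊗ U) (Y ⊗ W)).hom ≫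
        (Y ⊗ W) ◁ (β_ Y U).hom ≫ (α_ (Y ⊗ W) U Y).inv =
      (β_ Y U).hom ▷ W ▷ Y ≫ rswap U Y W ▷ Y ≫ rswap (U ⊗ W) Y Y ≫ (α_ U W Y).hom ▷ Y ≫
        (U ◁ (β_ W Y).hom) ▷ Y ≫ (β_ U (Y ⊗ W)).hom ▷ Y :=
    -- The two wires of type `Y` are distinct variables, as coherence requires a multilinear source.
    Wiring.unique (X := ![Y, U, W, Y])
      (a := .mul (.mul (.mul (.atom 0) (.atom 1)) (.atom 2)) (.atom 3))
      (by repeat' constructor) (by repeat' constructor) (by decide)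
  simp only [comp_whiskerRight, Category.assoc]
  rw [e₂, reassoc_of% e₃]
  simp only [Category.assoc]
  rw [reassoc_of% e₄]

/-- In the formula of `icomp_eq_tr_tr` the two arrows play symmetric roles. Dualizing exchanges the
loops over `V` and `Y`, which `tr_tr_swap` undoes. -/
theorem idual_icomp {X Y Z U V W : C} (f : X ⊗ V ⟶ Y ⊗ U) (g : Y ⊗ W ⟶ Z ⊗ V) :
    (β_ W X).hom ≫ icomp f g ≫ (β_ Z U).hom =
      icomp ((β_ W Y).hom ≫ g ≫ (β_ Z V).hom) ((β_ V X).hom ≫ f ≫ (β_ Y U).hom) := by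
  have e : (((β_ W Y).hom ≫ g ≫ (β_ Z V).hom) ⊗ₘ ((β_ V X).hom ≫ f ≫ (β_ Y U).hom)) =
      (((β_ W Y).hom ⊗ₘ (β_ V X).hom) ≫ (β_ (Y ⊗ W) (X ⊗ V)).hom) ≫ (f ⊗ₘ g) ≫
        (β_ (Y ⊗ U) (Z ⊗ V)).hom ≫ ((β_ Z V).hom ⊗ₘ (β_ Y U).hom) := by
    rw [← tensorHom_comp_tensorHom, ← tensorHom_comp_tensorHom,
      BraidedCategory.braiding_naturality_assoc, Category.assoc, SymmetricCategory.symmetry_assoc]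
  rw [icomp_eq_tr_tr, icomp_eq_tr_tr, e]
  simp only [← natural_right, ← natural_left]
  rw [tr_tr_swap]
  congr 2
  simp only [Category.assoc]
  have e₁ : rswap (W ⊗ X) Y V ≫ (β_ W X).hom ▷ V ▷ Y ≫ rswap X W V ▷ Y ≫
      (α_ (X ⊗ V) W Y).hom ≫ (X ⊗ V) ◁ (β_ W Y).hom =
    rswap W X Y ▷ V ≫ (α_ (W ⊗ Y) X V).hom ≫ (W ⊗ Y) ◁ (β_ X V).hom ≫
      ((β_ W Y).hom ⊗ₘ (β_ V X).hom) ≫ (β_ (Y ⊗ W) (X ⊗ V)).hom :=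
    Wiring.unique (X := ![W, X, Y, V])
      (a := .mul (.mul (.mul (.atom 0) (.atom 1)) (.atom 2)) (.atom 3))
      (by repeat' constructor) (by repeat' constructor) (by decide)
  have e₂ : (β_ (Y ⊗ U) (Z ⊗ V)).hom ≫ (Z ⊗ V) ◁ (β_ Y U).hom ≫ (α_ (Z ⊗ V) U Y).inv ≫
      rswap Z V U ▷ Y ≫ (β_ Z U).hom ▷ V ▷ Y ≫ rswap (U ⊗ Z) V Y =
    (β_ (Y ⊗ U) (Z ⊗ V)).hom ≫ ((β_ Z V).hom ⊗ₘ (β_ Y U).hom) ≫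
      (β_ (V ⊗ Z) (U ⊗ Y)).hom ≫ (U ⊗ Y) ◁ (β_ V Z).hom ≫ (α_ (U ⊗ Y) Z V).inv ≫
        rswap U Y Z ▷ V :=
    Wiring.unique (X := ![Y, U, Z, V])
      (a := .mul (.mul (.atom 0) (.atom 1)) (.mul (.atom 2) (.atom 3)))
      (by repeat' constructor) (by repeat' constructor) (by decide)
  rw [reassoc_of% e₁, e₂]

/-- The unit of `(X, U)` depends only on `T = X ⊗ U`; composing with it closes this wire into a
loop. -/
theorem coev_icomp {T Z W : C} (g : T ⊗ W ⟶ Z ⊗ T) :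
    icomp (β_ (𝟙_ C) T).hom g = (λ_ W).hom ≫ tr T ((β_ W T).hom ≫ g) ≫ (ρ_ Z).inv := by
  have e : rswap (𝟙_ C) W T ≫ (β_ (𝟙_ C) T).hom ▷ W ≫ rswap T (𝟙_ C) W =
      (λ_ W).hom ▷ T ≫ (β_ W T).hom ≫ (ρ_ (T ⊗ W)).inv :=
    Wiring.unique (X := ![W, T])
      (a := .mul (.mul .one (.atom 0)) (.atom 1))
      (by repeat' constructor) (by repeat' constructor) (by decide)
  have e' : (ρ_ (Z ⊗ T)).inv ≫ rswap Z T (𝟙_ C) = (ρ_ Z).inv ▷ T :=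
    Wiring.unique (X := ![Z, T])
      (a := .mul (.atom 0) (.atom 1))
      (by repeat' constructor) (by repeat' constructor) (by decide)
  rw [← natural_right, ← natural_left, icomp, icut, reassoc_of% e,
    ← rightUnitor_inv_naturality_assoc, e', Category.assoc]

/-- The loop over `X ⊗ U` splits into two loops that meet `f` only through identity wires, and each
is yanked in turn. With `tr_id_itensor`, this shows that both sides of `coev_natural_int` contain
just `f`. -/
theorem tr_itensor_id {X Y U V : C} (f : X ⊗ V ⟶ Y ⊗ U) :
    tr (X ⊗ U) ((β_ (X ⊗ V) (X ⊗ U)).hom ≫ itensor f (𝟙 U ⊗ₘ 𝟙 X)) = f := by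
  have e : (α_ (X ⊗ V) X U).hom ≫ ((β_ (X ⊗ V) (X ⊗ U)).hom ≫ itensor f (𝟙 U ⊗ₘ 𝟙 X)) ≫
      (α_ (Y ⊗ U) X U).inv =
    ((β_ X V).hom ▷ X ≫ rswap V X X ≫ (β_ V X).hom ▷ X ≫ f ▷ X ≫ rswap Y U X) ▷ U ≫
      rswap (Y ⊗ X) U U ≫ rswap Y X U ▷ U := by
    have e₀ : (f ⊗ₘ (𝟙 U ⊗ₘ 𝟙 X)) = ((X ⊗ V) ◁ (β_ U X).hom ≫ (α_ (X ⊗ V) X U).inv) ≫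
        f ▷ X ▷ U ≫ (α_ (Y ⊗ U) X U).hom ≫ (Y ⊗ U) ◁ (β_ X U).hom := by
      rw [id_tensorHom_id, tensorHom_id, Category.assoc,
        ← associator_inv_naturality_left_assoc, Iso.inv_hom_id_assoc, whisker_exchange_assoc,
        ← MonoidalCategory.whiskerLeft_comp, SymmetricCategory.symmetry,
        MonoidalCategory.whiskerLeft_id, Category.comp_id]
    have e₁ : (α_ (X ⊗ V) X U).hom ≫ (β_ (X ⊗ V) (X ⊗ U)).hom ≫ (X ⊗ U) ◁ (β_ X V).hom ≫
        tensorμ X U V X ≫ (X ⊗ V) ◁ (β_ U X).hom ≫ (α_ (X ⊗ V) X U).inv =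
      (β_ X V).hom ▷ X ▷ U ≫ rswap V X X ▷ U ≫ (β_ V X).hom ▷ X ▷ U :=
      Wiring.unique (X := ![X, V, X, U])
        (a := .mul (.mul (.mul (.atom 0) (.atom 1)) (.atom 2)) (.atom 3))
        (by repeat' constructor) (by repeat' constructor) (by decide)
    have e₂ : (α_ (Y ⊗ U) X U).hom ≫ (Y ⊗ U) ◁ (β_ X U).hom ≫ tensorμ Y U U X ≫
        (Y ⊗ U) ◁ (β_ U X).hom ≫ (α_ (Y ⊗ U) X U).inv =
      rswap Y U X ▷ U ≫ rswap (Y ⊗ X) U U ≫ rswap Y X U ▷ U :=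
      Wiring.unique (X := ![Y, U, X, U])
        (a := .mul (.mul (.mul (.atom 0) (.atom 1)) (.atom 2)) (.atom 3))
        (by repeat' constructor) (by repeat' constructor) (by decide)
    rw [itensor, e₀]
    simp only [comp_whiskerRight, Category.assoc]
    rw [reassoc_of% e₁, e₂]
  rw [vanishing_tensor, e, tr_yank]
  simp only [Category.assoc, rswap_rswap, Category.comp_id]
  rw [← comp_whiskerRight, tr_yank, SymmetricCategory.symmetry_assoc]

theorem tr_id_itensor {X Y U V : C} (f : X ⊗ V ⟶ Y ⊗ U) :
    tr (Y ⊗ V) ((β_ (X ⊗ V) (Y ⊗ V)).hom ≫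
      itensor (𝟙 Y ⊗ₘ 𝟙 V) ((β_ V X).hom ≫ f ≫ (β_ Y U).hom)) = f := by
  have e : (α_ (X ⊗ V) Y V).hom ≫ ((β_ (X ⊗ V) (Y ⊗ V)).hom ≫
      itensor (𝟙 Y ⊗ₘ 𝟙 V) ((β_ V X).hom ≫ f ≫ (β_ Y U).hom)) ≫ (α_ (Y ⊗ U) Y V).inv =
    rswap X V Y ▷ V ≫ rswap (X ⊗ Y) V V ≫
      (rswap X Y V ≫ f ▷ Y ≫ (β_ Y U).hom ▷ Y ≫ rswap U Y Y ≫ (β_ U Y).hom ▷ Y) ▷ V := by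
    have e₀ : ((𝟙 Y ⊗ₘ 𝟙 V) ⊗ₘ ((β_ V X).hom ≫ f ≫ (β_ Y U).hom)) =
        ((Y ⊗ V) ◁ (β_ V X).hom ≫ (β_ (Y ⊗ V) (X ⊗ V)).hom ≫ (α_ (X ⊗ V) Y V).inv) ≫
        f ▷ Y ▷ V ≫ (α_ (Y ⊗ U) Y V).hom ≫ (β_ (Y ⊗ U) (Y ⊗ V)).hom ≫
          (Y ⊗ V) ◁ (β_ Y U).hom := by
      rw [id_tensorHom_id, id_tensorHom, Category.assoc, Category.assoc,
        ← associator_inv_naturality_left_assoc, Iso.inv_hom_id_assoc,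
        ← BraidedCategory.braiding_naturality_right_assoc, SymmetricCategory.symmetry_assoc,
        MonoidalCategory.whiskerLeft_comp, MonoidalCategory.whiskerLeft_comp]
    have e₁ : (α_ (X ⊗ V) Y V).hom ≫ (β_ (X ⊗ V) (Y ⊗ V)).hom ≫ (Y ⊗ V) ◁ (β_ X V).hom ≫
        tensorμ Y V V X ≫ (Y ⊗ V) ◁ (β_ V X).hom ≫ (β_ (Y ⊗ V) (X ⊗ V)).hom ≫
          (α_ (X ⊗ V) Y V).inv =
      rswap X V Y ▷ V ≫ rswap (X ⊗ Y) V V ≫ rswap X Y V ▷ V :=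
      Wiring.unique (X := ![X, V, Y, V])
        (a := .mul (.mul (.mul (.atom 0) (.atom 1)) (.atom 2)) (.atom 3))
        (by repeat' constructor) (by repeat' constructor) (by decide)
    have e₂ : (α_ (Y ⊗ U) Y V).hom ≫ (β_ (Y ⊗ U) (Y ⊗ V)).hom ≫ (Y ⊗ V) ◁ (β_ Y U).hom ≫
        tensorμ Y V U Y ≫ (Y ⊗ U) ◁ (β_ V Y).hom ≫ (α_ (Y ⊗ U) Y V).inv =
      (β_ Y U).hom ▷ Y ▷ V ≫ rswap U Y Y ▷ V ≫ (β_ U Y).hom ▷ Y ▷ V :=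
      Wiring.unique (X := ![Y, U, Y, V])
        (a := .mul (.mul (.mul (.atom 0) (.atom 1)) (.atom 2)) (.atom 3))
        (by repeat' constructor) (by repeat' constructor) (by decide)
    rw [itensor, e₀]
    simp only [comp_whiskerRight, Category.assoc]
    rw [reassoc_of% e₁, e₂]
  rw [vanishing_tensor, e, tr_yank, rswap_rswap_assoc, ← comp_whiskerRight_assoc, tr_yank,
    Category.assoc, SymmetricCategory.symmetry, Category.comp_id]

/-- Naturality of the units. -/
theorem coev_natural_int {X Y U V : C} (f : X ⊗ V ⟶ Y ⊗ U) :
    icomp (β_ (𝟙_ C) (X ⊗ U)).hom (itensor f (𝟙 U ⊗ₘ 𝟙 X)) =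
      icomp (β_ (𝟙_ C) (Y ⊗ V)).hom
        (itensor (𝟙 Y ⊗ₘ 𝟙 V) ((β_ V X).hom ≫ f ≫ (β_ Y U).hom)) := by
  rw [coev_icomp, coev_icomp, tr_itensor_id, tr_id_itensor]

theorem coev_itensor_icomp {T X U Z W : C} (g : (T ⊗ X) ⊗ W ⟶ Z ⊗ (U ⊗ T)) :
    icomp (itensor (β_ (𝟙_ C) T).hom (𝟙 X ⊗ₘ 𝟙 U)) g =
      (λ_ X).hom ▷ W ≫ tr T (rswap X W T ≫ (β_ X T).hom ▷ W ≫ g ≫ (α_ Z U T).inv) ≫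
        Z ◁ (ρ_ U).inv := by
  have e : rswap ((𝟙_ C ⊗ X) ⊗ W) T U ≫ ((α_ ((𝟙_ C ⊗ X) ⊗ W) U T).hom ≫
      icut (itensor (β_ (𝟙_ C) T).hom (𝟙 X ⊗ₘ 𝟙 U)) g ≫ (α_ (Z ⊗ (U ⊗ 𝟙_ C)) U T).inv) ≫
      rswap (Z ⊗ (U ⊗ 𝟙_ C)) U T =
    ((λ_ X).hom ▷ W ▷ T ≫ rswap X W T ≫ (β_ X T).hom ▷ W ≫ g ≫ (α_ Z U T).inv ≫
      rswap Z U T) ▷ U ≫ rswap (Z ⊗ T) U U ≫ (rswap Z T U ≫ (Z ◁ (ρ_ U).inv) ▷ T) ▷ U := by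
    have e₀ : g ▷ (U ⊗ 𝟙_ C) = ((T ⊗ X) ⊗ W) ◁ (ρ_ U).hom ≫ g ▷ U ≫ (Z ⊗ (U ⊗ T)) ◁ (ρ_ U).inv := by
      rw [whisker_exchange_assoc, whiskerLeft_hom_inv, Category.comp_id]
    have e₁ : rswap ((𝟙_ C ⊗ X) ⊗ W) T U ≫ (α_ ((𝟙_ C ⊗ X) ⊗ W) U T).hom ≫
        rswap (𝟙_ C ⊗ X) W (U ⊗ T) ≫ itensor (β_ (𝟙_ C) T).hom (𝟙 X ⊗ₘ 𝟙 U) ▷ W ≫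
        rswap (T ⊗ X) (U ⊗ 𝟙_ C) W ≫ ((T ⊗ X) ⊗ W) ◁ (ρ_ U).hom =
      (λ_ X).hom ▷ W ▷ T ▷ U ≫ rswap X W T ▷ U ≫ (β_ X T).hom ▷ W ▷ U :=
      Wiring.unique (X := ![X, W, T, U])
        (a := .mul (.mul (.mul (.mul .one (.atom 0)) (.atom 1)) (.atom 2)) (.atom 3))
        (by repeat' constructor) (by repeat' constructor) (by decide)
    have e₂ : (Z ⊗ (U ⊗ T)) ◁ (ρ_ U).inv ≫ rswap Z (U ⊗ T) (U ⊗ 𝟙_ C) ≫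
        (α_ (Z ⊗ (U ⊗ 𝟙_ C)) U T).inv ≫ rswap (Z ⊗ (U ⊗ 𝟙_ C)) U T =
      (α_ Z U T).inv ▷ U ≫ rswap Z U T ▷ U ≫ rswap (Z ⊗ T) U U ≫ rswap Z T U ▷ U ≫
        (Z ◁ (ρ_ U).inv) ▷ T ▷ U :=
      Wiring.unique (X := ![Z, U, T, U])
        (a := .mul (.mul (.atom 0) (.mul (.atom 1) (.atom 2))) (.atom 3))
        (by repeat' constructor) (by repeat' constructor) (by decide)
    rw [icut, e₀]
    simp only [comp_whiskerRight, Category.assoc]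
    rw [reassoc_of% e₁, e₂]
  -- The traced object is `U ⊗ T`. Exchanging its loops makes the one over `U` innermost; that one
  -- is yanked, while the loop over `T` survives in the result.
  rw [icomp, vanishing_tensor, tr_tr_swap, e, tr_yank]
  simp only [Category.assoc, rswap_rswap_assoc]
  rw [← natural_right, ← natural_left]
  simp only [Category.assoc]

theorem itensor_coev_icomp {T X U Z W : C} (g : (X ⊗ T) ⊗ W ⟶ Z ⊗ (T ⊗ U)) :
    icomp (itensor (𝟙 X ⊗ₘ 𝟙 U) (β_ (𝟙_ C) T).hom) g =
      (ρ_ X).hom ▷ W ≫ tr T (rswap X W T ≫ g ≫ Z ◁ (β_ T U).hom ≫ (α_ Z U T).inv) ≫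
        Z ◁ (λ_ U).inv := by
  have e : (α_ ((X ⊗ 𝟙_ C) ⊗ W) T U).hom ≫
      icut (itensor (𝟙 X ⊗ₘ 𝟙 U) (β_ (𝟙_ C) T).hom) g ≫ (α_ (Z ⊗ (𝟙_ C ⊗ U)) T U).inv =
    ((ρ_ X).hom ▷ W ▷ T ≫ rswap X W T ≫ g ≫ (α_ Z T U).inv) ▷ U ≫ rswap (Z ⊗ T) U U ≫
      (rswap Z T U ≫ (Z ◁ (λ_ U).inv) ▷ T) ▷ U := by
    have e₀ : g ▷ (𝟙_ C ⊗ U) = ((X ⊗ T) ⊗ W) ◁ (λ_ U).hom ≫ g ▷ U ≫ (Z ⊗ (T ⊗ U)) ◁ (λ_ U).inv := by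
      rw [whisker_exchange_assoc, whiskerLeft_hom_inv, Category.comp_id]
    have e₁ : (α_ ((X ⊗ 𝟙_ C) ⊗ W) T U).hom ≫ rswap (X ⊗ 𝟙_ C) W (T ⊗ U) ≫
        itensor (𝟙 X ⊗ₘ 𝟙 U) (β_ (𝟙_ C) T).hom ▷ W ≫ rswap (X ⊗ T) (𝟙_ C ⊗ U) W ≫
        ((X ⊗ T) ⊗ W) ◁ (λ_ U).hom = (ρ_ X).hom ▷ W ▷ T ▷ U ≫ rswap X W T ▷ U :=
      Wiring.unique (X := ![X, W, T, U])
        (a := .mul (.mul (.mul (.mul (.atom 0) .one) (.atom 1)) (.atom 2)) (.atom 3))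
        (by repeat' constructor) (by repeat' constructor) (by decide)
    have e₂ : (Z ⊗ (T ⊗ U)) ◁ (λ_ U).inv ≫ rswap Z (T ⊗ U) (𝟙_ C ⊗ U) ≫
        (α_ (Z ⊗ (𝟙_ C ⊗ U)) T U).inv =
      (α_ Z T U).inv ▷ U ≫ rswap (Z ⊗ T) U U ≫ rswap Z T U ▷ U ≫ (Z ◁ (λ_ U).inv) ▷ T ▷ U :=
      Wiring.unique (X := ![Z, T, U, U])
        (a := .mul (.mul (.atom 0) (.mul (.atom 1) (.atom 2))) (.atom 3))
        (by repeat' constructor) (by repeat' constructor) (by decide)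
    rw [icut, e₀]
    simp only [comp_whiskerRight, Category.assoc]
    rw [reassoc_of% e₁, e₂]
  have e' : (α_ Z T U).inv ≫ rswap Z T U = Z ◁ (β_ T U).hom ≫ (α_ Z U T).inv :=
    Wiring.unique (X := ![Z, T, U])
      (a := .mul (.atom 0) (.mul (.atom 1) (.atom 2)))
      (by repeat' constructor) (by repeat' constructor) (by decide)
  rw [icomp, vanishing_tensor, e, tr_yank]
  simp only [Category.assoc]
  rw [reassoc_of% e', ← natural_right, ← natural_left]
  simp only [Category.assoc]

/-- The first yanking equation. -/
theorem yank_int (X U : C) :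
    icomp (itensor (β_ (𝟙_ C) (X ⊗ U)).hom (𝟙 X ⊗ₘ 𝟙 U))
        (icomp ((α_ X U X).hom ⊗ₘ (α_ U X U).hom)
          (itensor (𝟙 X ⊗ₘ 𝟙 U) (β_ (U ⊗ X) (𝟙_ C)).hom)) =
      icomp ((λ_ X).hom ⊗ₘ (ρ_ U).inv) ((ρ_ X).inv ⊗ₘ (λ_ U).hom) := by
  rw [pair_icomp, pair_icomp_pair, coev_itensor_icomp, vanishing_tensor]
  -- Only wires are left under the loop over `X ⊗ U`. The right-hand side is arranged so that
  -- `tr_yank` applies first over `U` and then, to what remains, over `X`.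
  have e : (α_ (X ⊗ (𝟙_ C ⊗ U)) X U).hom ≫ (rswap X (𝟙_ C ⊗ U) (X ⊗ U) ≫
      (β_ X (X ⊗ U)).hom ▷ (𝟙_ C ⊗ U) ≫ ((α_ X U X).hom ▷ (𝟙_ C ⊗ U) ≫
      itensor (𝟙 X ⊗ₘ 𝟙 U) (β_ (U ⊗ X) (𝟙_ C)).hom ≫ (X ⊗ 𝟙_ C) ◁ (α_ U X U).hom) ≫
      (α_ (X ⊗ 𝟙_ C) U (X ⊗ U)).inv) ≫ (α_ ((X ⊗ 𝟙_ C) ⊗ U) X U).inv =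
    ((α_ X (𝟙_ C) U).inv ▷ X ≫ rswap (X ⊗ 𝟙_ C) U X) ▷ U ≫ rswap ((X ⊗ 𝟙_ C) ⊗ X) U U ≫
      (rswap (X ⊗ 𝟙_ C) X U ≫ (α_ X (𝟙_ C) U).hom ▷ X ≫ (β_ X (𝟙_ C ⊗ U)).hom ▷ X ≫
        rswap (𝟙_ C ⊗ U) X X ≫ ((β_ (𝟙_ C ⊗ U) X).hom ≫ (α_ X (𝟙_ C) U).inv) ▷ X) ▷ U :=
    Wiring.unique (X := ![X, U, X, U])
      (a := .mul (.mul (.mul (.atom 0) (.mul .one (.atom 1))) (.atom 2)) (.atom 3))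
      (by repeat' constructor) (by repeat' constructor) (by decide)
  rw [e, tr_yank]
  simp only [Category.assoc, rswap_rswap_assoc, inv_hom_whiskerRight_assoc]
  rw [tr_yank]
  exact
    Wiring.unique (X := ![X, U])
      (a := .mul (.mul .one (.atom 0)) (.mul .one (.atom 1)))
      (by repeat' constructor) (by repeat' constructor) (by decide)

/-- The second yanking equation. -/
theorem yank_dual_int (X U : C) :
    icomp (itensor (𝟙 U ⊗ₘ 𝟙 X) (β_ (𝟙_ C) (X ⊗ U)).hom)
        (icomp ((α_ U X U).inv ⊗ₘ (α_ X U X).inv)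
          (itensor (β_ (U ⊗ X) (𝟙_ C)).hom (𝟙 U ⊗ₘ 𝟙 X))) =
      icomp ((ρ_ U).hom ⊗ₘ (λ_ X).inv) ((λ_ U).inv ⊗ₘ (ρ_ X).hom) := by
  rw [pair_icomp, pair_icomp_pair, itensor_coev_icomp, vanishing_tensor]
  have e : (α_ (U ⊗ (X ⊗ 𝟙_ C)) X U).hom ≫ (rswap U (X ⊗ 𝟙_ C) (X ⊗ U) ≫
      ((α_ U X U).inv ▷ (X ⊗ 𝟙_ C) ≫ itensor (β_ (U ⊗ X) (𝟙_ C)).hom (𝟙 U ⊗ₘ 𝟙 X) ≫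
        (𝟙_ C ⊗ U) ◁ (α_ X U X).inv) ≫ (𝟙_ C ⊗ U) ◁ (β_ (X ⊗ U) X).hom ≫
      (α_ (𝟙_ C ⊗ U) X (X ⊗ U)).inv) ≫ (α_ ((𝟙_ C ⊗ U) ⊗ X) X U).inv =
    ((β_ U (X ⊗ 𝟙_ C)).hom ▷ X ≫ rswap (X ⊗ 𝟙_ C) U X) ▷ U ≫ rswap ((X ⊗ 𝟙_ C) ⊗ X) U U ≫
      (rswap (X ⊗ 𝟙_ C) X U ≫ ((α_ X (𝟙_ C) U).hom ≫ (β_ X (𝟙_ C ⊗ U)).hom) ▷ X ≫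
        rswap (𝟙_ C ⊗ U) X X) ▷ U :=
    Wiring.unique (X := ![U, X, X, U])
      (a := .mul (.mul (.mul (.atom 0) (.mul (.atom 1) .one)) (.atom 2)) (.atom 3))
      (by repeat' constructor) (by repeat' constructor) (by decide)
  rw [e, tr_yank]
  simp only [Category.assoc, rswap_rswap_assoc]
  rw [← comp_whiskerRight_assoc, tr_yank_left]
  exact
    Wiring.unique (X := ![U, X])
      (a := .mul (.mul (.atom 0) .one) (.mul (.atom 1) .one))
      (by repeat' constructor) (by repeat' constructor) (by decide)

end

/-! ### The compact closed laws of Int -/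

section

open Coherence Traced

variable {C : Type u} [Category.{v} C] [MonoidalCategory C] [SymmetricCategory C]

theorem idual_pair {X Y U V : C} (p : X ⟶ Y) (q : V ⟶ U) :
    (β_ V X).hom ≫ (p ⊗ₘ q) ≫ (β_ Y U).hom = q ⊗ₘ p := by
  rw [BraidedCategory.braiding_naturality, SymmetricCategory.symmetry_assoc]

theorem idual_idual {X Y U V : C} (f : X ⊗ V ⟶ Y ⊗ U) :
    (β_ X V).hom ≫ ((β_ V X).hom ≫ f ≫ (β_ Y U).hom) ≫ (β_ U Y).hom = f := by
  simp

variable [Traced C]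

theorem pair_icomp_pair_id {X Y U V : C} (p : X ≅ Y) (q : V ≅ U) :
    icomp (p.hom ⊗ₘ q.hom) (p.inv ⊗ₘ q.inv) = (𝟙 X ⊗ₘ 𝟙 U) := by
  rw [pair_icomp_pair, Iso.hom_inv_id, Iso.inv_hom_id]

variable (C)

/-- The Int construction yields a compact closed category. -/
theorem intData_laws : (intData C).Laws where
  id_comp f := id_icomp f
  comp_id f := icomp_id f
  comp_assoc f g h := icomp_assoc f g h
  tensor_id A B := (itensor_pair (𝟙 A.pos) (𝟙 A.neg) (𝟙 B.pos) (𝟙 B.neg)).trans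
    (congrArg₂ _ (id_tensorHom_id _ _) (id_tensorHom_id _ _))
  tensor_comp f g f' g' := itensor_icomp f g f' g'
  assoc_assocInv A B D := pair_icomp_pair_id (α_ A.pos B.pos D.pos) (α_ D.neg B.neg A.neg)
  assocInv_assoc A B D :=
    pair_icomp_pair_id (α_ A.pos B.pos D.pos).symm (α_ D.neg B.neg A.neg).symm
  assoc_natural f f' f'' := (icomp_pair _ _ _).trans
    ((itensor_assoc f f' f'').trans (pair_icomp _ _ _).symm)
  lunit_lunitInv A := pair_icomp_pair_id (λ_ A.pos) (ρ_ A.neg).symm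
  lunitInv_lunit A := pair_icomp_pair_id (λ_ A.pos).symm (ρ_ A.neg)
  lunit_natural f := (icomp_pair _ _ _).trans ((itensor_left f).trans (pair_icomp _ _ _).symm)
  runit_runitInv A := pair_icomp_pair_id (ρ_ A.pos) (λ_ A.neg).symm
  runitInv_runit A := pair_icomp_pair_id (ρ_ A.pos).symm (λ_ A.neg)
  runit_natural f := (icomp_pair _ _ _).trans ((itensor_right f).trans (pair_icomp _ _ _).symm)
  pentagon A B D E := by
    refine (congrArg₂ icomp (itensor_pair _ _ _ _) ((congrArg (icomp _) (itensor_pair _ _ _ _)).trans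
      (pair_icomp_pair _ _ _ _))).trans ((pair_icomp_pair _ _ _ _).trans
        (Eq.trans ?_ (pair_icomp_pair _ _ _ _).symm))
    refine congrArg₂ _ ?_ ?_
    · exact
        Wiring.unique (X := ![A.pos, B.pos, D.pos, E.pos])
          (a := .mul (.mul (.mul (.atom 0) (.atom 1)) (.atom 2)) (.atom 3))
          (by repeat' constructor) (by repeat' constructor) (by decide)
    -- Negative components compose backwards, so the source here comes from the negative part of the
    -- codomain `A ⊗ (B ⊗ (D ⊗ E))`.
    · exact
        Wiring.unique (X := ![A.neg, B.neg, D.neg, E.neg])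
          (a := .mul (.mul (.mul (.atom 3) (.atom 2)) (.atom 1)) (.atom 0))
          (by repeat' constructor) (by repeat' constructor) (by decide)
  triangle A B := by
    refine (congrArg (icomp _) (itensor_pair _ _ _ _)).trans ((pair_icomp_pair _ _ _ _).trans
      (Eq.trans ?_ (itensor_pair _ _ _ _).symm))
    refine congrArg₂ _ ?_ ?_
    · exact
        Wiring.unique (X := ![A.pos, B.pos])
          (a := .mul (.mul (.atom 0) .one) (.atom 1))
          (by repeat' constructor) (by repeat' constructor) (by decide)
    · exact
        Wiring.unique (X := ![A.neg, B.neg])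
          (a := .mul (.atom 1) (.atom 0))
          (by repeat' constructor) (by repeat' constructor) (by decide)
  braid_braid A B := (pair_icomp_pair _ _ _ _).trans
    (congrArg₂ _ (SymmetricCategory.symmetry _ _) (SymmetricCategory.symmetry _ _))
  braid_natural f f' := (icomp_pair _ _ _).trans
    ((itensor_braid f f').trans (pair_icomp _ _ _).symm)
  hexagon A B D := by
    refine (congrArg (icomp _) (pair_icomp_pair _ _ _ _)).trans ((pair_icomp_pair _ _ _ _).trans
      (Eq.trans ?_ (congrArg₂ icomp (itensor_pair _ _ _ _) ((congrArg (icomp _)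
        (itensor_pair _ _ _ _)).trans (pair_icomp_pair _ _ _ _))).symm))
    refine Eq.trans ?_ (pair_icomp_pair _ _ _ _).symm
    refine congrArg₂ _ ?_ ?_
    · exact
        Wiring.unique (X := ![A.pos, B.pos, D.pos])
          (a := .mul (.mul (.atom 0) (.atom 1)) (.atom 2))
          (by repeat' constructor) (by repeat' constructor) (by decide)
    · exact
        Wiring.unique (X := ![A.neg, B.neg, D.neg])
          (a := .mul (.mul (.atom 0) (.atom 2)) (.atom 1))
          (by repeat' constructor) (by repeat' constructor) (by decide)
  hexagon_inv A B D := by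
    refine (congrArg (icomp _) (pair_icomp_pair _ _ _ _)).trans ((pair_icomp_pair _ _ _ _).trans
      (Eq.trans ?_ (congrArg₂ icomp (itensor_pair _ _ _ _) ((congrArg (icomp _)
        (itensor_pair _ _ _ _)).trans (pair_icomp_pair _ _ _ _))).symm))
    refine Eq.trans ?_ (pair_icomp_pair _ _ _ _).symm
    refine congrArg₂ _ ?_ ?_
    · exact
        Wiring.unique (X := ![A.pos, B.pos, D.pos])
          (a := .mul (.atom 0) (.mul (.atom 1) (.atom 2)))
          (by repeat' constructor) (by repeat' constructor) (by decide)
    · exact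
        Wiring.unique (X := ![A.neg, B.neg, D.neg])
          (a := .mul (.atom 1) (.mul (.atom 0) (.atom 2)))
          (by repeat' constructor) (by repeat' constructor) (by decide)
  dual_dual _ := rfl
  dualHom_dualHom f := heq_of_eq (idual_idual f)
  dualHom_id A := idual_pair (𝟙 A.pos) (𝟙 A.neg)
  dualHom_comp f g := idual_icomp f g
  yank A := yank_int A.pos A.neg
  yank_dual A := yank_dual_int A.pos A.neg
  coev_natural f := coev_natural_int f

end

/-! ### Embeddings of operations into a compact closed category -/

section

variable {K : Type u} [Category.{v} K] [MonoidalCategory K] [SymmetricCategory K]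
  [CompactClosed K]

theorem coev_zigzag (A : K) :
    coev K A ▷ A ≫ (α_ A (dualObj A) A).hom ≫ A ◁ ev K A = (λ_ A).hom ≫ (ρ_ A).inv :=
  (CompactClosed.pairing A).evaluation_coevaluation'

theorem ev_zigzag (A : K) :
    dualObj A ◁ coev K A ≫ (α_ (dualObj A) A (dualObj A)).inv ≫ ev K A ▷ dualObj A =
      (ρ_ (dualObj A)).hom ≫ (λ_ (dualObj A)).inv :=
  (CompactClosed.pairing A).coevaluation_evaluation'

theorem coev_comp {A B : K} (f : A ⟶ B) :
    coev K A ≫ f ▷ dualObj A = coev K B ≫ B ◁ CompactClosed.dual.map f.op :=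
  CompactClosed.coev_natural f

/-- The dual of an arrow is its mate. -/
theorem dual_map_eq {A B : K} (f : A ⟶ B) :
    CompactClosed.dual.map f.op = (ρ_ (dualObj B)).inv ≫ dualObj B ◁ coev K A ≫
      dualObj B ◁ f ▷ dualObj A ≫ (α_ _ _ _).inv ≫ ev K B ▷ dualObj A ≫ (λ_ _).hom := by
  rw [← MonoidalCategory.whiskerLeft_comp_assoc, coev_comp, MonoidalCategory.whiskerLeft_comp_assoc,
    associator_inv_naturality_right_assoc, whisker_exchange_assoc, leftUnitor_naturality,
    reassoc_of% ev_zigzag B]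
  simp

/-- Only the units are assumed natural. Naturality of the counits follows because `dual_map_eq`
identifies the dual arrow with the mate. -/
theorem ev_comp {A B : K} (f : A ⟶ B) :
    CompactClosed.dual.map f.op ▷ A ≫ ev K A = dualObj B ◁ f ≫ ev K B := by
  let _ := CompactClosed.pairing A
  let _ := CompactClosed.pairing B
  let _ : HasRightDual A := ⟨dualObj A⟩
  let _ : HasRightDual B := ⟨dualObj B⟩
  have e : CompactClosed.dual.map f.op = rightAdjointMate f := dual_map_eq f
  rw [e]
  exact rightAdjointMate_comp_evaluation f

/-- The zigzag equation makes the comparison the only arrow compatible with evaluation, so it is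
found by checking one square. -/
theorem dualComparison_eq {L : Type w} [Category.{v} L] [MonoidalCategory L] [SymmetricCategory L]
    [CompactClosed L] (F : L ⥤ K) [F.Monoidal] (A : L)
    (d : F.obj (dualObj A) ⟶ dualObj (F.obj A))
    (h : Functor.LaxMonoidal.μ F (dualObj A) A ≫ F.map (ev L A) ≫ Functor.OplaxMonoidal.η F =
      d ▷ F.obj A ≫ ev K (F.obj A)) : dualComparison F A = d := by
  rw [dualComparison, h, comp_whiskerRight, Category.assoc, ← associator_inv_naturality_left_assoc,
    whisker_exchange_assoc, reassoc_of% ev_zigzag (F.obj A), Iso.inv_hom_id, Category.comp_id,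
    ← rightUnitor_inv_naturality_assoc, Iso.inv_hom_id, Category.comp_id]

theorem mapApp_id {R : K} (app : Reflexivity R) : mapApp (𝟭 K) app = app.hom := by
  have e : dualComparison (𝟭 K) R = 𝟙 (dualObj R) := dualComparison_eq _ _ _ (by simp)
  rw [mapApp, ihomComparison, e]
  simp

end

/-- An interpretation of the operations `P` in a compact closed category `K` that is injective on
arrows and compatible with the operations up to coherent isomorphisms. -/
structure Embedding {T : Type w} (P : CCData.{v} T) (K : Type u) [Category.{v} K]
    [MonoidalCategory K] [SymmetricCategory K] [CompactClosed K] where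
  obj : T → K
  map : ∀ {A B}, P.Hom A B → (obj A ⟶ obj B)
  map_injective : ∀ {A B} {f g : P.Hom A B}, map f = map g → f = g
  map_id : ∀ A, map (P.id A) = 𝟙 (obj A)
  map_comp : ∀ {A B D} (f : P.Hom A B) (g : P.Hom B D), map (P.comp f g) = map f ≫ map g
  ε : 𝟙_ K ≅ obj P.unit
  μ : ∀ A B, obj A ⊗ obj B ≅ obj (P.tensor A B)
  map_tensorHom : ∀ {A B A' B'} (f : P.Hom A B) (g : P.Hom A' B'),
    map (P.tensorHom f g) = (μ A A').inv ≫ (map f ⊗ₘ map g) ≫ (μ B B').hom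
  map_assoc : ∀ A B D, map (P.assoc A B D) = (μ (P.tensor A B) D).inv ≫ (μ A B).inv ▷ obj D ≫
    (α_ (obj A) (obj B) (obj D)).hom ≫ obj A ◁ (μ B D).hom ≫ (μ A (P.tensor B D)).hom
  map_assocInv : ∀ A B D, map (P.assocInv A B D) = (μ A (P.tensor B D)).inv ≫
    obj A ◁ (μ B D).inv ≫ (α_ (obj A) (obj B) (obj D)).inv ≫ (μ A B).hom ▷ obj D ≫
      (μ (P.tensor A B) D).hom
  map_lunit : ∀ A, map (P.lunit A) = (μ P.unit A).inv ≫ ε.inv ▷ obj A ≫ (λ_ (obj A)).hom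
  map_lunitInv : ∀ A, map (P.lunitInv A) = (λ_ (obj A)).inv ≫ ε.hom ▷ obj A ≫ (μ P.unit A).hom
  map_runit : ∀ A, map (P.runit A) = (μ A P.unit).inv ≫ obj A ◁ ε.inv ≫ (ρ_ (obj A)).hom
  map_runitInv : ∀ A, map (P.runitInv A) = (ρ_ (obj A)).inv ≫ obj A ◁ ε.hom ≫ (μ A P.unit).hom
  map_braid : ∀ A B, map (P.braid A B) = (μ A B).inv ≫ (β_ (obj A) (obj B)).hom ≫ (μ B A).hom
  δ : ∀ A, obj (P.dual A) ≅ dualObj (obj A)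
  map_dualHom : ∀ {A B} (f : P.Hom A B),
    map (P.dualHom f) = (δ B).hom ≫ CompactClosed.dual.map (map f).op ≫ (δ A).inv
  map_coev : ∀ A, map (P.coev A) = ε.inv ≫ coev K (obj A) ≫ obj A ◁ (δ A).inv ≫
    (μ A (P.dual A)).hom
  map_ev : ∀ A, map (P.ev A) = (μ (P.dual A) A).inv ≫ (δ A).hom ▷ obj A ≫ ev K (obj A) ≫ ε.hom
  dual_dual : ∀ A, P.dual (P.dual A) = A
  dualHom_dualHom : ∀ {A B} (f : P.Hom A B), HEq (P.dualHom (P.dualHom f)) f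

namespace Embedding

variable {T : Type w} {P : CCData.{v} T} {K : Type u} [Category.{v} K]
    [MonoidalCategory K] [SymmetricCategory K] [CompactClosed K]

/-- Except for involutivity of the dual, every law equates parallel arrows; `map` turns it into the
corresponding law of `K` up to cancelling comparisons. Strict involutivity cannot be reflected from
`K` in this way, so it is a field of `Embedding`. -/
theorem laws (e : Embedding P K) : P.Laws where
  id_comp f := e.map_injective (by rw [e.map_comp, e.map_id, Category.id_comp])
  comp_id f := e.map_injective (by rw [e.map_comp, e.map_id, Category.comp_id])
  comp_assoc f g h := e.map_injective (by simp only [e.map_comp, Category.assoc])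
  tensor_id A B := e.map_injective (by simp [e.map_tensorHom, e.map_id])
  tensor_comp f g f' g' := e.map_injective (by simp [e.map_tensorHom, e.map_comp])
  assoc_assocInv A B D := e.map_injective (by simp [e.map_comp, e.map_id, e.map_assoc, e.map_assocInv])
  assocInv_assoc A B D := e.map_injective (by simp [e.map_comp, e.map_id, e.map_assoc, e.map_assocInv])
  assoc_natural f f' f'' := e.map_injective (by
    simp only [e.map_comp, e.map_tensorHom, e.map_assoc, comp_comp_tensorHom, tensorHom_comp_comp,
      Category.assoc, Iso.hom_inv_id_assoc, hom_inv_whiskerRight_assoc, whiskerLeft_hom_inv_assoc,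
      associator_naturality_assoc])
  lunit_lunitInv A := e.map_injective (by simp [e.map_comp, e.map_id, e.map_lunit, e.map_lunitInv])
  lunitInv_lunit A := e.map_injective (by simp [e.map_comp, e.map_id, e.map_lunit, e.map_lunitInv])
  lunit_natural f := e.map_injective (by
    simp [e.map_comp, e.map_id, e.map_tensorHom, e.map_lunit]
    rw [whisker_exchange_assoc, leftUnitor_naturality])
  runit_runitInv A := e.map_injective (by simp [e.map_comp, e.map_id, e.map_runit, e.map_runitInv])
  runitInv_runit A := e.map_injective (by simp [e.map_comp, e.map_id, e.map_runit, e.map_runitInv])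
  runit_natural f := e.map_injective (by
    simp [e.map_comp, e.map_id, e.map_tensorHom, e.map_runit]
    rw [← whisker_exchange_assoc, rightUnitor_naturality])
  pentagon A B D E := e.map_injective (by
    simp [e.map_comp, e.map_id, e.map_tensorHom, e.map_assoc]
    rw [whisker_exchange_assoc]
    simp)
  triangle A B := e.map_injective (by
    simp [e.map_comp, e.map_id, e.map_tensorHom, e.map_assoc, e.map_lunit, e.map_runit])
  braid_braid A B := e.map_injective (by simp [e.map_comp, e.map_id, e.map_braid])
  braid_natural f f' := e.map_injective (by simp [e.map_comp, e.map_tensorHom, e.map_braid])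
  hexagon A B D := e.map_injective (by
    simp [e.map_comp, e.map_id, e.map_tensorHom, e.map_braid, e.map_assoc])
  hexagon_inv A B D := e.map_injective (by
    simp [e.map_comp, e.map_id, e.map_tensorHom, e.map_braid, e.map_assocInv])
  dual_dual := e.dual_dual
  dualHom_dualHom := e.dualHom_dualHom
  dualHom_id A := e.map_injective (by simp [e.map_dualHom, e.map_id])
  dualHom_comp f g := e.map_injective (by simp [e.map_dualHom, e.map_comp])
  yank A := e.map_injective (by
    simp [e.map_comp, e.map_id, e.map_tensorHom, e.map_assoc, e.map_coev, e.map_ev, e.map_lunit,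
      e.map_runitInv]
    rw [reassoc_of% coev_zigzag (e.obj A)])
  yank_dual A := e.map_injective (by
    simp [e.map_comp, e.map_id, e.map_tensorHom, e.map_assocInv, e.map_coev, e.map_ev, e.map_runit,
      e.map_lunitInv]
    rw [← associator_inv_naturality_left_assoc, whisker_exchange_assoc, whisker_exchange_assoc,
      whisker_exchange_assoc, associator_inv_naturality_right_assoc, whisker_exchange_assoc,
      reassoc_of% ev_zigzag (e.obj A), ← whisker_exchange_assoc,
      ← leftUnitor_inv_naturality_assoc, rightUnitor_naturality_assoc]
    simp)
  coev_natural f := e.map_injective (by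
    simp [e.map_comp, e.map_id, e.map_tensorHom, e.map_coev, e.map_dualHom]
    rw [whisker_exchange_assoc, reassoc_of% coev_comp (e.map f)])

variable (e : Embedding P K)

theorem whiskerRight_μ {A B : T} (f : P.Hom A B) (D : T) :
    e.map f ▷ e.obj D ≫ (e.μ B D).hom = (e.μ A D).hom ≫ e.map (P.tensorHom f (P.id D)) := by
  rw [e.map_tensorHom, e.map_id, tensorHom_id, Iso.hom_inv_id_assoc]

theorem whiskerLeft_μ {A B : T} (D : T) (f : P.Hom A B) :
    e.obj D ◁ e.map f ≫ (e.μ D B).hom = (e.μ D A).hom ≫ e.map (P.tensorHom (P.id D) f) := by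
  rw [e.map_tensorHom, e.map_id, id_tensorHom, Iso.hom_inv_id_assoc]

theorem μ_assoc (A B D : T) :
    (e.μ A B).hom ▷ e.obj D ≫ (e.μ (P.tensor A B) D).hom ≫ e.map (P.assoc A B D) =
      (α_ (e.obj A) (e.obj B) (e.obj D)).hom ≫ e.obj A ◁ (e.μ B D).hom ≫
        (e.μ A (P.tensor B D)).hom := by
  simp [e.map_assoc]

theorem μ_lunit (A : T) :
    (λ_ (e.obj A)).hom = e.ε.hom ▷ e.obj A ≫ (e.μ P.unit A).hom ≫ e.map (P.lunit A) := by
  simp [e.map_lunit]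

theorem μ_runit (A : T) :
    (ρ_ (e.obj A)).hom = e.obj A ◁ e.ε.hom ≫ (e.μ A P.unit).hom ≫ e.map (P.runit A) := by
  simp [e.map_runit]

theorem μ_braid (A B : T) :
    (e.μ A B).hom ≫ e.map (P.braid A B) = (β_ (e.obj A) (e.obj B)).hom ≫ (e.μ B A).hom := by
  simp [e.map_braid]

theorem μ_ev (A : T) : (e.μ (P.dual A) A).hom ≫ e.map (P.ev A) ≫ e.ε.inv =
    (e.δ A).hom ▷ e.obj A ≫ ev K (e.obj A) := by
  simp [e.map_ev]

/-- The comparison functor. -/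
def functor (h : P.Laws) : h.Obj ⥤ K where
  obj A := e.obj A
  map f := e.map f
  map_id A := e.map_id A
  map_comp f g := e.map_comp f g

def coreMonoidal (h : P.Laws) : (e.functor h).CoreMonoidal where
  εIso := e.ε
  μIso A B := e.μ A B
  μIso_hom_natural_left f D := e.whiskerRight_μ f D
  μIso_hom_natural_right D f := e.whiskerLeft_μ D f
  associativity A B D := e.μ_assoc A B D
  left_unitality A := e.μ_lunit A
  right_unitality A := e.μ_runit A

instance monoidal (h : P.Laws) : (e.functor h).Monoidal := (e.coreMonoidal h).toMonoidal

instance braided (h : P.Laws) : (e.functor h).Braided where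
  braided A B := e.μ_braid A B

instance faithful (h : P.Laws) : (e.functor h).Faithful where
  map_injective h := e.map_injective h

theorem dualComparison_functor (h : P.Laws) (A : h.Obj) :
    dualComparison (e.functor h) A = (e.δ A).hom :=
  dualComparison_eq _ _ _ (e.μ_ev A)

theorem mapApp_functor (h : P.Laws) {N : h.Obj} (app : Reflexivity N) :
    mapApp (e.functor h) app =
      e.map app.hom ≫ (e.μ (P.dual N) N).inv ≫ (e.δ N).hom ▷ e.obj N := by
  rw [mapApp, ihomComparison, dualComparison_functor]
  rfl

/-- If an object `N` of a small compact closed category satisfies `N = [N → N]` and its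
reflexivity is the identity, then an embedding of the category strictifies the image of `N`. -/
def strictification {T : Type v} {P : CCData.{v} T} (e : Embedding P K) (h : P.Laws) (N : h.Obj)
    (hN : N = ihom N N) (app : Reflexivity (e.obj N))
    (happ : e.map (eqToHom hN) ≫ (e.μ (P.dual N) N).inv ≫ (e.δ N).hom ▷ e.obj N = app.hom) :
    MonoidalStrictification (e.obj N) app h.Obj where
  S := ⟨h.Obj⟩
  Γ := e.functor h
  braidedΓ := e.braided h
  faithfulΓ := e.faithful h
  N := N
  appN := eqToIso hN
  obj_eq := rfl
  app_eq := by
    rw [mapApp_functor]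
    exact happ.trans ((Category.id_comp _).trans (Category.comp_id _)).symm
  -- The object already equals its own function space in the source, so the source serves as the
  -- target.
  E := 𝟭 _
  braidedE := inferInstance
  equivalenceE := inferInstance
  strict_obj := hN
  strict_app := mapApp_id _

end Embedding

/-! ### Operations induced by a map of objects -/

section

variable {K : Type u} [Category.{v} K] [MonoidalCategory K] [SymmetricCategory K]
  [CompactClosed K]

/-- Data on a type of objects from which operations can be pulled back from `K`. -/
structure InducingData (T : Type w) (K : Type u) [Category.{v} K] [MonoidalCategory K]
    [SymmetricCategory K] [CompactClosed K] where
  obj : T → K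
  unit : T
  tensor : T → T → T
  dual : T → T
  ε : 𝟙_ K ≅ obj unit
  μ : ∀ A B, obj A ⊗ obj B ≅ obj (tensor A B)
  δ : ∀ A, obj (dual A) ≅ dualObj (obj A)

namespace InducingData

variable {T : Type w} (i : InducingData T K)

/-- Each operation is that of `K` conjugated by the comparisons, exactly as `Embedding` prescribes,
so its compatibility fields hold by `rfl`. -/
def data : CCData.{v} T where
  Hom A B := i.obj A ⟶ i.obj B
  id A := 𝟙 (i.obj A)
  comp f g := f ≫ g
  unit := i.unit
  tensor := i.tensor
  tensorHom {A B A' B'} f g := (i.μ A A').inv ≫ (f ⊗ₘ g) ≫ (i.μ B B').hom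
  assoc A B D := (i.μ (i.tensor A B) D).inv ≫ (i.μ A B).inv ▷ i.obj D ≫
    (α_ (i.obj A) (i.obj B) (i.obj D)).hom ≫ i.obj A ◁ (i.μ B D).hom ≫
      (i.μ A (i.tensor B D)).hom
  assocInv A B D := (i.μ A (i.tensor B D)).inv ≫ i.obj A ◁ (i.μ B D).inv ≫
    (α_ (i.obj A) (i.obj B) (i.obj D)).inv ≫ (i.μ A B).hom ▷ i.obj D ≫
      (i.μ (i.tensor A B) D).hom
  lunit A := (i.μ i.unit A).inv ≫ i.ε.inv ▷ i.obj A ≫ (λ_ (i.obj A)).hom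
  lunitInv A := (λ_ (i.obj A)).inv ≫ i.ε.hom ▷ i.obj A ≫ (i.μ i.unit A).hom
  runit A := (i.μ A i.unit).inv ≫ i.obj A ◁ i.ε.inv ≫ (ρ_ (i.obj A)).hom
  runitInv A := (ρ_ (i.obj A)).inv ≫ i.obj A ◁ i.ε.hom ≫ (i.μ A i.unit).hom
  braid A B := (i.μ A B).inv ≫ (β_ (i.obj A) (i.obj B)).hom ≫ (i.μ B A).hom
  dual := i.dual
  dualHom {A B} f := (i.δ B).hom ≫ CompactClosed.dual.map f.op ≫ (i.δ A).inv
  coev A := i.ε.inv ≫ coev K (i.obj A) ≫ i.obj A ◁ (i.δ A).inv ≫ (i.μ A (i.dual A)).hom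
  ev A := (i.μ (i.dual A) A).inv ≫ (i.δ A).hom ▷ i.obj A ≫ ev K (i.obj A) ≫ i.ε.hom

/-- The pulled back operations embed into `K`, provided that the dual is involutive. -/
def embedding (h₁ : ∀ A, i.dual (i.dual A) = A)
    (h₂ : ∀ {A B : T} (f : i.data.Hom A B), HEq (i.data.dualHom (i.data.dualHom f)) f) :
    Embedding i.data K where
  obj := i.obj
  map f := f
  map_injective h := h
  map_id _ := rfl
  map_comp _ _ := rfl
  ε := i.ε
  μ := i.μ
  map_tensorHom _ _ := rfl
  map_assoc _ _ _ := rfl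
  map_assocInv _ _ _ := rfl
  map_lunit _ := rfl
  map_lunitInv _ := rfl
  map_runit _ := rfl
  map_runitInv _ := rfl
  map_braid _ _ := rfl
  δ := i.δ
  map_dualHom _ := rfl
  map_coev _ := rfl
  map_ev _ := rfl
  dual_dual := h₁
  dualHom_dualHom := h₂

end InducingData

/-- Two objects: a unit object and one other object. -/
inductive Two : Type v
  | unit : Two
  | pt : Two

/-- A self-dual object `R` with `R ⊗ R ≅ R` makes `Two` a category with the tensor product in
which both the unit and `R` are idempotent. -/
def Two.inducing (R : K) (m : R ⊗ R ≅ R) (d₀ : 𝟙_ K ≅ dualObj (𝟙_ K)) (d : R ≅ dualObj R) :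
    InducingData Two.{v} K where
  obj
    | unit => 𝟙_ K
    | pt => R
  unit := unit
  tensor
    | unit, Y => Y
    | pt, _ => pt
  dual A := A
  ε := Iso.refl _
  μ
    | unit, unit => λ_ (𝟙_ K)
    | unit, pt => λ_ R
    | pt, unit => ρ_ R
    | pt, pt => m
  δ
    | unit => d₀
    | pt => d

end

/-! ### Strictification of an arbitrary reflexive object of Int -/

section

variable {C : Type u} [Category.{v} C] [MonoidalCategory C] [SymmetricCategory C] [Traced C]

/-- The dual pulled back along `d` sends `f` to `dB ≫ f* ≫ dA⁻¹`. Applied twice it gives `dA ≫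
(dA⁻¹)* ≫ f** ≫ dB* ≫ dB⁻¹`, which collapses to `f` because the isomorphisms are fixed by the dual.
-/
theorem dualHom_dualHom_of_symm (h : (intData C).Laws) {A B : IntObj C} (f : (intData C).Hom A B)
    (dA : (intData C).Hom A ((intData C).dual A)) (dA' : (intData C).Hom ((intData C).dual A) A)
    (dB : (intData C).Hom B ((intData C).dual B)) (dB' : (intData C).Hom ((intData C).dual B) B)
    (hA : (intData C).comp dA dA' = (intData C).id A)
    (hB : (intData C).comp dB dB' = (intData C).id B)
    (sA : (intData C).dualHom dA' = dA') (sB : (intData C).dualHom dB = dB) :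
    (intData C).comp dA ((intData C).comp ((intData C).dualHom
      ((intData C).comp dB ((intData C).comp ((intData C).dualHom f) dA'))) dB') = f := by
  have e : (intData C).dualHom ((intData C).dualHom f) = f := idual_idual f
  rw [h.dualHom_comp, h.dualHom_comp, e]
  refine (congrArg₂ (fun x y => (intData C).comp dA ((intData C).comp
    ((intData C).comp ((intData C).comp x f) y) dB')) sA sB).trans ?_
  rw [h.comp_assoc, h.comp_assoc, hB, h.comp_id, ← h.comp_assoc, hA, h.id_comp]

variable (h : (intData C).Laws)

/-- A reflexive object of `Int C` is isomorphic to its dual. -/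
def selfDual {X : h.Obj} (app : Reflexivity X) : X ≅ dualObj X :=
  -- For `X = (P, U)`, `[X → X]` is `(U ⊗ P, U ⊗ P)`, which is its own dual by definition; this is
  -- why `app` and its dual are composable.
  app ≪≫ (CompactClosed.dual.mapIso app.op : ihom X X ≅ dualObj X)

/-- The dual reverses composition and is involutive, so `(app ≫ app*)* = app** ≫ app* = app ≫ app*`.
-/
theorem dualHom_selfDual_hom {X : h.Obj} (app : Reflexivity X) :
    (intData C).dualHom (selfDual h app).hom = (selfDual h app).hom := by
  refine (h.dualHom_comp (B := (ihom X X : h.Obj)) app.hom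
    ((intData C).dualHom (B := (ihom X X : h.Obj)) app.hom)).trans ?_
  exact congrArg (fun x => (intData C).comp x ((intData C).dualHom (B := (ihom X X : h.Obj)) app.hom)) (idual_idual _)

theorem dualHom_selfDual_inv {X : h.Obj} (app : Reflexivity X) :
    (intData C).dualHom (selfDual h app).inv = (selfDual h app).inv := by
  refine (h.dualHom_comp (B := (ihom X X : h.Obj)) ((intData C).dualHom (A := (ihom X X : h.Obj)) app.inv)
    app.inv).trans ?_
  exact congrArg (fun x => (intData C).comp ((intData C).dualHom app.inv) x) (idual_idual _)

/-- The embedding of a category with two objects into `Int C` given by a reflexive object. -/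
def reflexiveEmbedding {X : h.Obj} (app : Reflexivity X) :
    Embedding (Two.inducing X (app ≪≫ whiskerRightIso (selfDual h app).symm X).symm
      (Iso.refl _) (selfDual h app)).data h.Obj :=
  InducingData.embedding _ (fun _ => rfl) (by
    intro A B f
    apply heq_of_eq
    have hu : (intData C).comp ((intData C).id (IntObj.unit C)) ((intData C).id (IntObj.unit C)) =
      (intData C).id (IntObj.unit C) := h.id_comp _
    have su : (intData C).dualHom ((intData C).id (IntObj.unit C)) =
      (intData C).id (IntObj.unit C) := h.dualHom_id _
    cases A <;> cases B
    · exact dualHom_dualHom_of_symm h _ _ _ _ _ hu hu su su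
    · exact dualHom_dualHom_of_symm h _ _ _ _ _ hu (selfDual h app).hom_inv_id su
        (dualHom_selfDual_hom h app)
    · exact dualHom_dualHom_of_symm h _ _ _ _ _ (selfDual h app).hom_inv_id hu
        (dualHom_selfDual_inv h app) su
    · exact dualHom_dualHom_of_symm h _ _ _ _ _ (selfDual h app).hom_inv_id
        (selfDual h app).hom_inv_id (dualHom_selfDual_inv h app) (dualHom_selfDual_hom h app))

theorem exists_strictification (X : h.Obj) (app : Reflexivity X) :
    ∃ D : SmallCompactClosed.{v}, Nonempty (MonoidalStrictification X app D.carrier) := by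
  refine ⟨⟨(reflexiveEmbedding h app).laws.Obj⟩, ⟨Embedding.strictification
    (reflexiveEmbedding h app) _ Two.pt rfl app ?_⟩⟩
  -- The multiplication on `X` was chosen inverse to `app ≫ d⁻¹ ▷ X`, so that the dual comparison
  -- `d` cancels and `app` remains.
  change 𝟙 X ≫ (app.hom ≫ (selfDual h app).inv ▷ X) ≫ (selfDual h app).hom ▷ X = app.hom
  simp

end

/-! ### The action of a braided functor on arrows of the Int construction -/

section

variable {D : Type w} [Category.{v} D] [MonoidalCategory D] [SymmetricCategory D]
  {C : Type u} [Category.{v} C] [MonoidalCategory C] [SymmetricCategory C]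
  (F : D ⥤ C) [F.Braided]

open Functor.LaxMonoidal Functor.OplaxMonoidal

/-- The action of a strong monoidal functor on arrows of the Int construction. -/
def imap {X Y U V : D} (f : X ⊗ V ⟶ Y ⊗ U) : F.obj X ⊗ F.obj V ⟶ F.obj Y ⊗ F.obj U :=
  μ F X V ≫ F.map f ≫ δ F Y U

theorem map_eq_imap {X Y U V : D} (f : X ⊗ V ⟶ Y ⊗ U) :
    F.map f = δ F X V ≫ imap F f ≫ μ F Y U := by
  simp [imap]

theorem imap_pair {X Y U V : D} (p : X ⟶ Y) (q : V ⟶ U) :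
    imap F (p ⊗ₘ q) = (F.map p ⊗ₘ F.map q) := by
  rw [imap, ← μ_natural_assoc, Functor.Monoidal.μ_δ, Category.comp_id]

theorem map_rswap (A B E : D) :
    F.map (rswap A B E) = δ F (A ⊗ B) E ≫ δ F A B ▷ F.obj E ≫ rswap (F.obj A) (F.obj B) (F.obj E) ≫
      μ F A E ▷ F.obj B ≫ μ F (A ⊗ E) B := by
  simp only [rswap, Functor.map_comp, Functor.Monoidal.map_associator,
    Functor.Monoidal.map_associator_inv, Functor.Monoidal.map_whiskerLeft, Functor.map_braiding,
    Category.assoc, Functor.Monoidal.μ_δ_assoc, MonoidalCategory.whiskerLeft_comp,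
    Functor.Monoidal.whiskerLeft_μ_δ_assoc]

/-- The comparisons between consecutive factors cancel. Those left at the ends are whiskered by the
traced object, so naturality can take them out of the trace. -/
theorem imap_icut {X Y Z U V W : D} (f : X ⊗ V ⟶ Y ⊗ U) (g : Y ⊗ W ⟶ Z ⊗ V) :
    imap F (icut f g) = δ F X W ▷ F.obj V ≫ icut (imap F f) (imap F g) ≫ μ F Z U ▷ F.obj V := by
  rw [imap, icut]
  simp only [Functor.map_comp, map_rswap, Functor.Monoidal.map_whiskerRight, map_eq_imap F f,
    map_eq_imap F g]
  simp [icut]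

theorem map_tensorμ (A B A' B' : D) :
    F.map (tensorμ A B A' B') = δ F (A ⊗ B) (A' ⊗ B') ≫ (δ F A B ⊗ₘ δ F A' B') ≫
      tensorμ (F.obj A) (F.obj B) (F.obj A') (F.obj B') ≫ (μ F A A' ⊗ₘ μ F B B') ≫
        μ F (A ⊗ A') (B ⊗ B') := by
  rw [tensorμ_comp_μ_tensorHom_μ_comp_μ, tensorHom_comp_tensorHom_assoc]
  simp

theorem imap_itensor {X Y U V X' Y' U' V' : D} (f : X ⊗ V ⟶ Y ⊗ U) (g : X' ⊗ V' ⟶ Y' ⊗ U') :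
    imap F (itensor f g) = (δ F X X' ⊗ₘ δ F V' V) ≫ itensor (imap F f) (imap F g) ≫
      (μ F Y Y' ⊗ₘ μ F U' U) := by
  rw [imap, itensor]
  simp only [Functor.map_comp, map_tensorμ, Functor.Monoidal.map_whiskerLeft,
    Functor.Monoidal.map_tensor, map_eq_imap F f, map_eq_imap F g, Functor.map_braiding]
  simp only [itensor, Category.assoc, Functor.Monoidal.μ_δ_assoc, Functor.Monoidal.μ_δ,
    Category.comp_id, ← id_tensorHom, tensorHom_comp_tensorHom, tensorHom_comp_tensorHom_assoc,
    Category.id_comp]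

theorem imap_idual {X Y U V : D} (f : X ⊗ V ⟶ Y ⊗ U) :
    imap F ((β_ V X).hom ≫ f ≫ (β_ Y U).hom) =
      (β_ (F.obj V) (F.obj X)).hom ≫ imap F f ≫ (β_ (F.obj Y) (F.obj U)).hom := by
  simp [imap, Functor.map_braiding]

variable [Traced C]

/-- Here and in the lemmas through `imap_braid`, the right-hand side is the formula required by a
field of `Embedding`, with comparisons of `F` as positive components and their inverses as negative
ones. Both sides are pairs, so monoidality of `F` settles each component. -/
theorem imap_assoc (X Y Z U V W : D) : imap F ((α_ X Y Z).hom ⊗ₘ (α_ W V U).hom) =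
    icomp (δ F (X ⊗ Y) Z ⊗ₘ μ F W (V ⊗ U)) (icomp
      (itensor (δ F X Y ⊗ₘ μ F V U) (𝟙 (F.obj Z) ⊗ₘ 𝟙 (F.obj W))) (icomp
        ((α_ (F.obj X) (F.obj Y) (F.obj Z)).hom ⊗ₘ (α_ (F.obj W) (F.obj V) (F.obj U)).hom) (icomp
          (itensor (𝟙 (F.obj X) ⊗ₘ 𝟙 (F.obj U)) (μ F Y Z ⊗ₘ δ F W V))
          (μ F X (Y ⊗ Z) ⊗ₘ δ F (W ⊗ V) U)))) := by
  simp only [imap_pair, itensor_pair, pair_icomp_pair]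
  simp only [Functor.Monoidal.map_associator,
    id_tensorHom, tensorHom_id, Category.assoc]

theorem imap_assocInv (X Y Z U V W : D) : imap F ((α_ X Y Z).inv ⊗ₘ (α_ W V U).inv) =
    icomp (δ F X (Y ⊗ Z) ⊗ₘ μ F (W ⊗ V) U) (icomp
      (itensor (𝟙 (F.obj X) ⊗ₘ 𝟙 (F.obj U)) (δ F Y Z ⊗ₘ μ F W V)) (icomp
        ((α_ (F.obj X) (F.obj Y) (F.obj Z)).inv ⊗ₘ (α_ (F.obj W) (F.obj V) (F.obj U)).inv) (icomp
          (itensor (μ F X Y ⊗ₘ δ F V U) (𝟙 (F.obj Z) ⊗ₘ 𝟙 (F.obj W)))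
          (μ F (X ⊗ Y) Z ⊗ₘ δ F W (V ⊗ U))))) := by
  simp only [imap_pair, itensor_pair, pair_icomp_pair]
  simp only [Functor.Monoidal.map_associator_inv,
    id_tensorHom, tensorHom_id, Category.assoc]

theorem imap_lunit (X U : D) : imap F ((λ_ X).hom ⊗ₘ (ρ_ U).inv) =
    icomp (δ F (𝟙_ D) X ⊗ₘ μ F U (𝟙_ D)) (icomp
      (itensor (η F ⊗ₘ ε F) (𝟙 (F.obj X) ⊗ₘ 𝟙 (F.obj U)))
      ((λ_ (F.obj X)).hom ⊗ₘ (ρ_ (F.obj U)).inv)) := by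
  simp only [imap_pair, itensor_pair, pair_icomp_pair]
  simp only [Functor.Monoidal.map_leftUnitor,
    Functor.Monoidal.map_rightUnitor_inv, id_tensorHom, tensorHom_id, Category.assoc]

theorem imap_lunitInv (X U : D) : imap F ((λ_ X).inv ⊗ₘ (ρ_ U).hom) =
    icomp ((λ_ (F.obj X)).inv ⊗ₘ (ρ_ (F.obj U)).hom) (icomp
      (itensor (ε F ⊗ₘ η F) (𝟙 (F.obj X) ⊗ₘ 𝟙 (F.obj U)))
      (μ F (𝟙_ D) X ⊗ₘ δ F U (𝟙_ D))) := by
  simp only [imap_pair, itensor_pair, pair_icomp_pair]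
  simp only [Functor.Monoidal.map_leftUnitor_inv,
    Functor.Monoidal.map_rightUnitor, id_tensorHom, tensorHom_id, Category.assoc]

theorem imap_runit (X U : D) : imap F ((ρ_ X).hom ⊗ₘ (λ_ U).inv) =
    icomp (δ F X (𝟙_ D) ⊗ₘ μ F (𝟙_ D) U) (icomp
      (itensor (𝟙 (F.obj X) ⊗ₘ 𝟙 (F.obj U)) (η F ⊗ₘ ε F))
      ((ρ_ (F.obj X)).hom ⊗ₘ (λ_ (F.obj U)).inv)) := by
  simp only [imap_pair, itensor_pair, pair_icomp_pair]
  simp only [Functor.Monoidal.map_rightUnitor,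
    Functor.Monoidal.map_leftUnitor_inv, id_tensorHom, tensorHom_id, Category.assoc]

theorem imap_runitInv (X U : D) : imap F ((ρ_ X).inv ⊗ₘ (λ_ U).hom) =
    icomp ((ρ_ (F.obj X)).inv ⊗ₘ (λ_ (F.obj U)).hom) (icomp
      (itensor (𝟙 (F.obj X) ⊗ₘ 𝟙 (F.obj U)) (ε F ⊗ₘ η F))
      (μ F X (𝟙_ D) ⊗ₘ δ F (𝟙_ D) U)) := by
  simp only [imap_pair, itensor_pair, pair_icomp_pair]
  simp only [Functor.Monoidal.map_rightUnitor_inv,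
    Functor.Monoidal.map_leftUnitor, id_tensorHom, tensorHom_id, Category.assoc]

theorem imap_braid (X Y U V : D) : imap F ((β_ X Y).hom ⊗ₘ (β_ U V).hom) =
    icomp (δ F X Y ⊗ₘ μ F V U) (icomp
      ((β_ (F.obj X) (F.obj Y)).hom ⊗ₘ (β_ (F.obj U) (F.obj V)).hom)
      (μ F Y X ⊗ₘ δ F U V)) := by
  simp only [imap_pair, pair_icomp_pair, Functor.map_braiding, Category.assoc]

theorem imap_itensor_eq_icomp {X Y U V X' Y' U' V' : D} (f : X ⊗ V ⟶ Y ⊗ U)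
    (g : X' ⊗ V' ⟶ Y' ⊗ U') : imap F (itensor f g) =
      icomp (δ F X X' ⊗ₘ μ F U' U) (icomp (itensor (imap F f) (imap F g))
        (μ F Y Y' ⊗ₘ δ F V' V)) := by
  rw [imap_itensor, pair_icomp, icomp_pair, tensorHom_def', MonoidalCategory.tensorHom_def]
  simp only [Category.assoc]
  rw [whisker_exchange_assoc]

/-- The tensor product of identities is `obj A ◁ (δ A).inv` for the identity comparison of duals;
keeping it makes the formula match `Embedding.map_coev` definitionally. The same holds in `imap_ev`.
-/
theorem imap_coev (X U : D) : imap F (β_ (𝟙_ D) (X ⊗ U)).hom =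
    icomp (η F ⊗ₘ ε F) (icomp (β_ (𝟙_ C) (F.obj X ⊗ F.obj U)).hom (icomp
      (itensor (𝟙 (F.obj X) ⊗ₘ 𝟙 (F.obj U)) (𝟙 (F.obj U) ⊗ₘ 𝟙 (F.obj X)))
      (μ F X U ⊗ₘ δ F X U))) := by
  rw [itensor_pair, pair_icomp_pair, icomp_pair, pair_icomp]
  simp only [imap, Functor.map_braiding, id_tensorHom_id, Category.id_comp, Category.comp_id,
    Category.assoc, Functor.Monoidal.μ_δ, Functor.Monoidal.μ_δ_assoc,
    BraidedCategory.braiding_naturality_right_assoc, Functor.Monoidal.whiskerRight_δ_μ_assoc,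
    BraidedCategory.braiding_naturality_left_assoc, ← MonoidalCategory.whiskerLeft_comp,
    Functor.Monoidal.η_ε, MonoidalCategory.whiskerLeft_id]

theorem imap_ev (X U : D) : imap F (β_ (U ⊗ X) (𝟙_ D)).hom =
    icomp (δ F U X ⊗ₘ μ F U X) (icomp
      (itensor (𝟙 (F.obj U) ⊗ₘ 𝟙 (F.obj X)) (𝟙 (F.obj X) ⊗ₘ 𝟙 (F.obj U)))
      (icomp (β_ (F.obj U ⊗ F.obj X) (𝟙_ C)).hom (ε F ⊗ₘ η F))) := by
  rw [icomp_pair, itensor_pair, pair_icomp, pair_icomp]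
  simp only [imap, Functor.map_braiding, id_tensorHom_id, Category.id_comp, Category.comp_id,
    Category.assoc, Functor.Monoidal.μ_δ, Functor.Monoidal.μ_δ_assoc, id_whiskerRight,
    MonoidalCategory.whiskerLeft_id]
  rw [← BraidedCategory.braiding_naturality_right_assoc, ← MonoidalCategory.whiskerLeft_comp_assoc,
    Functor.Monoidal.η_ε, MonoidalCategory.whiskerLeft_id, Category.id_comp,
    ← BraidedCategory.braiding_naturality_left, Functor.Monoidal.whiskerRight_δ_μ_assoc]

end

/-! ### The embedding of the generated subcategory -/

section

open Functor.LaxMonoidal Functor.OplaxMonoidal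

/-- The arrows `N ⟶ N` are the same on both sides, and at `I` only the identity scalar has to be
reached. The restriction `X = Y` matters, since `C` may have arrows between `I` and `N`. -/
theorem Star.toC_map_surjective {C : Type u} [Category.{v} C] [MonoidalCategory C] {N : C}
    {c : N ⊗ N ≅ N} (hs : ∀ s : 𝟙_ C ⟶ 𝟙_ C, s = 𝟙 (𝟙_ C)) {X Y : Star c}
    (h : X = Y) (g : toC.obj X ⟶ toC.obj Y) : ∃ f : X ⟶ Y, toC.map f = g := by
  subst h
  cases X
  · exact ⟨𝟙 unit, (hs g).symm⟩
  · exact ⟨ofEnd g, rfl⟩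

variable {C : Type u} [Category.{v} C] [MonoidalCategory C] [SymmetricCategory C]
  {N : C} {c : N ⊗ N ≅ N}

instance Star.braidedToC : (Star.toC (c := c)).Braided where
  braided X Y := mapC_braid X Y

variable [Traced C]

/-- At `I` both sides are scalars, hence equal; at `N` the trace over `I` is vanishing in `C`, and
the trace over `N` agrees by definition. -/
theorem Star.toC_map_tr (hs : ∀ s : 𝟙_ C ⟶ 𝟙_ C, s = 𝟙 (𝟙_ C)) {X Y : Star c} (U : Star c)
    (h : X = Y) (f : X ⊗ U ⟶ Y ⊗ U) : toC.map (Star.tr U h f) = Traced.tr (toC.obj U) (imap toC f) := by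
  subst h
  cases X <;> cases U
  · exact (hs _).symm
  · exact (hs _).symm
  · refine Eq.trans ?_ (Traced.vanishing_unit _).symm
    change toEnd f = (ρ_ N).inv ≫ ((ρ_ N).hom ≫ toEnd f ≫ (ρ_ N).inv) ≫ (ρ_ N).hom
    simp
  · rfl

/-- Composition in the generated subcategory is composition in `Int C`. -/
theorem imap_comp (hs : ∀ s : 𝟙_ C ⟶ 𝟙_ C, s = 𝟙 (𝟙_ C)) {X Y Z U V W : Star c}
    (h : X ⊗ W = Z ⊗ U) (f : X ⊗ V ⟶ Y ⊗ U) (g : Y ⊗ W ⟶ Z ⊗ V) :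
    imap Star.toC (Star.tr V h (icut f g)) = icomp (imap Star.toC f) (imap Star.toC g) := by
  rw [imap, Star.toC_map_tr hs, imap_icut, Traced.natural_left, Traced.natural_right]
  simp [icomp]

/-- The isomorphism of `Int C` given by two isomorphisms of `C`. -/
def pairIso (h : (intData C).Laws) {A B : IntObj C} (p : A.pos ≅ B.pos) (q : B.neg ≅ A.neg) :
    h.of A ≅ h.of B where
  hom := IntObj.ofPair p.hom q.hom
  inv := IntObj.ofPair p.inv q.inv
  hom_inv_id := pair_icomp_pair_id p q
  inv_hom_id := pair_icomp_pair_id p.symm q.symm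

variable (c) in
/-- The generated subcategory embeds into `Int C`. -/
def genEmbedding (h : (intData C).Laws) (hs : ∀ s : 𝟙_ C ⟶ 𝟙_ C, s = 𝟙 (𝟙_ C)) :
    Embedding (genData c) h.Obj where
  obj A := h.of ⟨Star.toC.obj A.1.pos, Star.toC.obj A.1.neg⟩
  map {A B} f := imap Star.toC (X := A.1.pos) (V := B.1.neg) (Y := B.1.pos) (U := A.1.neg) f
  map_injective {A B f g} e := Star.toC.map_injective (by
    rw [map_eq_imap Star.toC (X := A.1.pos) (V := B.1.neg) (Y := B.1.pos) (U := A.1.neg) f,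
      map_eq_imap Star.toC (X := A.1.pos) (V := B.1.neg) (Y := B.1.pos) (U := A.1.neg) g]
    exact congrArg (fun x => _ ≫ x ≫ _) e)
  map_id A := (imap_pair _ _ _).trans (congrArg₂ _ (Star.toC.map_id _) (Star.toC.map_id _))
  map_comp {A B E} f g := imap_comp hs (Gen.tensor_eq A.2 E.2) f g
  ε := pairIso h (A := IntObj.unit C) (B := ⟨Star.toC.obj (𝟙_ (Star c)), Star.toC.obj (𝟙_ (Star c))⟩)
    (Functor.Monoidal.εIso (Star.toC (c := c))) (Functor.Monoidal.εIso (Star.toC (c := c))).symm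
  μ A B := pairIso h
    (A := IntObj.tensor ⟨Star.toC.obj A.1.pos, Star.toC.obj A.1.neg⟩
      ⟨Star.toC.obj B.1.pos, Star.toC.obj B.1.neg⟩)
    (B := ⟨Star.toC.obj (A.1.pos ⊗ B.1.pos), Star.toC.obj (B.1.neg ⊗ A.1.neg)⟩)
    (Functor.Monoidal.μIso Star.toC A.1.pos B.1.pos)
    (Functor.Monoidal.μIso Star.toC B.1.neg A.1.neg).symm
  map_tensorHom {A B A' B'} f g := imap_itensor_eq_icomp Star.toC
    (X := A.1.pos) (V := B.1.neg) (Y := B.1.pos) (U := A.1.neg)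
    (X' := A'.1.pos) (V' := B'.1.neg) (Y' := B'.1.pos) (U' := A'.1.neg) f g
  map_assoc A B E := imap_assoc Star.toC A.1.pos B.1.pos E.1.pos A.1.neg B.1.neg E.1.neg
  map_assocInv A B E := imap_assocInv Star.toC A.1.pos B.1.pos E.1.pos A.1.neg B.1.neg E.1.neg
  map_lunit A := imap_lunit Star.toC A.1.pos A.1.neg
  map_lunitInv A := imap_lunitInv Star.toC A.1.pos A.1.neg
  map_runit A := imap_runit Star.toC A.1.pos A.1.neg
  map_runitInv A := imap_runitInv Star.toC A.1.pos A.1.neg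
  map_braid A B := imap_braid Star.toC A.1.pos B.1.pos A.1.neg B.1.neg
  δ A := Iso.refl _
  map_dualHom {A B} f := (imap_idual Star.toC
    (X := A.1.pos) (V := B.1.neg) (Y := B.1.pos) (U := A.1.neg) f).trans
      ((id_icomp _).trans (icomp_id _)).symm
  map_coev A := imap_coev Star.toC A.1.pos A.1.neg
  map_ev A := imap_ev Star.toC A.1.pos A.1.neg
  dual_dual _ := rfl
  dualHom_dualHom {A B} f := heq_of_eq
    (idual_idual (X := A.1.pos) (V := B.1.neg) (Y := B.1.pos) (U := A.1.neg) f)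

end

/-! ### Transport of an embedding along isomorphisms of objects -/

namespace Embedding

variable {T : Type w} {P : CCData.{v} T} {K : Type u} [Category.{v} K]
    [MonoidalCategory K] [SymmetricCategory K] [CompactClosed K]

/-- Change the objects of an embedding up to isomorphism. -/
def conj (e : Embedding P K) {obj : T → K} (φ : ∀ A, obj A ≅ e.obj A) : Embedding P K where
  obj := obj
  map {A B} f := (φ A).hom ≫ e.map f ≫ (φ B).inv
  map_injective h := e.map_injective (by simpa using h)
  map_id A := by simp [e.map_id]
  map_comp f g := by simp [e.map_comp]
  ε := e.ε ≪≫ (φ _).symm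
  μ A B := (φ A ⊗ᵢ φ B) ≪≫ e.μ A B ≪≫ (φ _).symm
  map_tensorHom f g := by
    simp [e.map_tensorHom, ← tensorHom_comp_tensorHom_assoc]
  map_assoc A B E := by
    simp [e.map_assoc]
    rw [tensorHom_comp_whiskerRight_assoc, whiskerLeft_comp_tensorHom_assoc]
    simp
    rw [whisker_exchange_assoc, ← reassoc_of% MonoidalCategory.tensorHom_def',
      associator_naturality_assoc, tensorHom_comp_whiskerLeft_assoc, tensorHom_comp_tensorHom]
    simp
    rw [whisker_exchange_assoc]
    simp
  map_assocInv A B E := by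
    simp [e.map_assocInv]
    rw [tensorHom_comp_whiskerLeft_assoc, whiskerRight_comp_tensorHom_assoc]
    simp
    rw [← whisker_exchange_assoc, ← reassoc_of% MonoidalCategory.tensorHom_def,
      associator_inv_naturality_assoc, tensorHom_comp_whiskerRight_assoc, tensorHom_comp_tensorHom]
    simp
    rw [← whisker_exchange_assoc]
    simp
  map_lunit A := by
    simp [e.map_lunit]
    rw [tensorHom_comp_whiskerRight_assoc]
    simp
    rw [whisker_exchange_assoc, leftUnitor_naturality]
  map_lunitInv A := by
    simp [e.map_lunitInv]
    rw [whiskerRight_comp_tensorHom_assoc]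
    simp
    rw [← whisker_exchange_assoc, ← leftUnitor_inv_naturality_assoc]
  map_runit A := by
    simp [e.map_runit]
    rw [tensorHom_comp_whiskerLeft_assoc]
    simp
    rw [← whisker_exchange_assoc, rightUnitor_naturality]
  map_runitInv A := by
    simp [e.map_runitInv]
    rw [whiskerLeft_comp_tensorHom_assoc]
    simp
    rw [whisker_exchange_assoc, ← rightUnitor_inv_naturality_assoc]
  map_braid A B := by
    simp [e.map_braid]
  δ A := φ (P.dual A) ≪≫ e.δ A ≪≫ CompactClosed.dual.mapIso (φ A).op
  map_dualHom f := by
    simp [e.map_dualHom]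
  map_coev A := by
    simp [e.map_coev]
    rw [whiskerLeft_comp_tensorHom_assoc]
    simp
    rw [whisker_exchange_assoc, whisker_exchange_assoc, reassoc_of% coev_comp (φ A).hom,
      ← MonoidalCategory.whiskerLeft_comp_assoc, ← Functor.map_comp, ← op_comp]
    simp
  map_ev A := by
    simp [e.map_ev]
    rw [tensorHom_comp_whiskerRight_assoc]
    simp
    rw [reassoc_of% ev_comp (φ A).hom, whisker_exchange_assoc,
      ← MonoidalCategory.whiskerLeft_comp_assoc, Iso.inv_hom_id]
    simp
  dual_dual := e.dual_dual
  dualHom_dualHom := e.dualHom_dualHom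

theorem full_conj (e : Embedding P K) {obj : T → K} (φ : ∀ A, obj A ≅ e.obj A) (h : P.Laws)
    (he : ∀ {A B} (g : e.obj A ⟶ e.obj B), ∃ f, e.map f = g) : ((e.conj φ).functor h).Full where
  map_surjective {A B} g := by
    change obj A ⟶ obj B at g
    obtain ⟨f, hf⟩ := he ((φ A).inv ≫ g ≫ (φ B).hom)
    refine ⟨f, ?_⟩
    change (φ A).hom ≫ e.map f ≫ (φ B).inv = g
    rw [hf]
    simp

end Embedding

/-- The isomorphism `φ'` replacing the dual object occurs in the tensor comparison and, inverted, in
the dual comparison, so it cancels. What remains is `app` transported along `φ`. -/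
theorem transport_eq {K : Type u} [Category.{v} K] [MonoidalCategory K] [SymmetricCategory K]
    [CompactClosed K] {X X' Y : K} (φ : X ≅ Y) (app : Reflexivity Y) (φ' : X' ≅ dualObj Y) :
    𝟙 X ≫ ((φ' ⊗ᵢ φ) ≪≫ app.symm ≪≫ φ.symm).inv ≫
        (φ' ≪≫ Iso.refl _ ≪≫ CompactClosed.dual.mapIso φ.op).hom ▷ X =
      (app.transport φ).hom := by
  simp [Reflexivity.transport, MonoidalCategory.tensorHom_def']

/-! ### The category generated by `(N, N)` strictifies -/

section

variable {C : Type u} [Category.{v} C] [MonoidalCategory C] [SymmetricCategory C] [Traced C]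
  {N : C} {c : N ⊗ N ≅ N} (h : (intData C).Laws)

variable (c) in
/-- The object `(N, N)` of `Int C` is reflexive. -/
def codeReflexivity : Reflexivity (h.of (diag N)) :=
  pairIso h (A := diag N) (B := IntObj.tensor (IntObj.dual (diag N)) (diag N)) c.symm c

theorem imap_toC_surjective {C : Type u} [Category.{v} C] [MonoidalCategory C]
    [SymmetricCategory C] {N : C} {c : N ⊗ N ≅ N} (hs : ∀ s : 𝟙_ C ⟶ 𝟙_ C, s = 𝟙 (𝟙_ C)) {X Y U V : Star c} (e : X ⊗ V = Y ⊗ U)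
    (g : Star.toC.obj X ⊗ Star.toC.obj V ⟶ Star.toC.obj Y ⊗ Star.toC.obj U) :
    ∃ f : X ⊗ V ⟶ Y ⊗ U, imap Star.toC f = g := by
  obtain ⟨f, hf⟩ := Star.toC_map_surjective hs e
    (Functor.OplaxMonoidal.δ Star.toC X V ≫ g ≫ Functor.LaxMonoidal.μ Star.toC Y U)
  exact ⟨f, by rw [imap, hf]; simp⟩

/-- The objects of `Int C` corresponding to the generated objects when `(N, N)` is replaced by
`X`. -/
def genObj (X : h.Obj) (A : {A : IntObj (Star c) // Gen c A}) : h.Obj :=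
  match A.1.pos with
  | Star.unit => h.of (IntObj.unit C)
  | Star.pt => X

/-- At the unit the two objects agree by definition, and mixed pairs are not generated. -/
def genObjIso (hs : ∀ s : 𝟙_ C ⟶ 𝟙_ C, s = 𝟙 (𝟙_ C)) {X : h.Obj} (φ : X ≅ h.of (diag N)) :
    ∀ A : {A : IntObj (Star c) // Gen c A}, genObj h X A ≅ (genEmbedding c h hs).obj A
  | ⟨⟨Star.unit, Star.unit⟩, _⟩ => Iso.refl (h.of (IntObj.unit C))
  | ⟨⟨Star.pt, Star.pt⟩, _⟩ => φ
  | ⟨⟨Star.unit, Star.pt⟩, hA⟩ => absurd hA.cases_eq (by simp)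
  | ⟨⟨Star.pt, Star.unit⟩, hA⟩ => absurd hA.cases_eq (by simp)

/-- The generated category is both source and target. Conjugating its embedding by `φ` makes the
image of `(N, N)` equal to `X`, not merely isomorphic to it. -/
theorem exists_full_strictification (hs : ∀ s : 𝟙_ C ⟶ 𝟙_ C, s = 𝟙 (𝟙_ C)) (X : h.Obj) (φ : X ≅ h.of (diag N))
    (hGen : (genData c).Laws) :
    ∃ σ : MonoidalStrictification X ((codeReflexivity c h).transport φ) hGen.Obj,
      σ.Γ.Full ∧ σ.E.obj σ.N = hGen.of (genBase c) := by
  let e := (genEmbedding c h hs).conj (genObjIso h hs φ)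
  have e₁ : e.map ((genData c).id (genBase c)) = 𝟙 X := e.map_id (genBase c)
  refine ⟨e.strictification hGen (genBase c) rfl ((codeReflexivity c h).transport φ) ?_, ?_, rfl⟩
  -- As `(N, N)` is its own dual, `φ` also serves as the isomorphism at the dual object.
  · exact (congrArg (· ≫ _) e₁).trans
      (transport_eq (X' := X) φ (codeReflexivity c h) φ)
  · exact Embedding.full_conj _ _ _ fun {A B} g =>
      imap_toC_surjective hs (Gen.tensor_eq A.2 B.2) g

end

end StrictRefl

/-! ### The theorem -/

theorem mainTheorem1 (C : Type u) [Category.{v} C] [MonoidalCategory C]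
    [SymmetricCategory C] [StrictRefl.Traced C]
    (trivial_scalars : ∀ s : 𝟙_ C ⟶ 𝟙_ C, s = 𝟙 (𝟙_ C)) :
    ∃ hInt : (StrictRefl.intData C).Laws,
      (∀ (X : hInt.Obj) (app : StrictRefl.Reflexivity X),
        ∃ D : StrictRefl.SmallCompactClosed.{v},
          Nonempty (StrictRefl.MonoidalStrictification X app D.carrier)) ∧
      (∀ (N : C) (c : N ⊗ N ≅ N),
        ∃ hGen : (StrictRefl.genData c).Laws,
        ∃ appN : StrictRefl.Reflexivity (hInt.of (StrictRefl.diag N)),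
          appN.hom = StrictRefl.codeApp c ∧
          ∀ (X : hInt.Obj) (φ : X ≅ hInt.of (StrictRefl.diag N)),
            ∃ σ : StrictRefl.MonoidalStrictification X (appN.transport φ) hGen.Obj,
              σ.Γ.Full ∧ σ.E.obj σ.N = hGen.of (StrictRefl.genBase c)) := by
  have hInt := StrictRefl.intData_laws C
  refine ⟨hInt, StrictRefl.exists_strictification hInt, fun N c => ?_⟩
  have hGen := (StrictRefl.genEmbedding c hInt trivial_scalars).laws
  exact ⟨hGen, StrictRefl.codeReflexivity c hInt, rfl, fun X φ =>
    StrictRefl.exists_full_strictification hInt trivial_scalars X φ hGen⟩
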